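/- A Boolean relation of arity $r$ is a set $R\subseteq\{0,1\}^r$; a constraint language is a finite set $\Gamma$ of Boolean relations. Write $R_{\mathrm{zero}}=\{0\}$, $R_{\mathrm{one}}=\{1\}$ (unary relations) and $\Gamma_{\mathrm{pin}}=\{R_{\mathrm{zero}},R_{\mathrm{one}}\}$. An instance $I=(V,C)$ over $\Gamma$ is a finite set $V$ of variables and a set $C$ of constraints $R(v_1,\dots,v_r)$ with $R\in\Gamma$ and $v_1,\dots,v_r\in V$ (not necessarily distinct); $Z(I)$ is the number of assignments $\sigma:V\to\{0,1\}$ with $(\sigma(v_1),\dots,\sigma(v_r))\in R$ for every constraint $R(v_1,\dots,v_r)\in C$. The degree of a variable is its number of appearances in the scopes of the constraints, counted with multiplicity within each scope, and the degree of $I$ is the maximum degree of its variables. $\#\mathrm{CSP}(\Gamma)$ is the problem of computing $Z(I)$ for a given instance $I$ over $\Gamma$, and $\#\mathrm{CSP}_d(\Gamma)$ is its restriction to instances of degree at most $d$. $\Gamma$ $d$-simulates equality if for every $k\ge 2$ there are $\ell\ge k$, $m\ge 1$ and an instance over $\Gamma\cup\Gamma_{\mathrm{pin}}$ with variables $x_1,\dots,x_\ell$,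 of degree at most $d$ and with each of $x_1,\dots,x_k$ of degree at most $d-1$, that has exactly $m$ satisfying assignments with $x_1=\dots=x_k=0$, exactly $m$ with $x_1=\dots=x_k=1$, and no others. A randomized approximation scheme (RAS) for a counting problem $f$ produces, on an instance $x$ and $\varepsilon\in(0,1)$, a random natural number $Y$ with $\Pr(e^{-\varepsilon}f(x)\le Y\le e^{\varepsilon}f(x))\ge 3/4$. An approximation-preserving (AP-) reduction from $f$ to $g$ is a probabilistic oracle Turing machine $M$ taking as input an instance $x$ of $f$ and $\varepsilon\in(0,1)$ (given by a finite binary expansion) such that (i) every oracle call of $M$ is a pair $(w,\delta)$ with $w$ an instance of $g$ and $0<\delta<1$, where $\delta^{-1}$ is bounded by a polynomial in $|x|$ and $\varepsilon^{-1}$; (ii) $M$ is a RAS for $f$ whenever the oracle is a RAS for $g$; (iii) the running time of $M$ is bounded by a polynomial in $|x|$ and $\varepsilon^{-1}$. **Proposition.** Let $\Gamma$ be a constraint language and $d$ a natural number. If $\Gamma$ $d$-simulates equality, then there is an AP-reduction from $\#\mathrm{CSP}(\Gamma)$ to $\#\mathrm{CSP}_d(\Gamma\cup\{R_{\mathrm{zero}},R_{\mathrm{one}}\})$.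 -/

import Mathlib

noncomputable section

namespace BoolCSP

/-! ### Boolean relations, constraint languages and CSP instances -/

/-- A Boolean relation: an arity `r` together with a subset of `{0,1}^r`. -/
abbrev BoolRel : Type := Σ r : ℕ, Finset (Fin r → Bool)

/-- A constraint language is a finite set of Boolean relations. -/
abbrev ConstraintLanguage : Type := Finset BoolRel

/-- `R_zero = {0}`. -/
def relZero : BoolRel := ⟨1, {fun _ => false}⟩

/-- `R_one = {1}`. -/
def relOne : BoolRel := ⟨1, {fun _ => true}⟩

/-- `Γ_pin = {R_zero, R_one}`. -/
def pinLanguage : ConstraintLanguage := {relZero, relOne}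

/-- The constraints `R(v₁, …, v_r)` over the variables `V` with `R ∈ Γ`;
the variables of the scope need not be distinct. -/
abbrev Cons (Γ : ConstraintLanguage) (V : Type) : Type :=
  Σ R : {R : BoolRel // R ∈ Γ}, (Fin R.1.1 → V)

/-- A CSP instance over `Γ`: the variables are `0, …, n - 1`, and the set of constraints is given
by a list of its elements without repetitions. -/
structure CSPInstance (Γ : ConstraintLanguage) where
  n : ℕ
  constraints : List (Cons Γ (Fin n))
  nodup : constraints.Nodup

namespace CSPInstance

variable {Γ : ConstraintLanguage}

/-- The assignment `s` satisfies every constraint of the instance. -/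
def Satisfies (I : CSPInstance Γ) (s : Fin I.n → Bool) : Prop :=
  ∀ c ∈ I.constraints, (fun i => s (c.2 i)) ∈ c.1.1.2

/-- `Z(I)`, the number of satisfying assignments. -/
def Z (I : CSPInstance Γ) : ℕ := Nat.card {s : Fin I.n → Bool // I.Satisfies s}

/-- The number of times the variable `v` appears among the constraints
(it appears twice in `R(v, v)`). -/
def varDegree (I : CSPInstance Γ) (v : Fin I.n) : ℕ :=
  (I.constraints.map fun c => (Finset.univ.filter fun i => c.2 i = v).card).sum

/-- The degree of an instance: the greatest number of appearances of a variable. -/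
def degree (I : CSPInstance Γ) : ℕ := Finset.univ.sup I.varDegree

end CSPInstance

/-! ### Simulating equality -/

/-- `Γ` `d`-simulates the `k`-ary equality relation: some instance over `Γ ∪ Γ_pin` with variables
`x₁, …, x_ℓ` (`k ≤ ℓ`), of degree at most `d`, in which each of `x₁, …, x_k` has degree at most
`d - 1`, has, for some `m ≥ 1`, exactly `m` satisfying assignments with `x₁ = ⋯ = x_k = 0`,
exactly `m` with `x₁ = ⋯ = x_k = 1`, and no others. -/
def SimulatesEq (Γ : ConstraintLanguage) (d k : ℕ) : Prop :=
  ∃ (I : CSPInstance (Γ ∪ pinLanguage)) (hk : k ≤ I.n) (m : ℕ),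
    1 ≤ m ∧
    (∀ b : Bool,
      Nat.card {s : Fin I.n → Bool //
        I.Satisfies s ∧ ∀ i : Fin k, s (Fin.castLE hk i) = b} = m) ∧
    (∀ s : Fin I.n → Bool, I.Satisfies s →
      ∃ b : Bool, ∀ i : Fin k, s (Fin.castLE hk i) = b) ∧
    I.degree ≤ d ∧
    ∀ i : Fin k, I.varDegree (Fin.castLE hk i) + 1 ≤ d

/-- `Γ` `d`-simulates equality. -/
def SimulatesEquality (Γ : ConstraintLanguage) (d : ℕ) : Prop :=
  ∀ k : ℕ, 2 ≤ k → SimulatesEq Γ d k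

/-! ### Counting problems -/

/-- A counting problem: instances, presented as words over a finite alphabet, and the natural
number to be computed for each instance. -/
structure CountingProblem where
  Sym : Type
  [finite_sym : Finite Sym]
  Inst : Type
  encode : Inst → List Sym
  encode_injective : Function.Injective encode
  value : Inst → ℕ

/-- The alphabet for instances over `Γ`: a unary digit `inl true`, a terminator `inl false`, and
a symbol for each relation of `Γ`. -/
abbrev CSPSym (Γ : ConstraintLanguage) : Type := Bool ⊕ {R : BoolRel // R ∈ Γ}

/-- A natural number in unary, with terminator. -/
def unary (Γ : ConstraintLanguage) (a : ℕ) : List (CSPSym Γ) :=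
  List.replicate a (Sum.inl true) ++ [Sum.inl false]

/-- A constraint is written as its relation symbol followed by the variables of its scope. -/
def encodeCons {Γ : ConstraintLanguage} {n : ℕ} (c : Cons Γ (Fin n)) : List (CSPSym Γ) :=
  Sum.inr c.1 :: (List.ofFn fun i => unary Γ (c.2 i)).flatten

/-- An instance is written as its number of variables followed by its constraints. -/
def CSPInstance.encode {Γ : ConstraintLanguage} (I : CSPInstance Γ) : List (CSPSym Γ) :=
  unary Γ I.n ++ (I.constraints.map encodeCons).flatten

theorem unary_append_inj {Γ : ConstraintLanguage} {a b : ℕ} {s t : List (CSPSym Γ)}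
    (h : unary Γ a ++ s = unary Γ b ++ t) : a = b ∧ s = t := by
  induction a generalizing b with
  | zero => cases b <;> simp_all [unary, List.replicate_succ]
  | succ a ih =>
    cases b with
    | zero => simp [unary, List.replicate_succ] at h
    | succ b =>
      have h' : unary Γ a ++ s = unary Γ b ++ t := by
        simpa [unary, List.replicate_succ] using h
      exact ⟨congrArg _ (ih h').1, (ih h').2⟩

theorem scope_append_inj {Γ : ConstraintLanguage} {n r : ℕ} {f g : Fin r → Fin n}
    {s t : List (CSPSym Γ)}
    (h : (List.ofFn fun i => unary Γ (f i)).flatten ++ s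
      = (List.ofFn fun i => unary Γ (g i)).flatten ++ t) : f = g ∧ s = t := by
  induction r with
  | zero => exact ⟨Subsingleton.elim _ _, by simpa using h⟩
  | succ r ih =>
    simp only [List.ofFn_succ, List.flatten_cons, List.append_assoc] at h
    obtain ⟨h0, h1⟩ := unary_append_inj h
    obtain ⟨h2, h3⟩ := ih (f := fun i => f i.succ) (g := fun i => g i.succ) h1
    refine ⟨funext fun i => ?_, h3⟩
    refine Fin.cases (Fin.ext h0) (fun j => congrFun h2 j) i

theorem CSPInstance.encode_injective {Γ : ConstraintLanguage} :
    Function.Injective (CSPInstance.encode (Γ := Γ)) := by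
  rintro ⟨n, l, hl⟩ ⟨n', l', hl'⟩ h
  obtain ⟨h0, h1⟩ := unary_append_inj h
  simp only at h0
  subst h0
  have key : ∀ (l l' : List (Cons Γ (Fin n))),
      (l.map encodeCons).flatten = (l'.map encodeCons).flatten → l = l' := by
    intro l
    induction l with
    | nil => intro l' h; cases l' <;> simp_all [encodeCons]
    | cons c l ih =>
      intro l' h
      cases l' with
      | nil => simp [encodeCons] at h
      | cons c' l' =>
        obtain ⟨R, f⟩ := c
        obtain ⟨R', f'⟩ := c'
        simp only [encodeCons, List.map_cons, List.flatten_cons, List.cons_append,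
          List.cons.injEq, Sum.inr.injEq] at h
        obtain ⟨h2, h3⟩ := h
        subst h2
        obtain ⟨h4, h5⟩ := scope_append_inj h3
        rw [h4, ih l' h5]
  have := key l l' h1
  subst this
  rfl

/-- The problem `#CSP(Γ)`. -/
def sharpCSP (Γ : ConstraintLanguage) : CountingProblem where
  Sym := CSPSym Γ
  Inst := CSPInstance Γ
  encode := CSPInstance.encode
  encode_injective := CSPInstance.encode_injective
  value := CSPInstance.Z

/-- The problem `#CSP_d(Γ)`: the restriction of `#CSP(Γ)` to instances of degree at most `d`. -/
def sharpCSPd (d : ℕ) (Γ : ConstraintLanguage) : CountingProblem where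
  Sym := CSPSym Γ
  Inst := {I : CSPInstance Γ // I.degree ≤ d}
  encode I := I.1.encode
  encode_injective := CSPInstance.encode_injective.comp Subtype.val_injective
  value I := I.1.Z

/-! ### Randomized approximation schemes -/

/-- The number `0.b₁b₂b₃…` written in binary as the word `b₁b₂b₃…`. -/
def binFrac : List Bool → ℝ
  | [] => 0
  | b :: s => ((if b then 1 else 0) + binFrac s) / 2

/-- The word `s` is the binary expansion of an error bound in `(0,1)`. -/
def IsTolerance (s : List Bool) : Prop := 0 < binFrac s ∧ binFrac s < 1

/-- A family of random variables, one for every word and every (word for an) error bound,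
is a randomized approximation scheme for `f`: on an instance `x` and `0 < ε < 1`
it yields `Y` with `Pr(e^{-ε} f(x) ≤ Y ≤ e^ε f(x)) ≥ 3/4`. -/
def IsRAS (f : CountingProblem) (D : List f.Sym → List Bool → PMF ℕ) : Prop :=
  ∀ (x : f.Inst) (s : List Bool), IsTolerance s →
    3 / 4 ≤ (D (f.encode x) s).toOuterMeasure
      {Y : ℕ | Real.exp (-binFrac s) * f.value x ≤ Y ∧ (Y : ℝ) ≤ Real.exp (binFrac s) * f.value x}

/-! ### Probabilistic oracle Turing machines -/

/-- The distinguished stacks of an oracle machine: the input word, the input error bound, the word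
and the error bound of an oracle call, the oracle's answer, and the output. -/
inductive Port
  | input | eps | query | delta | answer | output
  deriving DecidableEq

/-- The stack alphabets: `A` for the input word, `B` for oracle calls, bits for numbers, and
alphabets `C w` for the work stacks. -/
def StackSym (A B : Type) {W : Type} (C : W → Type) : Port ⊕ W → Type
  | Sum.inl Port.input => A
  | Sum.inl Port.query => B
  | Sum.inl _ => Bool
  | Sum.inr w => C w

/-- What a machine does at a label: an ordinary statement of a multi-stack Turing machine, a fair
coin flip that decides the next label, or an oracle call. -/
inductive Instr {K : Type} (Γ : K → Type) (Λ σ : Type)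
  | det (q : Turing.TM2.Stmt Γ Λ σ)
  | flip (next : Bool → Λ)
  | call (next : Λ)

/-- A probabilistic oracle Turing machine with input alphabet `A` and query alphabet `B`:
a multi-stack Turing machine with finitely many stacks, finite stack alphabets, finitely many
labels and internal states, which may also flip coins and call an oracle. -/
structure OracleTM (A B : Type) where
  W : Type
  [decEq_W : DecidableEq W]
  [finite_W : Finite W]
  C : W → Type
  [finite_C : ∀ w, Finite (C w)]
  L : Type
  [finite_L : Finite L]
  S : Type
  [finite_S : Finite S]
  main : L
  initial : S
  prog : L → Instr (StackSym A B C) L S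

attribute [instance] OracleTM.decEq_W

namespace OracleTM

variable {A B : Type} (M : OracleTM A B)

abbrev Stacks : Type := ∀ k : Port ⊕ M.W, List (StackSym A B M.C k)

abbrev Cfg : Type := Turing.TM2.Cfg (StackSym A B M.C) M.L M.S

/-- Initially, the input word `x` and the error bound `s` stand on their stacks, first symbol on
top, and all other stacks are empty. -/
def init (x : List A) (s : List Bool) : M.Cfg where
  l := some M.main
  var := M.initial
  stk
    | Sum.inl Port.input => x
    | Sum.inl Port.eps => s
    | Sum.inl Port.query => []
    | Sum.inl Port.delta => []
    | Sum.inl Port.answer => []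
    | Sum.inl Port.output => []
    | Sum.inr _ => []

/-- The word of an oracle call, read from the top of the stack. -/
def queryWord (S : M.Stacks) : List B := S (Sum.inl Port.query)

/-- The error bound of an oracle call, read from the top of the stack. -/
def queryTol (S : M.Stacks) : List Bool := S (Sum.inl Port.delta)

/-- The number on the output stack, in binary with the least significant bit on top. -/
def output (c : M.Cfg) : ℕ :=
  List.foldr Nat.bit 0 (show List Bool from c.stk (Sum.inl Port.output))

/-- The effect of the oracle's answer `y`: the query is erased, and `y` is written in binary on the
answer stack, least significant bit on top. -/
def receive (S : M.Stacks) (y : ℕ) : M.Stacks :=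
  Function.update
    (Function.update
      (Function.update S (Sum.inl Port.query) ([] : List B))
      (Sum.inl Port.delta) ([] : List Bool))
    (Sum.inl Port.answer) (show List Bool from Nat.bits y)

/-- The distribution of the next configuration when oracle calls are answered by independent
samples from `O`. A halted machine stays as it is. -/
def stepDist (O : List B → List Bool → PMF ℕ) : M.Cfg → PMF M.Cfg
  | ⟨none, v, S⟩ => PMF.pure ⟨none, v, S⟩
  | ⟨some l, v, S⟩ =>
    match M.prog l with
    | Instr.det q => PMF.pure (Turing.TM2.stepAux q v S)
    | Instr.flip next => (PMF.uniformOfFintype Bool).map fun b => ⟨some (next b), v, S⟩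
    | Instr.call next =>
      (O (M.queryWord S) (M.queryTol S)).map fun y => ⟨some next, v, M.receive S y⟩

/-- The distribution of the configuration after `t` steps. -/
def runDist (O : List B → List Bool → PMF ℕ) : ℕ → M.Cfg → PMF M.Cfg
  | 0, c => PMF.pure c
  | t + 1, c => (M.stepDist O c).bind (runDist O t)

/-- The possible next configurations, whatever the coins and the oracle's answers are. -/
def succs : M.Cfg → Set M.Cfg
  | ⟨none, v, S⟩ => {⟨none, v, S⟩}
  | ⟨some l, v, S⟩ =>
    match M.prog l with
    | Instr.det q => {Turing.TM2.stepAux q v S}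
    | Instr.flip next => {c | ∃ b : Bool, c = ⟨some (next b), v, S⟩}
    | Instr.call next => {c | ∃ y : ℕ, c = ⟨some next, v, M.receive S y⟩}

/-- The configuration `c'` occurs on some computation path that starts in `c`. -/
def Reaches (c c' : M.Cfg) : Prop := Relation.ReflTransGen (fun a b => b ∈ M.succs a) c c'

/-- Every computation path that starts in `c` halts within `t` steps. -/
def HaltsWithin : ℕ → M.Cfg → Prop
  | 0, c => c.l = none
  | t + 1, c => ∀ c' ∈ M.succs c, HaltsWithin t c'

/-- The machine is about to call the oracle. -/
def IsCall (c : M.Cfg) : Prop := ∃ l next, c.l = some l ∧ M.prog l = Instr.call next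

end OracleTM

/-! ### Approximation-preserving reductions -/

/-- The machine `M` is an approximation-preserving reduction from `f` to `g`. Here `T x s` is a
bound for the running time on the word `x` and the error bound `ε` with binary expansion `s`, and
`a * (|x| + ε⁻¹) ^ b` is the polynomial in `|x|` and `ε⁻¹` that bounds it. -/
def IsAPReduction (f g : CountingProblem) (M : OracleTM f.Sym g.Sym) : Prop :=
  ∃ (T : List f.Sym → List Bool → ℕ) (a b : ℕ),
    -- every oracle call is an instance of `g` with an error bound `0 < δ < 1`
    -- such that `δ⁻¹` is at most polynomial in `|x|` and `ε⁻¹`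
    (∀ (x : f.Inst) (s : List Bool), IsTolerance s →
      ∀ c, M.Reaches (M.init (f.encode x) s) c → M.IsCall c →
        (∃ w : g.Inst, M.queryWord c.stk = g.encode w) ∧
        IsTolerance (M.queryTol c.stk) ∧
        (binFrac (M.queryTol c.stk))⁻¹ ≤ a * ((f.encode x).length + (binFrac s)⁻¹) ^ b) ∧
    -- whenever the oracle is a randomized approximation scheme for `g`,
    -- the output of `M` is a randomized approximation scheme for `f`
    (∀ O : List g.Sym → List Bool → PMF ℕ, IsRAS g O →
      IsRAS f fun x s => (M.runDist O (T x s) (M.init x s)).map M.output) ∧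
    -- the running time is polynomial in `|x|` and `ε⁻¹`
    (∀ (x : f.Inst) (s : List Bool), IsTolerance s →
      M.HaltsWithin (T (f.encode x) s) (M.init (f.encode x) s) ∧
      (T (f.encode x) s : ℝ) ≤ a * ((f.encode x).length + (binFrac s)⁻¹) ^ b)

/-- `f ≤_AP g`. -/
def APReducible (f g : CountingProblem) : Prop :=
  ∃ M : OracleTM f.Sym g.Sym, IsAPReduction f g M

end BoolCSP

end

/-! The instances that simulate equality come with no bound on their size and no procedure for
finding them, so a machine cannot use a new one for every number of appearances. Only the instance
for `k = 3` is used. It yields one gadget of constant size, a `RingElem`, that the finite control of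
a machine can contain. The gadget has terminals `l`, `x`, `r` and satisfies `l = val → x = val → r =
val`. Copies closed up into a ring, each `r` being the next `l`, carry the value `val` all the way
round, so all terminals of the ring agree. The other variables are then determined uniquely. If
every variable becomes a ring and each of its appearances uses the `x` of a different copy, the
degree stays at most `d` and the number of satisfying assignments does not change at all
(`card_sat_allCons`).

The gadget exists for the following reasons (`exists_ringElem`). If `d ≥ 3`, forced equality of two
variables is incompatible with all relations being `UpClosed`, since otherwise one of the two could
be raised alone. The same holds with 0 and 1 exchanged. A relation that is not `UpClosed` has a face
on which two coordinates satisfy an implication, with a single tuple at each of two opposite corners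
(`faceLink_of_not_upClosed`). Pinning the other coordinates of that face gives a `Link` of degree 2,
with terminals of degree 1. Composing links gives some `α → α`, and two copies of it form a gadget
of degree 3. If `d = 2`, no degree is left for this construction. Instead, two satisfying
assignments of opposite terminal values at minimal Hamming distance are taken, and the variables on
which they agree are pinned after being split into their appearances (`exists_ringElem_two`). If `d
≤ 1`, the terminals are unconstrained and equality cannot be forced.

The machine writes the ring instance, rounds `ε` down to a power of two, calls the oracle once and
copies the answer (`exists_singleCall`). Since the count is preserved, so is the guarantee of
approximation. Only a prefix of the answer, of length linear in the input, is copied, because the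
running time must be bounded for every answer, while good answers fit into the prefix. -/

noncomputable section

namespace BoolCSP

section

/-! ### Deterministic runs of oracle machines -/

namespace OracleTM

variable {A B : Type} (M : OracleTM A B)

/-- The machine takes the deterministic step from `c` to `c'`. -/
def DetStep (c c' : M.Cfg) : Prop :=
  ∃ l q, c.l = some l ∧ M.prog l = Instr.det q ∧ c' = Turing.TM2.stepAux q c.var c.stk

/-- The machine gets from `c` to `c'` in exactly `t` deterministic steps. -/
inductive DetRun : ℕ → M.Cfg → M.Cfg → Prop
  | refl (c) : DetRun 0 c c
  | head {t c c' e} : M.DetStep c c' → DetRun t c' e → DetRun (t + 1) c e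

/-- The machine gets from `c` to `c'` in at most `n` deterministic steps. -/
def RunLe (n : ℕ) (c c' : M.Cfg) : Prop := ∃ t ≤ n, M.DetRun t c c'

variable {M}

theorem DetRun.trans {s t : ℕ} {c c' c'' : M.Cfg} (h : M.DetRun s c c') (h' : M.DetRun t c' c'') :
    M.DetRun (s + t) c c'' := by
  induction h with
  | refl c => simpa using h'
  | head h₁ _ ih => rw [Nat.add_right_comm]; exact DetRun.head h₁ (ih h')

theorem RunLe.refl (n : ℕ) (c : M.Cfg) : M.RunLe n c c := ⟨0, Nat.zero_le _, DetRun.refl c⟩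

theorem RunLe.trans {m n : ℕ} {c c' c'' : M.Cfg} (h : M.RunLe m c c') (h' : M.RunLe n c' c'') :
    M.RunLe (m + n) c c'' := by
  obtain ⟨s, hs, h⟩ := h
  obtain ⟨t, ht, h'⟩ := h'
  exact ⟨s + t, by omega, h.trans h'⟩

theorem RunLe.mono {m n : ℕ} {c c' : M.Cfg} (h : M.RunLe m c c') (hmn : m ≤ n) :
    M.RunLe n c c' := by
  obtain ⟨s, hs, h⟩ := h
  exact ⟨s, hs.trans hmn, h⟩

theorem RunLe.of_step {l : M.L} {q} {v : M.S} {S : M.Stacks} {c' : M.Cfg}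
    (hq : M.prog l = Instr.det q) (h : Turing.TM2.stepAux q v S = c') :
    M.RunLe 1 ⟨some l, v, S⟩ c' :=
  ⟨1, le_rfl, DetRun.head ⟨l, q, rfl, hq, h.symm⟩ (DetRun.refl _)⟩

theorem DetStep.succs_eq {c c' : M.Cfg} (h : M.DetStep c c') : M.succs c = {c'} := by
  obtain ⟨l, q, hl, hq, rfl⟩ := h
  obtain ⟨_, v, S⟩ := c
  simp only at hl
  subst hl
  simp [succs, hq]

theorem DetStep.stepDist_eq {c c' : M.Cfg} (h : M.DetStep c c') (O : List B → List Bool → PMF ℕ) :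
    M.stepDist O c = PMF.pure c' := by
  obtain ⟨l, q, hl, hq, rfl⟩ := h
  obtain ⟨_, v, S⟩ := c
  simp only at hl
  subst hl
  simp [stepDist, hq]

theorem DetStep.not_isCall {c c' : M.Cfg} (h : M.DetStep c c') : ¬ M.IsCall c := by
  obtain ⟨l, q, hl, hq, rfl⟩ := h
  rintro ⟨l', n, hl', hn⟩
  rw [hl] at hl'
  obtain rfl := Option.some.inj hl'
  rw [hq] at hn
  cases hn

theorem not_isCall_of_halted {c : M.Cfg} (h : c.l = none) : ¬ M.IsCall c := by
  rintro ⟨l, n, hl, -⟩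
  rw [h] at hl
  cases hl

theorem succs_of_halted {c : M.Cfg} (h : c.l = none) : M.succs c = {c} := by
  obtain ⟨_, v, S⟩ := c
  simp only at h
  subst h
  rfl

theorem runDist_of_halted {c : M.Cfg} (h : c.l = none) (O : List B → List Bool → PMF ℕ) (t : ℕ) :
    M.runDist O t c = PMF.pure c := by
  obtain ⟨_, v, S⟩ := c
  simp only at h
  subst h
  induction t with
  | zero => rfl
  | succ t ih => rw [runDist, stepDist, PMF.pure_bind, ih]

theorem haltsWithin_of_halted {c : M.Cfg} (h : c.l = none) (t : ℕ) : M.HaltsWithin t c := by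
  induction t with
  | zero => exact h
  | succ t ih => rw [HaltsWithin, succs_of_halted h]; simpa using ih

theorem eq_of_reaches_of_halted {c c' : M.Cfg} (h : c.l = none) (hr : M.Reaches c c') : c' = c := by
  induction hr with
  | refl => rfl
  | tail _ h₂ ih => subst ih; rw [succs_of_halted h] at h₂; exact h₂

theorem DetRun.runDist_eq {t : ℕ} {c c' : M.Cfg} (h : M.DetRun t c c')
    (O : List B → List Bool → PMF ℕ) (u : ℕ) : M.runDist O (t + u) c = M.runDist O u c' := by
  induction h with
  | refl c => simp
  | head h₁ _ ih => rw [Nat.add_right_comm, runDist, h₁.stepDist_eq, PMF.pure_bind, ih]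

theorem DetRun.haltsWithin {t : ℕ} {c c' : M.Cfg} (h : M.DetRun t c c') {u : ℕ}
    (hu : M.HaltsWithin u c') : M.HaltsWithin (t + u) c := by
  induction h with
  | refl c => simpa using hu
  | head h₁ _ ih =>
    rw [Nat.add_right_comm, HaltsWithin, h₁.succs_eq]
    simpa using ih hu

/-- A deterministic step never starts at a call, so a call that is reachable from the start of the
run lies on the continuation after its end. -/
theorem DetRun.reaches_of_isCall {t : ℕ} {c c' x : M.Cfg} (h : M.DetRun t c c')
    (hx : M.Reaches c x) (hc : M.IsCall x) : M.Reaches c' x := by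
  induction h with
  | refl c => exact hx
  | head h₁ _ ih =>
    rcases Relation.ReflTransGen.cases_head hx with rfl | ⟨y, hy, hyx⟩
    · exact absurd hc h₁.not_isCall
    · rw [h₁.succs_eq] at hy
      obtain rfl : y = _ := hy
      exact ih hyx

/-- A computation that makes a deterministic run, calls the oracle once, and halts after another
deterministic run. -/
structure SingleCall (M : OracleTM A B) (c : M.Cfg) (n : ℕ) where
  before : ℕ
  after : ℕ
  le : before + 1 + after ≤ n
  l : M.L
  next : M.L
  v : M.S
  S : M.Stacks
  final : ℕ → M.Cfg
  prog_eq : M.prog l = Instr.call next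
  run_before : M.RunLe before c ⟨some l, v, S⟩
  run_after : ∀ y, M.RunLe after ⟨some next, v, M.receive S y⟩ (final y)
  halted : ∀ y, (final y).l = none

namespace SingleCall

variable {c : M.Cfg} {n : ℕ}

theorem haltsWithin (h : SingleCall M c n) : M.HaltsWithin n c := by
  obtain ⟨t, ht, hr⟩ := h.run_before
  obtain ⟨k, rfl⟩ : ∃ k, n = t + (k + 1) := ⟨n - t - 1, by have := h.le; omega⟩
  refine hr.haltsWithin ?_
  have hs : M.succs ⟨some h.l, h.v, h.S⟩
      = {c | ∃ y : ℕ, c = ⟨some h.next, h.v, M.receive h.S y⟩} := by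
    simp [succs, h.prog_eq]
  rw [HaltsWithin, hs]
  rintro _ ⟨y, rfl⟩
  obtain ⟨u, hu, hr'⟩ := h.run_after y
  obtain ⟨m, rfl⟩ : ∃ m, k = u + m := ⟨k - u, by have := h.le; omega⟩
  exact hr'.haltsWithin (haltsWithin_of_halted (h.halted y) m)

/-- The oracle's answer is the only source of randomness, and once halted the machine idles, so
surplus steps do not matter. -/
theorem runDist_map_output (h : SingleCall M c n) (O : List B → List Bool → PMF ℕ) :
    (M.runDist O n c).map M.output
      = (O (M.queryWord h.S) (M.queryTol h.S)).map fun y => M.output (h.final y) := by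
  obtain ⟨t, ht, hr⟩ := h.run_before
  obtain ⟨k, rfl⟩ : ∃ k, n = t + (k + 1) := ⟨n - t - 1, by have := h.le; omega⟩
  have hs : M.stepDist O ⟨some h.l, h.v, h.S⟩ = (O (M.queryWord h.S) (M.queryTol h.S)).map
      fun y => ⟨some h.next, h.v, M.receive h.S y⟩ := by
    simp [stepDist, h.prog_eq]
  have hf : ∀ y, M.runDist O k ⟨some h.next, h.v, M.receive h.S y⟩ = PMF.pure (h.final y) := by
    intro y
    obtain ⟨u, hu, hr'⟩ := h.run_after y
    obtain ⟨m, rfl⟩ : ∃ m, k = u + m := ⟨k - u, by have := h.le; omega⟩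
    rw [hr'.runDist_eq, runDist_of_halted (h.halted y)]
  rw [hr.runDist_eq, runDist, hs, PMF.bind_map, PMF.map_bind, ← PMF.bind_pure_comp]
  congr 1
  funext y
  simp [hf, PMF.pure_map]

/-- What the reduction must prove about all oracle calls is thereby reduced to a single known query.
-/
theorem stk_eq_of_isCall (h : SingleCall M c n) {x : M.Cfg} (hx : M.Reaches c x)
    (hc : M.IsCall x) : x.stk = h.S := by
  obtain ⟨t, -, hr⟩ := h.run_before
  have hx := hr.reaches_of_isCall hx hc
  rcases Relation.ReflTransGen.cases_head hx with rfl | ⟨y, hy, hyx⟩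
  · rfl
  · exfalso
    have hs : M.succs ⟨some h.l, h.v, h.S⟩
        = {c | ∃ y : ℕ, c = ⟨some h.next, h.v, M.receive h.S y⟩} := by
      simp [succs, h.prog_eq]
    rw [hs] at hy
    obtain ⟨a, rfl⟩ := hy
    obtain ⟨u, -, hr'⟩ := h.run_after a
    have := eq_of_reaches_of_halted (h.halted a) (hr'.reaches_of_isCall hyx hc)
    subst this
    exact not_isCall_of_halted (h.halted a) hc

end SingleCall

end OracleTM

end

section

/-! ### Lists of constraints over an arbitrary set of variables -/

section ConstraintLists

variable {Γ : ConstraintLanguage} {V V' : Type}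

/-- The assignment `s` satisfies all constraints of the list. -/
def Sat (cs : List (Cons Γ V)) (s : V → Bool) : Prop :=
  ∀ c ∈ cs, (fun i => s (c.2 i)) ∈ c.1.1.2

open scoped Classical in
/-- The number of appearances of `v` in a constraint. -/
def consOcc (c : Cons Γ V) (v : V) : ℕ := (Finset.univ.filter fun i => c.2 i = v).card

/-- The number of appearances of `v` in a list of constraints. -/
def occ (cs : List (Cons Γ V)) (v : V) : ℕ := (cs.map fun c => consOcc c v).sum

/-- Rename the variables of a constraint. -/
def mapScope (f : V → V') (c : Cons Γ V) : Cons Γ V' := ⟨c.1, fun i => f (c.2 i)⟩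

theorem sat_append {cs cs' : List (Cons Γ V)} {s : V → Bool} :
    Sat (cs ++ cs') s ↔ Sat cs s ∧ Sat cs' s := by
  simp [Sat, or_imp, forall_and]

theorem sat_cons {c : Cons Γ V} {cs : List (Cons Γ V)} {s : V → Bool} :
    Sat (c :: cs) s ↔ (fun i => s (c.2 i)) ∈ c.1.1.2 ∧ Sat cs s := by
  simp [Sat]

theorem sat_map {f : V → V'} {cs : List (Cons Γ V)} {s : V' → Bool} :
    Sat (cs.map (mapScope f)) s ↔ Sat cs (s ∘ f) := by
  simp only [Sat, List.forall_mem_map]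
  rfl

theorem sat_congr {cs : List (Cons Γ V)} {s s' : V → Bool}
    (h : ∀ c ∈ cs, ∀ i, s (c.2 i) = s' (c.2 i)) (hs : Sat cs s) : Sat cs s' := by
  intro c hc
  have := hs c hc
  rwa [funext (h c hc)] at this

@[simp] theorem occ_nil (v : V) : occ ([] : List (Cons Γ V)) v = 0 := rfl

@[simp] theorem occ_cons (c : Cons Γ V) (cs : List (Cons Γ V)) (v : V) :
    occ (c :: cs) v = consOcc c v + occ cs v := by simp [occ]

theorem occ_append (cs cs' : List (Cons Γ V)) (v : V) :
    occ (cs ++ cs') v = occ cs v + occ cs' v := by simp [occ]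

theorem consOcc_eq_zero {c : Cons Γ V} {v : V} (h : ∀ i, c.2 i ≠ v) : consOcc c v = 0 := by
  simp [consOcc, h]

theorem consOcc_pos {c : Cons Γ V} {v : V} {i} (h : c.2 i = v) : 0 < consOcc c v :=
  Finset.card_pos.2 ⟨i, by simp [h]⟩

theorem consOcc_le_one {c : Cons Γ V} {v : V} (h : ∀ i j, c.2 i = v → c.2 j = v → i = j) :
    consOcc c v ≤ 1 := by
  refine Finset.card_le_one.2 fun i hi j hj => ?_
  simp only [Finset.mem_filter, Finset.mem_univ, true_and] at hi hj
  exact h i j hi hj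

theorem occ_eq_zero {cs : List (Cons Γ V)} {v : V} (h : ∀ c ∈ cs, ∀ i, c.2 i ≠ v) :
    occ cs v = 0 := by
  induction cs with
  | nil => rfl
  | cons c cs ih =>
    rw [occ_cons, consOcc_eq_zero (h c (by simp)), ih fun c' hc' => h c' (by simp [hc'])]

open scoped Classical in
theorem consOcc_mapScope {f : V → V'} (hf : Function.Injective f) (c : Cons Γ V) (v : V) :
    consOcc (mapScope f c) (f v) = consOcc c v := by
  change (Finset.univ.filter fun i => f (c.2 i) = f v).card = _
  simp only [hf.eq_iff]
  rfl

theorem occ_map {f : V → V'} (hf : Function.Injective f) (cs : List (Cons Γ V)) (v : V) :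
    occ (cs.map (mapScope f)) (f v) = occ cs v := by
  simp [occ, Function.comp_def, consOcc_mapScope hf]

theorem occ_map_eq_zero {f : V → V'} {cs : List (Cons Γ V)} {v : V'} (h : ∀ u, f u ≠ v) :
    occ (cs.map (mapScope f)) v = 0 := by
  refine occ_eq_zero fun c hc i => ?_
  obtain ⟨c, -, rfl⟩ := List.mem_map.1 hc
  exact h _

theorem mapScope_injective {f : V → V'} (hf : Function.Injective f) :
    Function.Injective (mapScope (Γ := Γ) f) := by
  rintro ⟨R, g⟩ ⟨R', g'⟩ h
  simp only [mapScope, Sigma.mk.injEq] at h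
  obtain ⟨rfl, h⟩ := h
  rw [heq_eq_eq] at h
  congr 1
  funext i
  exact hf (congrFun h i)

/-- Constraints with different scopes are different. -/
theorem ne_of_scope {c c' : Cons Γ V} {i} (h : ∀ k, c'.2 k ≠ c.2 i) : c ≠ c' := by
  rintro rfl
  exact h i rfl

theorem consOcc_le_occ {cs : List (Cons Γ V)} {c : Cons Γ V} (hc : c ∈ cs) (v : V) :
    consOcc c v ≤ occ cs v :=
  List.single_le_sum (by simp) _ (List.mem_map_of_mem hc)

/-- A variable that appears at most once appears in only one constraint. -/
theorem eq_of_occ_le_one {cs : List (Cons Γ V)} {v : V} (h : occ cs v ≤ 1) {c c' : Cons Γ V}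
    (hc : c ∈ cs) (hc' : c' ∈ cs) {i i'} (hi : c.2 i = v) (hi' : c'.2 i' = v) : c = c' := by
  induction cs with
  | nil => simp at hc
  | cons b cs ih =>
    rw [occ_cons] at h
    have key : ∀ {e : Cons Γ V} {k}, e ∈ cs → e.2 k = v → 0 < occ cs v := fun he hk =>
      (consOcc_pos hk).trans_le (consOcc_le_occ he v)
    rcases List.mem_cons.1 hc with h₁ | h₁ <;> rcases List.mem_cons.1 hc' with h₂ | h₂
    · rw [h₁, h₂]
    · subst h₁; have := consOcc_pos hi; have := key h₂ hi'; omega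
    · subst h₂; have := consOcc_pos hi'; have := key h₁ hi; omega
    · exact ih (by omega) h₁ h₂

/-- The unary relation that pins a variable to `b`. -/
def pinRel (b : Bool) : BoolRel := ⟨1, {fun _ => b}⟩

theorem pinRel_mem (Γ : ConstraintLanguage) (b : Bool) : pinRel b ∈ Γ ∪ pinLanguage := by
  cases b
  · exact Finset.mem_union_right _ (Finset.mem_insert_self relZero {relOne})
  · exact Finset.mem_union_right _ (Finset.mem_insert_of_mem (Finset.mem_singleton_self relOne))

theorem mem_pinLanguage {R : BoolRel} (h : R ∈ pinLanguage) : ∃ b, R = pinRel b := by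
  rcases Finset.mem_insert.1 h with h | h
  · exact ⟨false, h⟩
  · exact ⟨true, Finset.mem_singleton.1 h⟩

/-- The constraint that pins the variable `v` to `b`. -/
def pinCons (Γ : ConstraintLanguage) (b : Bool) (v : V) : Cons (Γ ∪ pinLanguage) V :=
  ⟨⟨pinRel b, pinRel_mem Γ b⟩, fun _ => v⟩

theorem sat_pinCons {b : Bool} {v : V} {s : V → Bool} :
    ((fun i => s ((pinCons Γ b v).2 i)) ∈ (pinCons Γ b v).1.1.2) ↔ s v = b := by
  refine Finset.mem_singleton.trans ?_
  exact ⟨fun h => congrFun h (0 : Fin 1), fun h => funext fun _ => h⟩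

open scoped Classical in
theorem consOcc_pinCons (b : Bool) (u v : V) :
    consOcc (pinCons Γ b u) v = if u = v then 1 else 0 := by
  by_cases h : u = v
  · simp only [consOcc, pinCons, h, Finset.filter_true, if_true]
    exact Finset.card_fin 1
  · simp [consOcc, pinCons, h]

theorem pinCons_scope (b : Bool) (v : V) (i) : (pinCons Γ b v).2 i = v := rfl

theorem exists_pinCons_ne {b : Bool} {u v : V} (h : u ≠ v) : ∃ i, (pinCons Γ b u).2 i ≠ v :=
  ⟨(0 : Fin 1), h⟩

theorem pinCons_inj {b b' : Bool} {u v : V} (h : pinCons Γ b u = pinCons Γ b' v) : u = v := by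
  by_contra hne
  have h1 := consOcc_pinCons (Γ := Γ) b u u
  rw [h, consOcc_pinCons] at h1
  simp [Ne.symm hne] at h1

theorem occ_map_pinCons_le {ι : Type} {l : List ι} (hl : l.Nodup) {g : ι → V}
    (hg : Function.Injective g) (b : ι → Bool) (v : V) :
    occ (l.map fun k => pinCons Γ (b k) (g k)) v ≤ 1 := by
  induction l with
  | nil => simp
  | cons k l ih =>
    rw [List.nodup_cons] at hl
    rw [List.map_cons, occ_cons, consOcc_pinCons]
    split_ifs with h
    · rw [occ_eq_zero]
      intro c hc i
      obtain ⟨k', hk', rfl⟩ := List.mem_map.1 hc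
      rw [pinCons_scope, ← h]
      intro h'
      exact hl.1 (hg h' ▸ hk')
    · simpa using ih hl.2

theorem nodup_map_pinCons {ι : Type} {l : List ι} (hl : l.Nodup) {g : ι → V}
    (hg : Function.Injective g) (b : ι → Bool) :
    (l.map fun k => pinCons Γ (b k) (g k)).Nodup :=
  hl.map fun _ _ h => hg (pinCons_inj h)

theorem sat_map_pinCons {ι : Type} {l : List ι} {g : ι → V} {b : ι → Bool} {s : V → Bool} :
    Sat (l.map fun k => pinCons Γ (b k) (g k)) s ↔ ∀ k ∈ l, s (g k) = b k := by
  simp only [Sat, List.forall_mem_map, sat_pinCons]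

end ConstraintLists

/-! ### Faces of Boolean relations -/

section Faces

variable {ι : Type}

/-- With `a` and `b`, the relation holds for every tuple between `a` and `a ∨ b`. -/
def UpClosed (R : Set (ι → Bool)) : Prop :=
  ∀ a ∈ R, ∀ b ∈ R, ∀ c : ι → Bool, (∀ k, c k = a k ∨ (c k = true ∧ b k = true)) → c ∈ R

/-- The face of the cube spanned by some `a, b ∈ R` has coordinates `i ≠ j` for which
membership in `R` means `x_i = α → x_j = β`, and `a` and `b` are the only elements of `R` in the
face with `(x_i, x_j) = (α, β)` and `(x_i, x_j) = (¬α, ¬β)`, respectively. -/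
def FaceLink (R : Set (ι → Bool)) (α β : Bool) : Prop :=
  ∃ a ∈ R, ∃ b ∈ R, ∃ i j, i ≠ j ∧ a i = α ∧ a j = β ∧ b i = (!α) ∧ b j = (!β) ∧
    ∀ p ∈ R, (∀ k, a k = b k → p k = a k) → p = a ∨ p = b ∨ (p i = b i ∧ p j = a j)

/-- Complementing all tuples exchanges the two truth values. This transfers the result on raising
coordinates to lowering them. -/
theorem FaceLink.compl {R : Set (ι → Bool)} {α β : Bool}
    (h : FaceLink {p | (fun k => !p k) ∈ R} α β) : FaceLink R (!α) (!β) := by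
  obtain ⟨a, ha, b, hb, i, j, hij, h1, h2, h3, h4, h5⟩ := h
  refine ⟨_, ha, _, hb, i, j, hij, by simp [h1], by simp [h2], by simp [h3], by simp [h4], ?_⟩
  intro p hp hpk
  have h6 := h5 (fun k => !p k) (by simpa using hp) fun k hk => by
    have := hpk k (by simp [hk])
    simp [this]
  rcases h6 with h6 | h6 | h6
  · left; funext k; simp [← h6]
  · right; left; funext k; simp [← h6]
  · right; right
    simp only [← h6.1, ← h6.2, Bool.not_not, and_self]

open scoped Classical in
-- A point of the face differs from `a` only where `b` does, and at all those coordinates only if it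
-- is `b`. This drives the inductions on the distance between two points.
theorem hammingDist_lt_of_face [Fintype ι] {a b w : ι → Bool} (hw : ∀ k, a k = b k → w k = a k)
    (hwb : w ≠ b) : hammingDist a w < hammingDist a b := by
  refine Finset.card_lt_card ⟨fun k => ?_, fun h => ?_⟩
  · simp only [Finset.mem_filter, Finset.mem_univ, true_and]
    exact fun h h' => h (hw k h').symm
  · obtain ⟨k, hk⟩ := Function.ne_iff.1 hwb
    have hab : a k ≠ b k := fun h' => hk ((hw k h').trans h')
    have := h (Finset.mem_filter.2 ⟨Finset.mem_univ k, hab⟩)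
    simp only [Finset.mem_filter, Finset.mem_univ, true_and] at this
    revert hk hab this
    cases a k <;> cases b k <;> cases w k <;> simp

open scoped Classical in
theorem hammingDist_lt_of_face' [Fintype ι] {a b w : ι → Bool} (hw : ∀ k, a k = b k → w k = a k)
    (hwa : w ≠ a) : hammingDist w b < hammingDist a b := by
  rw [hammingDist_comm w, hammingDist_comm a]
  exact hammingDist_lt_of_face (fun k hk => (hw k hk.symm).trans hk.symm) hwa

open scoped Classical in
-- Consider a violation `a, b, c` with `a` and `b` as close as possible. Minimality leaves almost no
-- room for further elements of `R` in the face spanned by `a` and `b`: apart from the two of them,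
-- only `b` with one coordinate lowered can occur. Such a face is a link whose premise is that this
-- coordinate is true.
theorem faceLink_of_not_upClosed [Fintype ι] {R : Set (ι → Bool)} (hR : ¬ UpClosed R) :
    ∃ β, FaceLink R true β := by
  by_contra hno
  push Not at hno
  refine hR ?_
  suffices H : ∀ D : ℕ, ∀ a ∈ R, ∀ b ∈ R, hammingDist a b = D → ∀ c : ι → Bool,
      (∀ k, c k = a k ∨ (c k = true ∧ b k = true)) → c ∈ R from
    fun a ha b hb => H _ a ha b hb rfl
  intro D
  induction D using Nat.strong_induction_on with
  | _ D ih =>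
  intro a ha b hb hD c hc
  subst hD
  by_contra hcR
  have hca : c ≠ a := fun h => hcR (h ▸ ha)
  obtain ⟨i, hi⟩ := Function.ne_iff.1 hca
  have hC : ∀ k, c k ≠ a k → c k = true ∧ a k = false ∧ b k = true := by
    intro k hk
    rcases hc k with h | ⟨h, h'⟩
    · exact absurd h hk
    · refine ⟨h, ?_, h'⟩
      rw [h] at hk
      simpa using hk.symm
  -- a further point of the face avoids the coordinates where `c` and `a` differ
  have eq_of_mem_face : ∀ w ∈ R, (∀ k, a k = b k → w k = a k) → w ≠ b → ∀ k, c k ≠ a k →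
      w k = false := by
    intro w hw hwf hwb k hk
    by_contra hwk
    rw [Bool.not_eq_false] at hwk
    -- Raising in `a` those coordinates of the change that `w` already has is a smaller instance of
    -- closure. The result is strictly closer to `b`, and a second smaller instance then gives `c ∈
    -- R`.
    have ha'' : (fun k => if c k ≠ a k ∧ w k = true then true else a k) ∈ R := by
      refine ih _ (hammingDist_lt_of_face hwf hwb) a ha w hw rfl _ fun k => ?_
      by_cases h : c k ≠ a k ∧ w k = true
      · right; simp [h]
      · left; simp only [if_neg h]
    refine hcR (ih _ (hammingDist_lt_of_face' (a := a) ?_ ?_) _ ha'' b hb rfl c fun k => ?_)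
    · intro k hab
      have : ¬ (c k ≠ a k ∧ w k = true) := fun h => by
        have := hC k h.1
        rw [hab, this.2.2] at this
        simp at this
      simp only [if_neg this]
    · intro h
      have h1 := congrFun h k
      simp only [hk, hwk, ne_eq, not_false_eq_true, and_self, if_true] at h1
      rw [← h1] at hk
      exact hk (hC k (by rw [← h1]; exact hk)).1
    · by_cases h : c k = a k
      · left; simp [h]
      · right; exact ⟨(hC k h).1, (hC k h).2.2⟩
  have hai := hC i hi
  have hab : a ≠ b := fun h => by rw [h, hai.2.2] at hai; simp at hai
  -- such a point agrees with `b` elsewhere, and `c` differs from `a` only at `i`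
  have agrees_elsewhere : ∀ w ∈ R, (∀ k, a k = b k → w k = a k) → w ≠ a → w ≠ b →
      w i = false ∧ ∀ k, k ≠ i → w k = b k := by
    intro w hw hwf hwa hwb
    refine ⟨eq_of_mem_face w hw hwf hwb i hi, fun k hk => ?_⟩
    by_contra hwk
    -- `w ≠ a` makes `w` closer to `b`, so `w` may be raised at `i`. The raised point is still not
    -- `b`, as it differs from it at `k`, which contradicts `eq_of_mem_face`.
    have hw' : Function.update w i true ∈ R := by
      refine ih _ (hammingDist_lt_of_face' hwf hwa) w hw b hb rfl _ fun m => ?_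
      by_cases hm : m = i
      · subst hm; right; simp [hai.2.2]
      · left; simp [hm]
    have := eq_of_mem_face _ hw' (fun m hm => ?_) (fun h => hwk ?_) i hi
    · simp at this
    · have hmi : m ≠ i := fun h => by subst h; rw [hai.2.1, hai.2.2] at hm; simp at hm
      rw [Function.update_of_ne hmi, hwf m hm]
    · rw [← h, Function.update_of_ne hk]
  -- Whether or not there is a further point, `b` and `a` serve as the two corners of a link, in
  -- this order, because `b i` is true and `a i` is false.
  by_cases hw : ∃ w ∈ R, (∀ k, a k = b k → w k = a k) ∧ w ≠ a ∧ w ≠ b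
  · obtain ⟨w, hw, hwf, hwa, hwb⟩ := hw
    obtain ⟨hwi, hwk⟩ := agrees_elsewhere w hw hwf hwa hwb
    obtain ⟨z, hz⟩ := Function.ne_iff.1 hwa
    have hzi : z ≠ i := fun h => by subst h; rw [hwi, hai.2.1] at hz; exact hz rfl
    have hzb : a z = !b z := by
      have := hwk z hzi
      rw [this] at hz
      revert hz; cases a z <;> cases b z <;> simp
    refine hno (b z) ⟨b, hb, a, ha, i, z, hzi.symm, hai.2.2, rfl, by simp [hai.2.1], hzb, ?_⟩
    intro p hp hpf
    by_cases hpa : p = a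
    · exact Or.inr (Or.inl hpa)
    by_cases hpb : p = b
    · exact Or.inl hpb
    obtain ⟨h1, h2⟩ := agrees_elsewhere p hp (fun k hk => (hpf k hk.symm).trans hk.symm) hpa hpb
    exact Or.inr (Or.inr ⟨h1.trans hai.2.1.symm, h2 z hzi⟩)
  · have hcb : c ≠ b := fun h => hcR (h ▸ hb)
    -- Without further points, any second coordinate on which `a` and `b` differ will do; `c ≠ b`
    -- supplies one, and it is not `i` because `c` and `b` agree there.
    obtain ⟨z, hz⟩ := Function.ne_iff.1 hcb
    have hzi : z ≠ i := fun h => by subst h; rw [hai.1, hai.2.2] at hz; exact hz rfl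
    have hzb : a z = !b z := by
      have := hc z
      revert hz this; cases a z <;> cases b z <;> cases c z <;> simp
    refine hno (b z) ⟨b, hb, a, ha, i, z, hzi.symm, hai.2.2, rfl, by simp [hai.2.1], hzb, ?_⟩
    intro p hp hpf
    by_contra hpp
    push Not at hpp
    exact hw ⟨p, hp, fun k hk => (hpf k hk.symm).trans hk.symm, hpp.2.1, hpp.1⟩

end Faces

end

section

/-! ### Links -/

/-- A list of constraints with two distinguished variables `x` and `y`, each of which appears at
most once, that imposes `x = α → y = β` and has exactly one satisfying assignment with
`(x, y) = (α, β)` and exactly one with `(x, y) = (¬α, ¬β)`. -/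
structure Link (Γ : ConstraintLanguage) (α β : Bool) where
  T : Type
  [finite_T : Finite T]
  x : T
  y : T
  x_ne_y : x ≠ y
  cons : List (Cons Γ T)
  nodup : cons.Nodup
  occ_le : ∀ t, occ cons t ≤ 2
  occ_x : occ cons x ≤ 1
  occ_y : occ cons y ≤ 1
  exists_ne_x : ∀ c ∈ cons, ∃ i, c.2 i ≠ x
  exists_ne_y : ∀ c ∈ cons, ∃ i, c.2 i ≠ y
  imp : ∀ s, Sat cons s → s x = α → s y = β
  pos : ∃! s, Sat cons s ∧ s x = α ∧ s y = β
  neg : ∃! s, Sat cons s ∧ s x = (!α) ∧ s y = (!β)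

attribute [instance] Link.finite_T

open scoped Classical in
-- One constraint on distinct variables, with pins on the coordinates where `a` and `b` agree, cuts
-- out exactly the face. The pinned variables appear twice and the free ones, among them the
-- terminals, once.
theorem FaceLink.exists_link {Γ : ConstraintLanguage} {R : BoolRel} (hR : R ∈ Γ) {α β : Bool}
    (h : FaceLink (R.2 : Set (Fin R.1 → Bool)) α β) : Nonempty (Link (Γ ∪ pinLanguage) α β) := by
  obtain ⟨a, ha, b, hb, i, j, hij, hai, haj, hbi, hbj, hp⟩ := h
  rw [Finset.mem_coe] at ha hb
  let c₀ : Cons (Γ ∪ pinLanguage) (Fin R.1) := ⟨⟨R, Finset.mem_union_left _ hR⟩, fun i => i⟩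
  let pins : List (Fin R.1) := (Finset.univ.filter fun k => a k = b k).toList
  have hpins : ∀ k, k ∈ pins ↔ a k = b k := by simp [pins]
  have hi : a i ≠ b i := by rw [hai, hbi]; simp
  have hj : a j ≠ b j := by rw [haj, hbj]; simp
  have hc₀ : ∀ t, consOcc c₀ t ≤ 1 := fun t => consOcc_le_one fun k m hk hm => hk.trans hm.symm
  have hocc : ∀ t, a t ≠ b t →
      occ (pins.map fun k => pinCons Γ (a k) k) t = 0 := by
    intro t ht
    refine occ_eq_zero fun c hc m => ?_
    obtain ⟨k, hk, rfl⟩ := List.mem_map.1 hc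
    rw [pinCons_scope]
    rintro rfl
    exact ht ((hpins k).1 hk)
  have hsat : ∀ s, Sat (c₀ :: pins.map fun k => pinCons Γ (a k) k) s ↔
      s ∈ R.2 ∧ ∀ k, a k = b k → s k = a k := by
    intro s
    rw [sat_cons, sat_map_pinCons (g := fun k => k)]
    simp only [hpins]
    rfl
  have hne : ∀ t, a t ≠ b t → ∀ u, u ≠ t →
      ∀ c ∈ c₀ :: pins.map fun k => pinCons Γ (a k) k, ∃ m, c.2 m ≠ t := by
    intro t ht u hu c hc
    rcases List.mem_cons.1 hc with rfl | hc
    · exact ⟨u, hu⟩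
    · obtain ⟨k, hk, rfl⟩ := List.mem_map.1 hc
      exact exists_pinCons_ne fun h => ht (h ▸ (hpins k).1 hk)
  refine ⟨⟨Fin R.1, i, j, hij, c₀ :: pins.map fun k => pinCons Γ (a k) k, ?_, ?_, ?_, ?_,
    hne i hi j hij.symm, hne j hj i hij, ?_, ⟨a, ?_, ?_⟩, ⟨b, ?_, ?_⟩⟩⟩
  · refine List.nodup_cons.2 ⟨fun hmem => ?_, nodup_map_pinCons (Finset.nodup_toList _)
      (fun _ _ h => h) _⟩
    -- The pins avoid `i`, whereas the constraint contains it, so the constraint is not one of the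
    -- pins.
    have h1 : 0 < occ (pins.map fun k => pinCons Γ (a k) k) i :=
      (consOcc_pos (c := c₀) (i := i) rfl).trans_le (consOcc_le_occ hmem i)
    rw [hocc i hi] at h1
    exact lt_irrefl _ h1
  · intro t
    rw [occ_cons]
    exact Nat.add_le_add (hc₀ t)
      (occ_map_pinCons_le (Finset.nodup_toList _) (fun _ _ h => h) _ t)
  · rw [occ_cons, hocc i hi]; exact hc₀ i
  · rw [occ_cons, hocc j hj]; exact hc₀ j
  · intro s hs hsi
    rw [hsat] at hs
    rcases hp s hs.1 hs.2 with rfl | rfl | h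
    · exact haj
    · exact absurd (hai.trans hsi.symm) hi
    · exact h.2.trans haj
  · exact ⟨(hsat a).2 ⟨ha, fun _ _ => rfl⟩, hai, haj⟩
  · rintro s ⟨hs, hsi, hsj⟩
    rw [hsat] at hs
    rcases hp s hs.1 hs.2 with h | rfl | h
    · exact h
    · exact absurd (hai.trans hsi.symm) hi
    · exact absurd (hai.trans (hsi.symm.trans h.1)) hi
  · exact ⟨(hsat b).2 ⟨hb, fun _ h => h.symm⟩, hbi, hbj⟩
  · rintro s ⟨hs, hsi, hsj⟩
    rw [hsat] at hs
    rcases hp s hs.1 hs.2 with rfl | h | h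
    · exact absurd (hsi.trans hbi.symm) hi
    · exact h
    · exact absurd (h.2.symm.trans (hsj.trans hbj.symm)) hj

namespace Link

variable {Γ : ConstraintLanguage} {α β γ : Bool}

section Glue

variable (A : Link Γ α β) (B : Link Γ β γ)

/-- The variables of two links, the second variable of the first being identified with the first
variable of the second. -/
abbrev GlueVar : Type := A.T ⊕ {t : B.T // t ≠ B.x}

open scoped Classical in
/-- The inclusion of the variables of the second link. -/
def glueRight (t : B.T) : GlueVar A B := if h : t = B.x then Sum.inl A.y else Sum.inr ⟨t, h⟩

theorem glueRight_x : glueRight A B B.x = Sum.inl A.y := by simp [glueRight]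

theorem glueRight_of_ne {t : B.T} (h : t ≠ B.x) : glueRight A B t = Sum.inr ⟨t, h⟩ := by
  simp [glueRight, h]

theorem glueRight_injective : Function.Injective (glueRight A B) := by
  intro s t h
  by_cases hs : s = B.x <;> by_cases ht : t = B.x <;> simp_all [glueRight]

/-- The constraints of two links joined in a common variable. -/
def glueCons : List (Cons Γ (GlueVar A B)) :=
  A.cons.map (mapScope Sum.inl) ++ B.cons.map (mapScope (glueRight A B))

theorem sat_glueCons {s : GlueVar A B → Bool} :
    Sat (glueCons A B) s ↔ Sat A.cons (s ∘ Sum.inl) ∧ Sat B.cons (s ∘ glueRight A B) := by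
  rw [glueCons, sat_append, sat_map, sat_map]

theorem nodup_glueCons : (glueCons A B).Nodup := by
  refine List.Nodup.append (A.nodup.map (mapScope_injective Sum.inl_injective))
    (B.nodup.map (mapScope_injective (glueRight_injective A B))) fun c hc hc' => ?_
  obtain ⟨c, hcA, rfl⟩ := List.mem_map.1 hc
  obtain ⟨c', hcB, h⟩ := List.mem_map.1 hc'
  obtain ⟨i, hi⟩ := B.exists_ne_x c' hcB
  refine ne_of_scope (c := mapScope (glueRight A B) c') (i := i) (fun k => ?_) h
  change Sum.inl _ ≠ glueRight A B (c'.2 i)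
  rw [glueRight_of_ne A B hi]
  simp

theorem occ_glueCons_inl {t : A.T} (ht : t ≠ A.y) :
    occ (glueCons A B) (Sum.inl t) = occ A.cons t := by
  rw [glueCons, occ_append, occ_map Sum.inl_injective, occ_map_eq_zero, Nat.add_zero]
  intro u
  by_cases hu : u = B.x
  · subst hu; rw [glueRight_x]; simpa using ht.symm
  · rw [glueRight_of_ne A B hu]; simp

theorem occ_glueCons_mid :
    occ (glueCons A B) (Sum.inl A.y) = occ A.cons A.y + occ B.cons B.x := by
  rw [glueCons, occ_append, occ_map Sum.inl_injective, ← glueRight_x A B,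
    occ_map (glueRight_injective A B)]

theorem occ_glueCons_inr (t : {t : B.T // t ≠ B.x}) :
    occ (glueCons A B) (Sum.inr t) = occ B.cons t := by
  rw [glueCons, occ_append, occ_map_eq_zero (by simp), Nat.zero_add,
    ← glueRight_of_ne A B t.2, occ_map (glueRight_injective A B)]

theorem occ_glueCons_le (t : GlueVar A B) : occ (glueCons A B) t ≤ 2 := by
  rcases t with t | t
  · by_cases ht : t = A.y
    · subst ht
      rw [occ_glueCons_mid]
      have := A.occ_y
      have := B.occ_x
      omega
    · rw [occ_glueCons_inl A B ht]; exact A.occ_le t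
  · rw [occ_glueCons_inr]; exact B.occ_le t

/-- Once the outer values force the value `m` of the shared variable, both halves are determined
separately, and their unique assignments agree in that variable. -/
theorem existsUnique_sat_glueCons {p m q : Bool}
    (hA : ∃! s, Sat A.cons s ∧ s A.x = p ∧ s A.y = m)
    (hB : ∃! s, Sat B.cons s ∧ s B.x = m ∧ s B.y = q)
    (hm : ∀ s, Sat (glueCons A B) s → s (Sum.inl A.x) = p → s (glueRight A B B.y) = q →
      s (Sum.inl A.y) = m) :
    ∃! s, Sat (glueCons A B) s ∧ s (Sum.inl A.x) = p ∧ s (glueRight A B B.y) = q := by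
  obtain ⟨sA, ⟨hA1, hA2, hA3⟩, hA4⟩ := hA
  obtain ⟨sB, ⟨hB1, hB2, hB3⟩, hB4⟩ := hB
  have hg : (Sum.elim sA (fun t : {t : B.T // t ≠ B.x} => sB t)) ∘ glueRight A B = sB := by
    funext t
    by_cases ht : t = B.x
    · subst ht; simp [glueRight_x, hA3, hB2]
    · simp [glueRight_of_ne A B ht]
  refine ⟨Sum.elim sA fun t => sB t, ⟨(sat_glueCons A B).2 ⟨?_, ?_⟩, hA2, ?_⟩, ?_⟩
  · simpa using hA1
  · rw [hg]; exact hB1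
  · exact (congrFun hg B.y).trans hB3
  · rintro s ⟨hs, h1, h2⟩
    have h3 := hm s hs h1 h2
    rw [sat_glueCons] at hs
    have e1 := hA4 _ ⟨hs.1, h1, h3⟩
    have e2 := hB4 _ ⟨hs.2, by simpa [glueRight_x] using h3, h2⟩
    funext t
    rcases t with t | t
    · exact congrFun e1 t
    · have := congrFun e2 t
      simpa [glueRight_of_ne A B t.2] using this

theorem glueRight_y : glueRight A B B.y = Sum.inr ⟨B.y, B.x_ne_y.symm⟩ :=
  glueRight_of_ne A B B.x_ne_y.symm

theorem mid_of_pos {s : GlueVar A B → Bool} (hs : Sat (glueCons A B) s)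
    (h : s (Sum.inl A.x) = α) : s (Sum.inl A.y) = β :=
  A.imp _ ((sat_glueCons A B).1 hs).1 h

theorem right_of_mid {s : GlueVar A B → Bool} (hs : Sat (glueCons A B) s)
    (h : s (Sum.inl A.y) = β) : s (glueRight A B B.y) = γ :=
  B.imp _ ((sat_glueCons A B).1 hs).2 (by simpa [glueRight_x] using h)

theorem existsUnique_pos :
    ∃! s, Sat (glueCons A B) s ∧ s (Sum.inl A.x) = α ∧ s (glueRight A B B.y) = γ :=
  existsUnique_sat_glueCons A B A.pos B.pos fun _ hs h _ => mid_of_pos A B hs h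

/-- Here the shared variable is controlled from the right: by the contrapositive of the second
implication it cannot be `β`. -/
theorem existsUnique_neg :
    ∃! s, Sat (glueCons A B) s ∧ s (Sum.inl A.x) = (!α) ∧ s (glueRight A B B.y) = (!γ) :=
  existsUnique_sat_glueCons A B A.neg B.neg fun s hs _ h => by
    by_contra hne
    have := right_of_mid A B hs (by revert hne; cases s (Sum.inl A.y) <;> cases β <;> simp)
    simp_all

theorem glueCons_cases {c : Cons Γ (GlueVar A B)} (hc : c ∈ glueCons A B) :
    (∃ c₁ ∈ A.cons, c = mapScope Sum.inl c₁) ∨ ∃ c₂ ∈ B.cons, c = mapScope (glueRight A B) c₂ := by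
  rcases List.mem_append.1 hc with h | h
  · obtain ⟨c₁, h₁, rfl⟩ := List.mem_map.1 h
    exact Or.inl ⟨c₁, h₁, rfl⟩
  · obtain ⟨c₂, h₂, rfl⟩ := List.mem_map.1 h
    exact Or.inr ⟨c₂, h₂, rfl⟩

/-- Every constraint involves a variable other than the two outer ones. -/
theorem exists_ne_outer {c : Cons Γ (GlueVar A B)} (hc : c ∈ glueCons A B) :
    ∃ i, c.2 i ≠ Sum.inl A.x ∧ c.2 i ≠ glueRight A B B.y := by
  rcases glueCons_cases A B hc with ⟨c, hc', rfl⟩ | ⟨c, hc', rfl⟩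
  · obtain ⟨i, hi⟩ := A.exists_ne_x c hc'
    refine ⟨i, fun h => hi (Sum.inl_injective h), ?_⟩
    rw [glueRight_y]
    simp [mapScope]
  · obtain ⟨i, hi⟩ := B.exists_ne_y c hc'
    refine ⟨i, ?_, fun h => hi (glueRight_injective A B h)⟩
    change glueRight A B (c.2 i) ≠ _
    by_cases h : c.2 i = B.x
    · rw [h, glueRight_x]
      intro h'
      exact A.x_ne_y (Sum.inl_injective h').symm
    · rw [glueRight_of_ne A B h]; simp

theorem exists_ne_mid {c : Cons Γ (GlueVar A B)} (hc : c ∈ glueCons A B) :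
    ∃ i, c.2 i ≠ Sum.inl A.y := by
  rcases glueCons_cases A B hc with ⟨c, hc', rfl⟩ | ⟨c, hc', rfl⟩
  · obtain ⟨i, hi⟩ := A.exists_ne_y c hc'
    exact ⟨i, fun h => hi (Sum.inl_injective h)⟩
  · obtain ⟨i, hi⟩ := B.exists_ne_x c hc'
    refine ⟨i, ?_⟩
    change glueRight A B (c.2 i) ≠ _
    rw [glueRight_of_ne A B hi]; simp

/-- Links can be composed. -/
def comp : Link Γ α γ where
  T := GlueVar A B
  x := Sum.inl A.x
  y := glueRight A B B.y
  x_ne_y := by rw [glueRight_y]; simp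
  cons := glueCons A B
  nodup := nodup_glueCons A B
  occ_le := occ_glueCons_le A B
  occ_x := by rw [occ_glueCons_inl A B A.x_ne_y]; exact A.occ_x
  occ_y := by rw [glueRight_y, occ_glueCons_inr]; exact B.occ_y
  exists_ne_x c hc := (exists_ne_outer A B hc).imp fun _ h => h.1
  exists_ne_y c hc := (exists_ne_outer A B hc).imp fun _ h => h.2
  imp _ hs h := right_of_mid A B hs (mid_of_pos A B hs h)
  pos := existsUnique_pos A B
  neg := existsUnique_neg A B

end Glue

end Link

/-! ### Ring elements -/

/-- A list of constraints with distinguished variables `l`, `x` and `r`. When elements are joined to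
a ring, `r` being identified with the `l` of the next element, these variables are forced to be
equal, all other variables are determined by them, and `x` may appear in one further constraint
without the degree exceeding `d`. -/
structure RingElem (Γ : ConstraintLanguage) (d : ℕ) where
  T : Type
  [finite_T : Finite T]
  l : T
  x : T
  r : T
  l_ne_x : l ≠ x
  x_ne_r : x ≠ r
  l_ne_r : l ≠ r
  cons : List (Cons Γ T)
  nodup : cons.Nodup
  val : Bool
  occ_le : ∀ t, occ cons t ≤ d
  occ_x : occ cons x + 1 ≤ d
  occ_lr : occ cons l + occ cons r ≤ d
  exists_ne_x : ∀ c ∈ cons, ∃ i, c.2 i ≠ x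
  exists_ne_lr : ∀ c ∈ cons, ∃ i, c.2 i ≠ l ∧ c.2 i ≠ r
  imp_x : ∀ s, Sat cons s → s l = val → s x = val
  imp_r : ∀ s, Sat cons s → s x = val → s r = val
  existsUnique_sat : ∀ b, ∃! s, Sat cons s ∧ s l = b ∧ s r = b

attribute [instance] RingElem.finite_T

/-- Two links `α → α` in a row form a ring element of degree `3`. -/
def Link.toRingElem {Γ : ConstraintLanguage} {α : Bool} (A : Link Γ α α) {d : ℕ} (hd : 3 ≤ d) :
    RingElem Γ d where
  T := GlueVar A A
  l := Sum.inl A.x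
  x := Sum.inl A.y
  r := glueRight A A A.y
  l_ne_x h := A.x_ne_y (Sum.inl_injective h)
  x_ne_r := by rw [glueRight_y]; simp
  l_ne_r := by rw [glueRight_y]; simp
  cons := glueCons A A
  nodup := nodup_glueCons A A
  val := α
  occ_le t := (occ_glueCons_le A A t).trans (by omega)
  occ_x := by have := occ_glueCons_le A A (Sum.inl A.y); omega
  occ_lr := by
    rw [occ_glueCons_inl A A A.x_ne_y, glueRight_y, occ_glueCons_inr]
    have := A.occ_x
    have := A.occ_y
    simp only
    omega
  exists_ne_x c hc := exists_ne_mid A A hc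
  exists_ne_lr c hc := exists_ne_outer A A hc
  imp_x _ hs h := mid_of_pos A A hs h
  imp_r _ hs h := right_of_mid A A hs h
  existsUnique_sat b := by
    by_cases hb : b = α
    · subst hb; exact existsUnique_pos A A
    · obtain rfl : b = !α := by revert hb; cases b <;> cases α <;> simp
      exact existsUnique_neg A A

end

/-! ### Gadgets of degree two: splitting the variables that have to be pinned -/

section

variable {Γ : ConstraintLanguage} {V : Type}

theorem occ_map_le_one {ι : Type} {l : List ι} (hl : l.Nodup) {f : ι → Cons Γ V} {v : V}
    (h1 : ∀ k, consOcc (f k) v ≤ 1) (h2 : ∀ k k' i i', (f k).2 i = v → (f k').2 i' = v → k = k') :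
    occ (l.map f) v ≤ 1 := by
  induction l with
  | nil => simp
  | cons k l ih =>
    rw [List.nodup_cons] at hl
    rw [List.map_cons, occ_cons]
    by_cases h : ∃ i, (f k).2 i = v
    · obtain ⟨i, hi⟩ := h
      rw [occ_eq_zero]
      · exact h1 k
      · intro c hc i' hi'
        obtain ⟨k', hk', rfl⟩ := List.mem_map.1 hc
        exact hl.1 (h2 k k' i i' hi hi' ▸ hk')
    · push Not at h
      rw [consOcc_eq_zero h]
      simpa using ih hl.2

theorem occ_le_of_sublist {cs cs' : List (Cons Γ V)} (h : cs.Sublist cs') (v : V) :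
    occ cs v ≤ occ cs' v :=
  (h.map _).sum_le_sum (by simp)

/-- If all variables of a constraint appear only once and `a` and `b` satisfy the constraints, then
`a` may be changed to `b` on the scope of the constraint. -/
theorem sat_exchange {cs : List (Cons Γ V)} {a b : V → Bool} (ha : Sat cs a) (hb : Sat cs b)
    {c : Cons Γ V} (hc : c ∈ cs) (h : ∀ i, occ cs (c.2 i) ≤ 1) {s : V → Bool}
    (hs : ∀ i, s (c.2 i) = b (c.2 i)) (hs' : ∀ v, (∀ i, c.2 i ≠ v) → s v = a v) : Sat cs s := by
  intro c' hc'
  by_cases hcc : c' = c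
  · subst hcc
    have := hb c' hc'
    rwa [← funext hs] at this
  -- The variables of `c` appear nowhere else, so `c'` meets none of them and sees only values of
  -- `a`.
  · have := ha c' hc'
    rwa [← funext fun i => hs' (c'.2 i) fun k hk => hcc ?_] at this
    exact eq_of_occ_le_one (h k) hc' hc hk.symm rfl

theorem mem_of_forall_eq {r : ℕ} {R : Finset (Fin r → Bool)} {s t : Fin r → Bool}
    (h : ∀ i, s i = t i) (hs : s ∈ R) : t ∈ R := funext h ▸ hs

section Split

variable (a b : V → Bool)

/-- The appearances in a list of constraints of the variables on which `a` and `b` agree. -/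
abbrev PinnedOcc (cs : List (Cons Γ V)) : Type :=
  {o : (Σ c : {c // c ∈ cs}, Fin c.1.1.1.1) // a (o.1.1.2 o.2) = b (o.1.1.2 o.2)}

instance (cs : List (Cons Γ V)) : Finite (PinnedOcc a b cs) := by
  have : Finite {c // c ∈ cs} := List.finite_toSet cs
  infer_instance

/-- The variables on which `a` and `b` differ, and a variable for each appearance of one of the
others. -/
abbrev SplitVar (cs : List (Cons Γ V)) : Type := {v : V // a v ≠ b v} ⊕ PinnedOcc a b cs

variable {cs : List (Cons Γ V)}

/-- The variable that was split. -/
def unsplit : SplitVar a b cs → V := Sum.elim (fun v => v.1) fun o => o.1.1.1.2 o.1.2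

open scoped Classical in
/-- A constraint in which each appearance of a variable on which `a` and `b` agree is replaced by a
variable of its own. -/
def splitCons (c : {c // c ∈ cs}) : Cons Γ (SplitVar a b cs) :=
  ⟨c.1.1, fun i => if h : a (c.1.2 i) = b (c.1.2 i) then Sum.inr ⟨⟨c, i⟩, h⟩
    else Sum.inl ⟨c.1.2 i, h⟩⟩

theorem unsplit_splitCons (c : {c // c ∈ cs}) (i) :
    unsplit a b ((splitCons a b c).2 i) = c.1.2 i := by
  simp only [splitCons]
  split_ifs <;> rfl

theorem mapScope_unsplit_splitCons (c : {c // c ∈ cs}) :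
    mapScope (unsplit a b) (splitCons a b c) = c.1 := by
  obtain ⟨⟨R, g⟩, hc⟩ := c
  simp only [mapScope, unsplit_splitCons]
  rfl

theorem splitCons_injective : Function.Injective (splitCons a b (cs := cs)) := by
  intro c c' h
  have := congrArg (mapScope (unsplit a b)) h
  rw [mapScope_unsplit_splitCons, mapScope_unsplit_splitCons] at this
  exact Subtype.ext this

theorem splitCons_scope_inl {c : {c // c ∈ cs}} {i} {v : {v // a v ≠ b v}}
    (h : (splitCons a b c).2 i = Sum.inl v) : c.1.2 i = v := by
  rw [← unsplit_splitCons a b, h]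
  rfl

theorem splitCons_scope_inr {c : {c // c ∈ cs}} {i} {o : PinnedOcc a b cs}
    (h : (splitCons a b c).2 i = Sum.inr o) : o.1 = ⟨c, i⟩ := by
  simp only [splitCons] at h
  split_ifs at h
  rw [← Sum.inr_injective h]

theorem splitCons_scope_of_ne {c : {c // c ∈ cs}} {i} (h : a (c.1.2 i) ≠ b (c.1.2 i)) :
    (splitCons a b c).2 i = Sum.inl ⟨c.1.2 i, h⟩ := by
  simp [splitCons, h]

theorem consOcc_splitCons_inl (c : {c // c ∈ cs}) (v : {v // a v ≠ b v}) :
    consOcc (splitCons a b c) (Sum.inl v) = consOcc c.1 v := by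
  classical
  change (Finset.univ.filter fun i : Fin c.1.1.1.1 => (splitCons a b c).2 i = Sum.inl v).card
    = (Finset.univ.filter fun i : Fin c.1.1.1.1 => c.1.2 i = v).card
  congr 1
  ext i
  simp only [Finset.mem_filter, Finset.mem_univ, true_and]
  refine ⟨splitCons_scope_inl a b, fun h => ?_⟩
  have hv : a (c.1.2 i) ≠ b (c.1.2 i) := by rw [h]; exact v.2
  rw [splitCons_scope_of_ne a b hv]
  simp [h]

end Split

open scoped Classical in
/-- Constraints of degree `2` that force three variables of degree `1` to be equal give rise to
a ring element. -/
theorem exists_ringElem_two {cs : List (Cons (Γ ∪ pinLanguage) V)} [Finite V] (hcs : cs.Nodup)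
    (p : Fin 3 → V) (hp : Function.Injective p) (hocc : ∀ v, occ cs v ≤ 2)
    (hocc' : ∀ i, occ cs (p i) ≤ 1) (heq : ∀ s, Sat cs s → ∀ i j, s (p i) = s (p j))
    (hex : ∀ b, ∃ s, Sat cs s ∧ s (p 0) = b) : Nonempty (RingElem (Γ ∪ pinLanguage) 2) := by
  have := Fintype.ofFinite V
  -- satisfying assignments of both kinds at minimal distance
  have hmin : ∃ D : ℕ, ∃ a b, Sat cs a ∧ Sat cs b ∧ a (p 0) = false ∧ b (p 0) = true ∧
      hammingDist a b = D := by
    obtain ⟨a, ha, ha0⟩ := hex false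
    obtain ⟨b, hb, hb0⟩ := hex true
    exact ⟨_, a, b, ha, hb, ha0, hb0, rfl⟩
  obtain ⟨a, b, ha, hb, ha0, hb0, hD⟩ := Nat.find_spec hmin
  -- Any third satisfying assignment in the face spanned by `a` and `b` could replace one of the two
  -- and reduce the distance.
  have hface : ∀ w, Sat cs w → (∀ k, a k = b k → w k = a k) → w = a ∨ w = b := by
    intro w hw hwf
    by_contra hne
    push Not at hne
    rcases hw0 : w (p 0) with _ | _
    · exact Nat.find_min hmin (hD ▸ hammingDist_lt_of_face' hwf hne.1)
        ⟨w, b, hw, hb, hw0, hb0, rfl⟩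
    · exact Nat.find_min hmin (hD ▸ hammingDist_lt_of_face hwf hne.2)
        ⟨a, w, ha, hw, ha0, hw0, rfl⟩
  have hap : ∀ i, a (p i) = false := fun i => (heq a ha i 0).trans ha0
  have hbp : ∀ i, b (p i) = true := fun i => (heq b hb i 0).trans hb0
  have hpne : ∀ i, a (p i) ≠ b (p i) := fun i => by rw [hap, hbp]; simp
  -- a constraint whose variables are among the three given ones involves all of them
  have hscope : ∀ c ∈ cs, (∀ i, ∃ k, c.2 i = p k) → ∀ _ : Fin c.1.1.1, ∀ k,
      ∃ j, c.2 j = p k := by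
    intro c hc hck i k
    -- Switching from `a` to `b` on the scope of `c` is allowed by `sat_exchange`. As the terminals
    -- remain equal, the switch must reach all three of them.
    have hs : Sat cs (fun v => if ∃ j, c.2 j = v then b v else a v) := by
      refine sat_exchange ha hb hc (fun j => ?_) (fun j => ?_) fun v hv => ?_
      · obtain ⟨m, hm⟩ := hck j
        rw [hm]
        exact hocc' m
      · rw [if_pos ⟨j, rfl⟩]
      · rw [if_neg]
        push Not
        exact hv
    obtain ⟨m, hm⟩ := hck i
    have h1 := heq _ hs m k
    simp only [if_pos (⟨i, hm⟩ : ∃ j, c.2 j = p m), hap, hbp] at h1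
    by_contra hno
    rw [if_neg hno] at h1
    simp at h1
  have := Fintype.ofFinite (PinnedOcc a b cs)
  -- Constraints in which all variables would be pinned are dropped. They hold anyway, and if kept
  -- they could coincide with one of the new pins or have an empty scope.
  let P : {c // c ∈ cs} → Prop := fun c => ∃ i, a (c.1.2 i) ≠ b (c.1.2 i)
  let cs₁ : List (Cons (Γ ∪ pinLanguage) (SplitVar a b cs)) :=
    (cs.attach.filter (P ·)).map (splitCons a b)
  let val : PinnedOcc a b cs → Bool := fun o => a (o.1.1.1.2 o.1.2)
  let cs₂ : List (Cons (Γ ∪ pinLanguage) (SplitVar a b cs)) :=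
    (Finset.univ : Finset (PinnedOcc a b cs)).toList.map fun o => pinCons Γ (val o) (Sum.inr o)
  have hcs₁ : ∀ c ∈ cs₁, ∃ c', P c' ∧ c = splitCons a b c' := by
    intro c hc
    obtain ⟨c', hc', rfl⟩ := List.mem_map.1 hc
    exact ⟨c', by simpa using (List.mem_filter.1 hc').2, rfl⟩
  -- The new variables always carry the common value of `a` and `b`, so an assignment is determined
  -- by its values on the variables that were not split.
  let lift : (V → Bool) → SplitVar a b cs → Bool := fun w => Sum.elim (fun v => w v.1) val
  have hsat : ∀ s, Sat (cs₁ ++ cs₂) s ↔ s = lift a ∨ s = lift b := by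
    intro s
    rw [sat_append]
    constructor
    · rintro ⟨h₁, h₂⟩
      have h₂ : ∀ o, s (Sum.inr o) = val o := by
        have := sat_map_pinCons.1 h₂
        simpa using this
      have hv : ∀ (c : {c // c ∈ cs}) i, (if h : a (c.1.2 i) = b (c.1.2 i) then a (c.1.2 i)
          else s (Sum.inl ⟨c.1.2 i, h⟩)) = s ((splitCons a b c).2 i) := by
        intro c i
        simp only [splitCons]
        split_ifs with h
        · rw [h₂]
        · rfl
      -- Undoing the split gives an assignment of the old variables in the face of `a` and `b`; the
      -- dropped constraints hold because it agrees with `a` on their scopes. By `hface` it is `a`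
      -- or `b`.
      have hw : Sat cs (fun v => if h : a v = b v then a v else s (Sum.inl ⟨v, h⟩)) := by
        intro c hc
        by_cases hP : P ⟨c, hc⟩
        · have := h₁ (splitCons a b ⟨c, hc⟩) (List.mem_map_of_mem (by simp [hP]))
          exact mem_of_forall_eq (r := c.1.1.1) (fun i => (hv ⟨c, hc⟩ i).symm) this
        · have hP' : ∀ i, a (c.2 i) = b (c.2 i) := by simpa [P] using hP
          have := ha c hc
          simpa [hP'] using this
      have hlift : s = lift (fun v => if h : a v = b v then a v else s (Sum.inl ⟨v, h⟩)) := by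
        funext t
        rcases t with ⟨v, hv⟩ | o
        · simp [lift, hv]
        · simp [lift, h₂]
      rcases hface _ hw fun k hk => by simp [hk] with h | h
      · left; rw [hlift, h]
      · right; rw [hlift, h]
    · have key : ∀ w, Sat cs w → (∀ k, a k = b k → w k = a k) →
          Sat cs₁ (lift w) ∧ Sat cs₂ (lift w) := by
        intro w hw hwf
        refine ⟨fun c hc => ?_, sat_map_pinCons.2 fun o _ => rfl⟩
        obtain ⟨c, -, rfl⟩ := hcs₁ c hc
        have h1 : ∀ i, lift w ((splitCons a b c).2 i) = w (c.1.2 i) := by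
          intro i
          simp only [splitCons]
          split_ifs with h
          · exact (hwf _ h).symm
          · rfl
        have := hw c.1 c.2
        exact mem_of_forall_eq (r := c.1.1.1.1) (fun i => (h1 i).symm) this
      rintro (rfl | rfl)
      · exact key a ha fun _ _ => rfl
      · exact key b hb fun _ h => h.symm
  have hocc₂ : ∀ v, occ cs₂ (Sum.inl v) = 0 := by
    intro v
    refine occ_eq_zero fun c hc i => ?_
    obtain ⟨o, -, rfl⟩ := List.mem_map.1 hc
    rw [pinCons_scope]
    simp
  have hoccl : ∀ v : {v // a v ≠ b v}, occ (cs₁ ++ cs₂) (Sum.inl v) ≤ occ cs v := by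
    intro v
    rw [occ_append, hocc₂, Nat.add_zero]
    refine (occ_le_of_sublist (List.Sublist.map _ List.filter_sublist) _).trans_eq ?_
    rw [occ, List.map_map, occ]
    simp only [Function.comp_def, consOcc_splitCons_inl]
    rw [List.attach_map_val (f := fun c => consOcc c v.1)]
  -- A split variable stands for one appearance and has one pin. Pinning the original variable could
  -- have raised its degree to three.
  have hoccr : ∀ o, occ (cs₁ ++ cs₂) (Sum.inr o) ≤ 2 := by
    intro o
    rw [occ_append]
    refine Nat.add_le_add (occ_map_le_one ?_ ?_ ?_)
      (occ_map_pinCons_le (Finset.nodup_toList _) Sum.inr_injective val (Sum.inr o))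
    · exact (List.nodup_attach.2 hcs).filter _
    · refine fun c => consOcc_le_one fun i j hi hj => ?_
      have := (splitCons_scope_inr a b hi).symm.trans (splitCons_scope_inr a b hj)
      exact eq_of_heq (Sigma.mk.inj this).2
    · intro c c' i i' hi hi'
      have := (splitCons_scope_inr a b hi).symm.trans (splitCons_scope_inr a b hi')
      exact (Sigma.mk.inj this).1
  have hocc3 : ∀ i, occ (cs₁ ++ cs₂) (Sum.inl ⟨p i, hpne i⟩) ≤ 1 := fun i =>
    (hoccl _).trans (hocc' i)
  have hinj : ∀ i j, i ≠ j → (Sum.inl ⟨p i, hpne i⟩ : SplitVar a b cs) ≠ Sum.inl ⟨p j, hpne j⟩ := by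
    intro i j hij h
    exact hij (hp (Subtype.ext_iff.1 (Sum.inl_injective h)))
  -- Only `lift a` and `lift b` satisfy the constraints and the terminals are equal in both, so
  -- either truth value may serve as `val`.
  refine ⟨⟨SplitVar a b cs, Sum.inl ⟨p 0, hpne 0⟩, Sum.inl ⟨p 1, hpne 1⟩, Sum.inl ⟨p 2, hpne 2⟩,
    hinj 0 1 (by decide), hinj 1 2 (by decide), hinj 0 2 (by decide), cs₁ ++ cs₂, ?_, true,
    ?_, ?_, ?_, ?_, ?_, ?_, ?_, ?_⟩⟩
  · refine List.Nodup.append (((List.nodup_attach.2 hcs).filter _).map (splitCons_injective a b))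
      (nodup_map_pinCons (Finset.nodup_toList _) Sum.inr_injective val) fun c hc hc' => ?_
    obtain ⟨c, ⟨i, hi⟩, rfl⟩ := hcs₁ c hc
    obtain ⟨o, -, h⟩ := List.mem_map.1 hc'
    refine ne_of_scope (c := splitCons a b c) (i := i) (fun k => ?_) h.symm
    rw [splitCons_scope_of_ne a b hi, pinCons_scope]
    simp
  · rintro (v | o)
    · exact (hoccl v).trans (hocc v)
    · exact hoccr o
  · have := hocc3 1
    omega
  · have := hocc3 0
    have := hocc3 2
    omega
  · intro c hc
    rcases List.mem_append.1 hc with hc | hc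
    · obtain ⟨c, ⟨i, hi⟩, rfl⟩ := hcs₁ c hc
      by_contra hno
      push Not at hno
      -- A scope consisting only of the terminal `x` would, by `hscope`, have to contain the other
      -- terminals as well.
      have h1 := fun k => splitCons_scope_inl a b (hno k)
      obtain ⟨j, hj⟩ := hscope c.1 c.2 (fun k => ⟨1, h1 k⟩) i 0
      exact absurd (hp (hj.symm.trans (h1 j))) (by decide)
    · obtain ⟨o, -, rfl⟩ := List.mem_map.1 hc
      exact exists_pinCons_ne (by simp)
  · intro c hc
    rcases List.mem_append.1 hc with hc | hc
    · obtain ⟨c, ⟨i, hi⟩, rfl⟩ := hcs₁ c hc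
      by_contra hno
      push Not at hno
      have h1 : ∀ k, c.1.2 k = p 0 ∨ c.1.2 k = p 2 := fun k => by
        by_cases h : (splitCons a b c).2 k = Sum.inl ⟨p 0, hpne 0⟩
        · exact Or.inl (splitCons_scope_inl a b h)
        · exact Or.inr (splitCons_scope_inl a b (hno k h))
      obtain ⟨j, hj⟩ := hscope c.1 c.2 (fun k => (h1 k).elim (fun h => ⟨0, h⟩) fun h => ⟨2, h⟩) i 1
      rcases h1 j with h | h
      · exact absurd (hp (hj.symm.trans h)) (by decide)
      · exact absurd (hp (hj.symm.trans h)) (by decide)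
    · obtain ⟨o, -, rfl⟩ := List.mem_map.1 hc
      exact ⟨(0 : Fin 1), Sum.inr_ne_inl, Sum.inr_ne_inl⟩
  · intro s hs
    rcases (hsat s).1 hs with rfl | rfl <;> simp [lift, hap, hbp]
  · intro s hs
    rcases (hsat s).1 hs with rfl | rfl <;> simp [lift, hap, hbp]
  · intro v
    cases v
    · refine ⟨lift a, ⟨(hsat _).2 (Or.inl rfl), by simp [lift, hap], by simp [lift, hap]⟩, ?_⟩
      rintro s ⟨hs, h0, -⟩
      rcases (hsat s).1 hs with rfl | rfl
      · rfl
      · simp [lift, hbp] at h0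
    · refine ⟨lift b, ⟨(hsat _).2 (Or.inr rfl), by simp [lift, hbp], by simp [lift, hbp]⟩, ?_⟩
      rintro s ⟨hs, h0, -⟩
      rcases (hsat s).1 hs with rfl | rfl
      · simp [lift, hap] at h0
      · rfl

end

/-! ### Extracting a ring element from simulated equality -/

section

variable {Γ : ConstraintLanguage} {V : Type}

theorem varDegree_eq_occ {Γ : ConstraintLanguage} (I : CSPInstance Γ) (v : Fin I.n) :
    I.varDegree v = occ I.constraints v := by
  unfold CSPInstance.varDegree occ consOcc
  congr! 4
  ext i
  simp

theorem upClosed_pinRel (b : Bool) : UpClosed ((pinRel b).2 : Set (Fin (pinRel b).1 → Bool)) := by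
  intro s hs t ht c hc
  have hs := Finset.mem_singleton.1 (Finset.mem_coe.1 hs)
  have ht := Finset.mem_singleton.1 (Finset.mem_coe.1 ht)
  refine Finset.mem_coe.2 (Finset.mem_singleton.2 (funext fun i => ?_))
  rcases hc i with h | ⟨h, h'⟩
  · rw [h, hs]
  · rw [h, ← h', ht]

theorem upClosed_compl_pinRel (b : Bool) :
    UpClosed {s : Fin (pinRel b).1 → Bool | (fun i => !s i) ∈ (pinRel b).2} := by
  intro s hs t ht c hc
  have hs := fun i => congrFun (Finset.mem_singleton.1 hs) i
  have ht := fun i => congrFun (Finset.mem_singleton.1 ht) i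
  refine Finset.mem_singleton.2 (funext fun i => ?_)
  have hs : (!s i) = b := hs i
  have ht : (!t i) = b := ht i
  change (!c i) = b
  rcases hc i with h | ⟨h, h'⟩
  · rw [h, hs]
  · rw [h, ← h', ht]

open scoped Classical in
/-- If every relation is closed under passing from `a` and `b` to tuples between `a` and `a ∨ b`,
a single variable can be raised in a satisfying assignment. -/
theorem sat_update_true {cs : List (Cons Γ V)}
    (hcl : ∀ R ∈ Γ, UpClosed (R.2 : Set (Fin R.1 → Bool))) {a b : V → Bool}
    (ha : Sat cs a) (hb : Sat cs b) {v : V} (hbv : b v = true) :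
    Sat cs (Function.update a v true) := by
  intro c hc
  refine Finset.mem_coe.1 (hcl c.1.1 c.1.2 _ (ha c hc) _ (hb c hc) _ fun i => ?_)
  by_cases h : c.2 i = v
  · right; simp [h, hbv]
  · left; simp [h]

open scoped Classical in
theorem sat_update_false {cs : List (Cons Γ V)}
    (hcl : ∀ R ∈ Γ, UpClosed {s : Fin R.1 → Bool | (fun i => !s i) ∈ R.2}) {a b : V → Bool}
    (ha : Sat cs a) (hb : Sat cs b) {v : V} (hav : a v = false) :
    Sat cs (Function.update b v false) := by
  intro c hc
  have := hcl c.1.1 c.1.2 (fun i => !b (c.2 i)) (by simpa using hb c hc) (fun i => !a (c.2 i))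
    (by simpa using ha c hc) (fun i => !Function.update b v false (c.2 i)) fun i => by
      by_cases h : c.2 i = v
      · right; simp [h, hav]
      · left; simp [h]
  simpa using this

/-- The pinning relations have the closure property, so the failure comes from a relation of `Γ`. -/
theorem exists_link_true (h : ¬ ∀ R ∈ Γ ∪ pinLanguage, UpClosed (R.2 : Set (Fin R.1 → Bool))) :
    ∃ β, Nonempty (Link (Γ ∪ pinLanguage) true β) := by
  push Not at h
  obtain ⟨R, hR, h⟩ := h
  rcases Finset.mem_union.1 hR with hR | hR
  · obtain ⟨β, hβ⟩ := faceLink_of_not_upClosed h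
    exact ⟨β, hβ.exists_link hR⟩
  · obtain ⟨b, rfl⟩ := mem_pinLanguage hR
    exact absurd (upClosed_pinRel b) h

theorem exists_link_false
    (h : ¬ ∀ R ∈ Γ ∪ pinLanguage, UpClosed {s : Fin R.1 → Bool | (fun i => !s i) ∈ R.2}) :
    ∃ β, Nonempty (Link (Γ ∪ pinLanguage) false β) := by
  push Not at h
  obtain ⟨R, hR, h⟩ := h
  rcases Finset.mem_union.1 hR with hR | hR
  · obtain ⟨β, hβ⟩ := faceLink_of_not_upClosed h
    exact ⟨!β, FaceLink.exists_link hR (FaceLink.compl (R := (R.2 : Set (Fin R.1 → Bool))) hβ)⟩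
  · obtain ⟨b, rfl⟩ := mem_pinLanguage hR
    exact absurd (upClosed_compl_pinRel b) h

/-- If all relations were `UpClosed`, `u` alone could be raised in an assignment with `u = v = 0`,
and dually it could be lowered. Hence there are links with premise true and with premise false. -/
theorem exists_ringElem_of_three_le {d : ℕ} (hd : 3 ≤ d)
    {cs : List (Cons (Γ ∪ pinLanguage) V)} {u v : V} (huv : u ≠ v)
    (heq : ∀ s, Sat cs s → s u = s v) (hex : ∀ b, ∃ s, Sat cs s ∧ s u = b) :
    Nonempty (RingElem (Γ ∪ pinLanguage) d) := by
  classical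
  obtain ⟨a, ha, hau⟩ := hex false
  obtain ⟨b, hb, hbu⟩ := hex true
  obtain ⟨β, ⟨A⟩⟩ := exists_link_true (Γ := Γ) fun hcl => by
    have := heq _ (sat_update_true hcl ha hb hbu)
    simp [huv.symm, ← heq a ha, hau] at this
  obtain ⟨γ, ⟨B⟩⟩ := exists_link_false (Γ := Γ) fun hcl => by
    have := heq _ (sat_update_false hcl ha hb hau)
    simp [huv.symm, ← heq b hb, hbu] at this
  -- If neither link preserves its truth value, one leads from true to false and the other from
  -- false to true, so their composite leads from true to true.
  cases β
  · cases γ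
    · exact ⟨B.toRingElem hd⟩
    · exact ⟨(A.comp B).toRingElem hd⟩
  · exact ⟨A.toRingElem hd⟩

theorem exists_ringElem {d : ℕ} (h : SimulatesEquality Γ d) :
    Nonempty (RingElem (Γ ∪ pinLanguage) d) := by
  classical
  -- Three equal variables provide the three terminals needed when `d = 2`. The multiplicity `m`
  -- matters only through being positive.
  obtain ⟨I, hk, m, hm, hcard, hsat, hdeg, hdeg'⟩ := h 3 (by norm_num)
  let p : Fin 3 → Fin I.n := Fin.castLE hk
  have hp : Function.Injective p := Fin.castLE_injective hk
  have hocc : ∀ v, occ I.constraints v ≤ d := fun v => by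
    rw [← varDegree_eq_occ]
    exact (Finset.le_sup (f := I.varDegree) (Finset.mem_univ v)).trans hdeg
  have hocc' : ∀ i, occ I.constraints (p i) + 1 ≤ d := fun i => by
    rw [← varDegree_eq_occ]
    exact hdeg' i
  have heq : ∀ s, Sat I.constraints s → ∀ i j, s (p i) = s (p j) := fun s hs i j => by
    obtain ⟨b, hb⟩ := hsat s hs
    exact (hb i).trans (hb j).symm
  have hex : ∀ b, ∃ s, Sat I.constraints s ∧ s (p 0) = b := fun b => by
    have : 0 < Nat.card {s : Fin I.n → Bool //
        I.Satisfies s ∧ ∀ i : Fin 3, s (Fin.castLE hk i) = b} := by rw [hcard b]; exact hm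
    obtain ⟨⟨s, hs, hsb⟩⟩ := (Nat.card_pos_iff.1 this).1
    exact ⟨s, hs, hsb 0⟩
  have h01 : p 0 ≠ p 1 := fun h => absurd (hp h) (by decide)
  by_cases hd : 3 ≤ d
  · exact exists_ringElem_of_three_le hd h01 (fun s hs => heq s hs 0 1) hex
  by_cases hd2 : d = 2
  · subst hd2
    exact exists_ringElem_two I.nodup p hp hocc (fun i => by have := hocc' i; omega) heq hex
  -- For `d ≤ 1` the first terminal appears in no constraint and can be changed alone.
  · exfalso
    obtain ⟨a, ha, ha0⟩ := hex false
    have hzero : occ I.constraints (p 0) = 0 := by have := hocc' 0; omega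
    have hs : Sat I.constraints (Function.update a (p 0) true) := by
      refine sat_congr (fun c hc i => ?_) ha
      rw [Function.update_of_ne]
      intro h
      have := (consOcc_pos h).trans_le (consOcc_le_occ hc _)
      omega
    have := heq _ hs 0 1
    simp [h01.symm, ← heq a ha 0 1, ha0] at this

end

section

/-! ### Replacing variables by rings -/

namespace RingElem

variable {Γ Δ : ConstraintLanguage} {d : ℕ} (E : RingElem Δ d) {n K : ℕ}

/-- The variables of a ring element other than `r`. -/
abbrev Inner : Type := {t : E.T // t ≠ E.r}

/-- The variables of `n` rings with `K + 1` elements. -/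
abbrev RingVar (n K : ℕ) : Type := Fin n × Fin (K + 1) × E.Inner

/-- The variable `l`. -/
def innerL : E.Inner := ⟨E.l, E.l_ne_r⟩

/-- The variable `x`. -/
def innerX : E.Inner := ⟨E.x, E.x_ne_r⟩

open scoped Classical in
/-- The variables of the `j`-th element of the `v`-th ring. -/
def place (p : Fin n × Fin (K + 1)) (t : E.T) : E.RingVar n K :=
  if h : t = E.r then (p.1, p.2 + 1, E.innerL) else (p.1, p.2, ⟨t, h⟩)

theorem place_r (p : Fin n × Fin (K + 1)) : E.place p E.r = (p.1, p.2 + 1, E.innerL) := by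
  simp [place]

theorem place_of_ne (p : Fin n × Fin (K + 1)) {t : E.T} (h : t ≠ E.r) :
    E.place p t = (p.1, p.2, ⟨t, h⟩) := by
  simp [place, h]

/-- A ring with a single element would identify `l` with `r` of the same element. The existence of a
variable `v` and `n ≤ K` give at least two elements; with no variables there are no rings. -/
theorem add_one_ne_self (hK : n ≤ K) (v : Fin n) (j : Fin (K + 1)) : j + 1 ≠ j := by
  obtain ⟨m, rfl⟩ : ∃ m, K = m + 1 := ⟨K - 1, by have := v.2; omega⟩
  simp

theorem place_injective (hK : n ≤ K) (p : Fin n × Fin (K + 1)) :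
    Function.Injective (E.place p) := by
  intro t u h
  have hne := add_one_ne_self hK p.1 p.2
  by_cases ht : t = E.r <;> by_cases hu : u = E.r <;> simp_all [place]

/-- Only an `l` is shared: it is also the `r` of the cyclically preceding element. -/
theorem place_eq {p : Fin n × Fin (K + 1)} {t : E.T} {w : E.RingVar n K} (h : E.place p t = w) :
    (p = (w.1, w.2.1) ∧ t = w.2.2) ∨ (w.2.2 = E.innerL ∧ p = (w.1, w.2.1 - 1) ∧ t = E.r) := by
  subst h
  by_cases ht : t = E.r
  · subst ht; right; simp [place_r]
  · left; simp [place_of_ne, ht]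

/-- The constraints of an element of a ring. -/
def elemCons (p : Fin n × Fin (K + 1)) : List (Cons Δ (E.RingVar n K)) :=
  E.cons.map (mapScope (E.place p))

/-- The positions of all ring elements. -/
def positions (n K : ℕ) : List (Fin n × Fin (K + 1)) :=
  (List.finRange n).product (List.finRange (K + 1))

theorem mem_positions (p : Fin n × Fin (K + 1)) : p ∈ positions n K := by
  obtain ⟨v, j⟩ := p
  exact List.mem_product.2 ⟨List.mem_finRange v, List.mem_finRange j⟩

theorem nodup_positions : (positions n K).Nodup :=
  (List.nodup_finRange n).product (List.nodup_finRange (K + 1))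

/-- The constraints of all rings. -/
def ringCons (n K : ℕ) : List (Cons Δ (E.RingVar n K)) :=
  (positions n K).reverse.flatMap E.elemCons

theorem mem_ringCons {c : Cons Δ (E.RingVar n K)} (hc : c ∈ E.ringCons n K) :
    ∃ p, ∃ c' ∈ E.cons, c = mapScope (E.place p) c' := by
  obtain ⟨p, -, hc⟩ := List.mem_flatMap.1 hc
  obtain ⟨c', hc', rfl⟩ := List.mem_map.1 hc
  exact ⟨p, c', hc', rfl⟩

/-- Every constraint of an element involves a variable that is neither `l` nor `r`, and such a
variable belongs to no other element. -/
theorem nodup_ringCons (hK : n ≤ K) : (E.ringCons n K).Nodup := by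
  refine List.nodup_flatMap.2
    ⟨fun p _ => E.nodup.map (mapScope_injective (E.place_injective hK p)),
      (List.nodup_reverse.2 nodup_positions).imp fun {p q} hpq c hc hc' => ?_⟩
  obtain ⟨c₁, h₁, rfl⟩ := List.mem_map.1 hc
  obtain ⟨c₂, h₂, h⟩ := List.mem_map.1 hc'
  obtain ⟨i, hil, hir⟩ := E.exists_ne_lr c₁ h₁
  refine ne_of_scope (c := mapScope (E.place p) c₁) (i := i) (fun k hk => ?_) h.symm
  have hk : E.place q (c₂.2 k) = E.place p (c₁.2 i) := hk
  rw [E.place_of_ne p hir] at hk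
  rcases E.place_eq hk with h | h
  · exact hpq h.1.symm
  · exact hil (Subtype.ext_iff.1 h.1)

theorem sat_ringCons {s : E.RingVar n K → Bool} :
    Sat (E.ringCons n K) s ↔ ∀ p, Sat E.cons (s ∘ E.place p) := by
  constructor
  · intro h p
    rw [← sat_map]
    intro c hc
    exact h c (List.mem_flatMap.2 ⟨p, List.mem_reverse.2 (mem_positions p), hc⟩)
  · intro h c hc
    obtain ⟨p, c', hc', rfl⟩ := E.mem_ringCons hc
    exact h p c' hc'

theorem occ_flatMap {ι V : Type} (l : List ι) (f : ι → List (Cons Δ V)) (v : V) :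
    occ (l.flatMap f) v = (l.map fun k => occ (f k) v).sum := by
  induction l with
  | nil => rfl
  | cons k l ih => simp [occ_append, ih]

open scoped Classical in
theorem occ_elemCons_le (hK : n ≤ K) (p : Fin n × Fin (K + 1)) (w : E.RingVar n K) :
    occ (E.elemCons p) w ≤ (if p = (w.1, w.2.1) then occ E.cons w.2.2 else 0)
      + if p = (w.1, w.2.1 - 1) then if w.2.2 = E.innerL then occ E.cons E.r else 0 else 0 := by
  by_cases h : ∃ t, E.place p t = w
  · obtain ⟨t, ht⟩ := h
    have h1 : occ (E.elemCons p) w = occ E.cons t := by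
      rw [← ht]; exact occ_map (E.place_injective hK p) _ _
    rw [h1]
    rcases E.place_eq ht with ⟨h2, h3⟩ | ⟨h2, h3, h4⟩
    · rw [if_pos h2, h3]; exact Nat.le_add_right _ _
    · rw [if_pos h3, if_pos h2, h4]; exact Nat.le_add_left _ _
  · push Not at h
    rw [elemCons, occ_map_eq_zero h]
    exact Nat.zero_le _

open scoped Classical in
-- The second summand accounts for the preceding element, whose `r` is this `l`.
theorem occ_ringCons_le (hK : n ≤ K) (w : E.RingVar n K) :
    occ (E.ringCons n K) w ≤
      occ E.cons w.2.2 + if w.2.2 = E.innerL then occ E.cons E.r else 0 := by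
  rw [ringCons, occ_flatMap, List.map_reverse, List.sum_reverse,
    ← List.sum_toFinset _ nodup_positions]
  refine (Finset.sum_le_sum fun p _ => E.occ_elemCons_le hK p w).trans ?_
  rw [Finset.sum_add_distrib, Finset.sum_ite_eq', Finset.sum_ite_eq',
    if_pos (List.mem_toFinset.2 (mem_positions _)), if_pos (List.mem_toFinset.2 (mem_positions _))]

/-! The original constraints -/

/-- The number of appearances of variables in a list of constraints. -/
def totalArity {V : Type} (cs : List (Cons Γ V)) : ℕ := (cs.map fun c => c.1.1.1).sum

/-- A constraint over a larger language. -/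
def liftCons (h : Γ ⊆ Δ) {V : Type} (c : Cons Γ V) : Cons Δ V := ⟨⟨c.1.1, h c.1.2⟩, c.2⟩

theorem liftCons_injective (h : Γ ⊆ Δ) {V : Type} : Function.Injective (liftCons h (V := V)) := by
  rintro ⟨⟨R, hR⟩, g⟩ ⟨⟨R', hR'⟩, g'⟩ h
  simp only [liftCons, Sigma.mk.injEq, Subtype.mk.injEq] at h
  obtain ⟨rfl, h⟩ := h
  rw [heq_eq_eq] at h
  rw [h]

/-- The original constraints; each appearance of a variable is replaced by the variable `x` of the
ring element with the number of appearances that follow it. -/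
def useCons (h : Γ ⊆ Δ) (K : ℕ) : List (Cons Γ (Fin n)) → List (Cons Δ (E.RingVar n K))
  | [] => []
  | c :: cs => ⟨⟨c.1.1, h c.1.2⟩, fun i =>
      (c.2 i, Fin.ofNat (K + 1) (i.rev + totalArity cs), E.innerX)⟩ :: useCons h K cs

theorem map_fst_useCons (h : Γ ⊆ Δ) (cs : List (Cons Γ (Fin n))) :
    (E.useCons h K cs).map (mapScope Prod.fst) = cs.map (liftCons h) := by
  induction cs with
  | nil => rfl
  | cons c cs ih => simp only [useCons, List.map_cons, ih, mapScope, liftCons]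

/-- Replacing ring variables by the index of their ring recovers the original constraints, so
distinctness is inherited. -/
theorem nodup_useCons (h : Γ ⊆ Δ) {cs : List (Cons Γ (Fin n))} (hcs : cs.Nodup) :
    (E.useCons h K cs).Nodup := by
  refine List.Nodup.of_map (mapScope Prod.fst) ?_
  rw [map_fst_useCons]
  exact hcs.map (liftCons_injective h)

theorem useCons_scope (h : Γ ⊆ Δ) {cs : List (Cons Γ (Fin n))} (hK : totalArity cs ≤ K)
    {c : Cons Δ (E.RingVar n K)} (hc : c ∈ E.useCons h K cs) (i) :
    ((c.2 i).2.1 : ℕ) < totalArity cs ∧ (c.2 i).2.2 = E.innerX := by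
  induction cs with
  | nil => simp [useCons] at hc
  | cons b cs ih =>
    have hb : totalArity (b :: cs) = b.1.1.1 + totalArity cs := by simp [totalArity]
    rw [hb] at hK ⊢
    rcases List.mem_cons.1 hc with rfl | hc
    · have hi := (Fin.rev (n := b.1.1.1) i).2
      refine ⟨?_, rfl⟩
      simp only [Fin.val_ofNat]
      refine (Nat.mod_le _ _).trans_lt ?_
      omega
    · have := ih (by omega) hc
      exact ⟨by omega, this.2⟩

/-- Appearances are numbered from the end of the list, over all variables together. Different
appearances therefore use different ring elements, and `totalArity cs ≤ K` prevents the numbers from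
wrapping around. -/
theorem occ_useCons_le (h : Γ ⊆ Δ) {cs : List (Cons Γ (Fin n))} (hK : totalArity cs ≤ K)
    (w : E.RingVar n K) : occ (E.useCons h K cs) w ≤ 1 := by
  induction cs with
  | nil => simp [useCons]
  | cons b cs ih =>
    have hb : totalArity (b :: cs) = b.1.1.1 + totalArity cs := by simp [totalArity]
    rw [hb] at hK
    have hval : ∀ i : Fin b.1.1.1,
        ((Fin.ofNat (K + 1) (i.rev + totalArity cs) : Fin (K + 1)) : ℕ)
          = i.rev + totalArity cs := by
      intro i
      rw [Fin.val_ofNat, Nat.mod_eq_of_lt]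
      have := i.rev.2
      omega
    rw [useCons, occ_cons]
    by_cases hw : ∃ i : Fin b.1.1.1,
        (b.2 i, Fin.ofNat (K + 1) (i.rev + totalArity cs), E.innerX) = w
    · obtain ⟨i, rfl⟩ := hw
      rw [occ_eq_zero (cs := E.useCons h K cs)]
      · refine consOcc_le_one fun (k : Fin b.1.1.1) (m : Fin b.1.1.1) hk hm => ?_
        have hkm : Fin.ofNat (K + 1) (k.rev + totalArity cs)
            = Fin.ofNat (K + 1) (m.rev + totalArity cs) :=
          congrArg (fun w : E.RingVar n K => w.2.1) (hk.trans hm.symm)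
        have := congrArg Fin.val hkm
        rw [hval, hval] at this
        exact Fin.rev_injective (Fin.ext (Nat.add_right_cancel this))
      · intro c hc k hk
        have := (E.useCons_scope h (by omega) hc k).1
        rw [hk] at this
        simp only [hval] at this
        omega
    · push Not at hw
      refine (Nat.add_le_add_right (consOcc_eq_zero hw).le _).trans ?_
      rw [Nat.zero_add]
      exact ih (by omega)

/-! The resulting instance -/

/-- All constraints of the instance in which each variable is replaced by a ring. -/
def allCons (h : Γ ⊆ Δ) (K : ℕ) (cs : List (Cons Γ (Fin n))) : List (Cons Δ (E.RingVar n K)) :=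
  E.useCons h K cs ++ E.ringCons n K

/-- The original constraints now involve only variables `x`, whereas every ring constraint involves
another one. An original constraint without variables causes no clash either, since ring constraints
have nonempty scopes. -/
theorem nodup_allCons (h : Γ ⊆ Δ) {cs : List (Cons Γ (Fin n))} (hcs : cs.Nodup) (hn : n ≤ K)
    (hK : totalArity cs ≤ K) : (E.allCons h K cs).Nodup := by
  refine (E.nodup_useCons h hcs).append (E.nodup_ringCons hn) fun c hc hc' => ?_
  obtain ⟨p, c', hc'', rfl⟩ := E.mem_ringCons hc'
  obtain ⟨i, hi⟩ := E.exists_ne_x c' hc''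
  have hx : (E.place p (c'.2 i)).2.2 = E.innerX := (E.useCons_scope h hK hc i).2
  by_cases hr : c'.2 i = E.r
  · rw [hr, place_r] at hx
    exact E.l_ne_x (Subtype.ext_iff.1 hx)
  · rw [place_of_ne _ _ hr] at hx
    exact hi (Subtype.ext_iff.1 hx)

/-- The three fields on degrees are used separately: `occ_x` leaves room for the one use of an `x`,
`occ_lr` pays for the identified terminals, and `occ_le` covers the rest. -/
theorem occ_allCons_le (h : Γ ⊆ Δ) {cs : List (Cons Γ (Fin n))} (hn : n ≤ K)
    (hK : totalArity cs ≤ K) (w : E.RingVar n K) : occ (E.allCons h K cs) w ≤ d := by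
  rw [allCons, occ_append]
  have h1 := E.occ_ringCons_le hn w
  by_cases hx : w.2.2 = E.innerX
  · have hl : w.2.2 ≠ E.innerL := by
      rw [hx]
      exact fun h => E.l_ne_x (Subtype.ext_iff.1 h).symm
    rw [if_neg hl, hx] at h1
    have h2 := E.occ_useCons_le h hK w
    have h3 := E.occ_x
    simp only [innerX] at h1
    omega
  · have h2 : occ (E.useCons h K cs) w = 0 :=
      occ_eq_zero fun c hc i hi => hx (hi ▸ (E.useCons_scope h hK hc i).2)
    rw [h2]
    split_ifs at h1 with hl
    · have h3 := E.occ_lr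
      rw [hl] at h1
      simp only [innerL] at h1
      omega
    · have := E.occ_le w.2.2
      omega

/-- The satisfying assignment of a ring element with `l = r = b`. -/
def sol (b : Bool) : E.T → Bool := (E.existsUnique_sat b).choose

theorem sat_sol (b : Bool) : Sat E.cons (E.sol b) := (E.existsUnique_sat b).choose_spec.1.1

theorem sol_l (b : Bool) : E.sol b E.l = b := (E.existsUnique_sat b).choose_spec.1.2.1

theorem sol_r (b : Bool) : E.sol b E.r = b := (E.existsUnique_sat b).choose_spec.1.2.2

theorem eq_sol {b : Bool} {s : E.T → Bool} (hs : Sat E.cons s) (hl : s E.l = b) (hr : s E.r = b) :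
    s = E.sol b := (E.existsUnique_sat b).choose_spec.2 s ⟨hs, hl, hr⟩

/-- For the value other than `val`, argue backwards: `x = val` would force `r = val`. -/
theorem sol_x (b : Bool) : E.sol b E.x = b := by
  by_cases hb : b = E.val
  · rw [E.imp_x _ (E.sat_sol b) ((E.sol_l b).trans hb), hb]
  · by_contra h
    have hx : E.sol b E.x = E.val := by
      revert hb h
      cases E.sol b E.x <;> cases b <;> cases E.val <;> simp
    exact hb ((E.sol_r b).symm.trans (E.imp_r _ (E.sat_sol b) hx))

/-- The assignment that gives all variables of the `v`-th ring the value `σ v`, up to the choice of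
the remaining variables. -/
def extend (σ : Fin n → Bool) : E.RingVar n K → Bool := fun w => E.sol (σ w.1) w.2.2

theorem extend_comp_place (σ : Fin n → Bool) (p : Fin n × Fin (K + 1)) :
    E.extend σ ∘ E.place p = E.sol (σ p.1) := by
  funext t
  by_cases ht : t = E.r
  · subst ht
    simp [place_r, extend, innerL, sol_l, sol_r]
  · simp [place_of_ne _ _ ht, extend]

/-- The value `val` is passed on from each `l` to the next. In a cycle, either all the `l` have this
value or none has, so in both cases they agree, and uniqueness within each element fixes the
remaining variables. -/
theorem sat_ringCons_iff {s : E.RingVar n K → Bool} :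
    Sat (E.ringCons n K) s ↔ s = E.extend fun v => s (v, 0, E.innerL) := by
  rw [sat_ringCons]
  constructor
  · intro h
    have hl : ∀ v j, (s ∘ E.place (v, j)) E.l = s (v, j, E.innerL) := fun v j => by
      simp [place_of_ne _ _ E.l_ne_r, innerL]
    have hr : ∀ v j, (s ∘ E.place (v, j)) E.r = s (v, j + 1, E.innerL) := fun v j => by
      simp [place_r]
    have hstep : ∀ v j, s (v, j, E.innerL) = E.val → s (v, j + 1, E.innerL) = E.val := by
      intro v j hj
      rw [← hr]
      exact E.imp_r _ (h (v, j)) (E.imp_x _ (h (v, j)) ((hl v j).trans hj))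
    have hall : ∀ v j, s (v, j, E.innerL) = E.val → ∀ j', s (v, j', E.innerL) = E.val := by
      intro v j hj j'
      have : ∀ m : ℕ, s (v, j + Fin.ofNat (K + 1) m, E.innerL) = E.val := by
        intro m
        induction m with
        | zero => simpa using hj
        | succ m ih =>
          have := hstep v _ ih
          rwa [add_assoc, show (Fin.ofNat (K + 1) m : Fin (K + 1)) + 1 = Fin.ofNat (K + 1) (m + 1)
            from by ext; simp [Fin.val_add]] at this
      -- Going round the cycle by `j' - j` steps reaches every other element.
      have h' := this (j' - j : Fin (K + 1))
      rwa [Fin.ofNat_val_eq_self, add_sub_cancel] at h'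
    have hconst : ∀ v j, s (v, j, E.innerL) = s (v, 0, E.innerL) := by
      intro v j
      by_cases hj : s (v, j, E.innerL) = E.val
      · rw [hj, hall v j hj 0]
      · have h0 : s (v, 0, E.innerL) ≠ E.val := fun h0 => hj (hall v 0 h0 j)
        revert hj h0
        cases s (v, j, E.innerL) <;> cases s (v, 0, E.innerL) <;> cases E.val <;> simp
    funext ⟨v, j, t, ht⟩
    have := E.eq_sol (b := s (v, 0, E.innerL)) (h (v, j)) ((hl v j).trans (hconst v j))
      ((hr v j).trans (hconst v (j + 1)))
    have := congrFun this t
    simpa [place_of_ne _ _ ht, extend] using this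
  · intro h p
    rw [h, extend_comp_place]
    exact E.sat_sol _

theorem sat_useCons_extend (h : Γ ⊆ Δ) {cs : List (Cons Γ (Fin n))} (hK : totalArity cs ≤ K)
    {σ : Fin n → Bool} : Sat (E.useCons h K cs) (E.extend σ) ↔ Sat cs σ := by
  have h1 : Sat ((E.useCons h K cs).map (mapScope Prod.fst)) σ ↔ Sat cs σ := by
    rw [map_fst_useCons]
    simp only [Sat, List.forall_mem_map]
    rfl
  rw [← h1, sat_map]
  have h2 : ∀ c ∈ E.useCons h K cs, ∀ i, E.extend σ (c.2 i) = (σ ∘ Prod.fst) (c.2 i) := by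
    intro c hc i
    simp only [extend, (E.useCons_scope h hK hc i).2, Function.comp_apply]
    exact E.sol_x _
  exact ⟨sat_congr h2, sat_congr fun c hc i => (h2 c hc i).symm⟩

/-- Restriction to the variables `l` of the elements at position 0 is inverse to `extend`. The
reduction is thus parsimonious. -/
theorem card_sat_allCons (h : Γ ⊆ Δ) {cs : List (Cons Γ (Fin n))} (hK : totalArity cs ≤ K) :
    Nat.card {s // Sat (E.allCons h K cs) s} = Nat.card {σ // Sat cs σ} := by
  have hext : ∀ σ : Fin n → Bool, (fun v => E.extend (K := K) σ (v, 0, E.innerL)) = σ :=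
    fun σ => funext fun v => E.sol_l _
  have hsat : ∀ {s}, Sat (E.allCons h K cs) s ↔
      Sat (E.useCons h K cs) s ∧ s = E.extend fun v => s (v, 0, E.innerL) := fun {s} => by
    rw [allCons, sat_append, sat_ringCons_iff]
  refine Nat.card_congr
    ⟨fun s => ⟨fun v => s.1 (v, 0, E.innerL), ?_⟩, fun σ => ⟨E.extend σ.1, ?_⟩, fun s => ?_,
      fun σ => Subtype.ext (hext σ.1)⟩
  · have hs := hsat.1 s.2
    rw [← E.sat_useCons_extend h hK, ← hs.2]
    exact hs.1
  · rw [hsat, hext]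
    exact ⟨(E.sat_useCons_extend h hK).2 σ.2, rfl⟩
  · exact Subtype.ext (hsat.1 s.2).2.symm

/-- The number of variables of a ring element other than `r`. -/
def size : ℕ := Nat.card E.Inner

/-- The number of a variable within its ring element. -/
def code (t : E.Inner) : ℕ := Finite.equivFin E.Inner t

/-- The numbering of the variables of the rings. -/
def number (n K : ℕ) : E.RingVar n K ≃ Fin (n * ((K + 1) * E.size)) :=
  (Equiv.prodCongr (Equiv.refl _)
    ((Equiv.prodCongr (Equiv.refl _) (Finite.equivFin E.Inner)).trans finProdFinEquiv)).trans
      finProdFinEquiv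

/-- Up to a constant depending on the inner variable, the number is `E.size` times the global index
of the ring element. The machine can therefore write it in unary by copying counters. -/
theorem number_val (w : E.RingVar n K) :
    (E.number n K w : ℕ) = E.size * (w.1 * (K + 1) + w.2.1) + E.code w.2.2 := by
  have h : (E.number n K w : ℕ)
      = E.code w.2.2 + E.size * w.2.1 + (K + 1) * E.size * w.1 := rfl
  rw [h]
  ring

/-- The instance in which each variable is replaced by a ring. -/
def ringInstance (h : Γ ⊆ Δ) (I : CSPInstance Γ) (hn : I.n ≤ K)
    (hK : totalArity I.constraints ≤ K) : CSPInstance Δ where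
  n := I.n * ((K + 1) * E.size)
  constraints := (E.allCons h K I.constraints).map (mapScope (E.number I.n K))
  nodup := (E.nodup_allCons h I.nodup hn hK).map (mapScope_injective (E.number I.n K).injective)

theorem Z_ringInstance (h : Γ ⊆ Δ) (I : CSPInstance Γ) (hn : I.n ≤ K)
    (hK : totalArity I.constraints ≤ K) : (E.ringInstance h I hn hK).Z = I.Z := by
  refine Eq.trans ?_ (E.card_sat_allCons h hK)
  refine Nat.card_congr (Equiv.subtypeEquiv
    (Equiv.arrowCongr (E.number I.n K).symm (Equiv.refl Bool)) fun s => ?_)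
  exact sat_map (f := E.number I.n K) (s := s)

theorem degree_ringInstance (h : Γ ⊆ Δ) (I : CSPInstance Γ) (hn : I.n ≤ K)
    (hK : totalArity I.constraints ≤ K) : (E.ringInstance h I hn hK).degree ≤ d := by
  refine Finset.sup_le fun v _ => ?_
  rw [varDegree_eq_occ]
  obtain ⟨w, rfl⟩ := (E.number I.n K).surjective v
  exact (occ_map (E.number I.n K).injective _ w).trans_le (E.occ_allCons_le h hn hK w)

end RingElem

end

section

/-! ### The words that describe the resulting instance -/

variable {Γ Δ : ConstraintLanguage} {d : ℕ}

/-- A block of unary digits. -/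
abbrev digits (Δ : ConstraintLanguage) (k : ℕ) : List (CSPSym Δ) :=
  List.replicate k (Sum.inl true)

theorem digits_add (a b : ℕ) : digits Δ (a + b) = digits Δ a ++ digits Δ b := by
  rw [digits, List.replicate_add]

/-- The word for a list of constraints. -/
def consWord {n : ℕ} (cs : List (Cons Δ (Fin n))) : List (CSPSym Δ) := (cs.map encodeCons).flatten

theorem consWord_append {n : ℕ} (cs cs' : List (Cons Δ (Fin n))) :
    consWord (cs ++ cs') = consWord cs ++ consWord cs' := by simp [consWord]

theorem consWord_cons {n : ℕ} (c : Cons Δ (Fin n)) (cs : List (Cons Δ (Fin n))) :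
    consWord (c :: cs)
      = Sum.inr c.1 :: ((List.ofFn fun i => unary Δ (c.2 i)).flatten ++ consWord cs) := by
  simp [consWord, encodeCons]

/-- The number of terminators in a word. -/
def terminators : List (CSPSym Γ) → ℕ
  | [] => 0
  | Sum.inl false :: u => terminators u + 1
  | _ :: u => terminators u

theorem terminators_le_length (u : List (CSPSym Γ)) : terminators u ≤ u.length := by
  induction u with
  | nil => simp [terminators]
  | cons a u ih =>
    rcases a with b | R
    · cases b <;> simp [terminators] <;> omega
    · simp [terminators]; omega

theorem terminators_unary_append (a : ℕ) (u : List (CSPSym Γ)) :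
    terminators (unary Γ a ++ u) = terminators u + 1 := by
  induction a with
  | zero => simp [unary, terminators]
  | succ a ih =>
    rw [← ih]
    simp [unary, List.replicate_succ, terminators]

theorem terminators_scope_append {r : ℕ} (f : Fin r → ℕ) (u : List (CSPSym Γ)) :
    terminators ((List.ofFn fun i => unary Γ (f i)).flatten ++ u) = r + terminators u := by
  induction r with
  | zero => simp
  | succ r ih =>
    rw [List.ofFn_succ, List.flatten_cons, List.append_assoc, terminators_unary_append, ih]
    omega

/-- Each appearance of a variable ends with one terminator. While reading backwards, the machine
obtains the number of the current appearance by counting terminators. -/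
theorem terminators_consWord {n : ℕ} (cs : List (Cons Γ (Fin n))) :
    terminators (consWord cs) = RingElem.totalArity cs := by
  induction cs with
  | nil => rfl
  | cons c cs ih =>
    rw [consWord_cons, terminators, terminators_scope_append, ih]
    · simp [RingElem.totalArity]
    · simp

namespace RingElem

variable (E : RingElem Δ d) {n K : ℕ}

/-- The word for the original constraints, with each variable replaced by a variable of its ring. -/
def useWord (h : Γ ⊆ Δ) (K : ℕ) : List (CSPSym Γ) → List (CSPSym Δ)
  | [] => []
  | Sum.inl true :: u => digits Δ (E.size * (K + 1)) ++ useWord h K u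
  | Sum.inl false :: u =>
    digits Δ (E.size * terminators u) ++ (digits Δ (E.code E.innerX)
      ++ Sum.inl false :: useWord h K u)
  | Sum.inr R :: u => Sum.inr ⟨R.1, h R.2⟩ :: useWord h K u

theorem useWord_unary_append (h : Γ ⊆ Δ) (a : ℕ) (u : List (CSPSym Γ)) :
    E.useWord h K (unary Γ a ++ u)
      = unary Δ (E.size * (a * (K + 1) + terminators u) + E.code E.innerX) ++ E.useWord h K u := by
  induction a with
  | zero => simp [unary, useWord, List.replicate_add, -List.replicate_append_replicate]
  | succ a ih =>
    have h1 : unary Γ (a + 1) ++ u = Sum.inl true :: (unary Γ a ++ u) := by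
      simp [unary, List.replicate_succ]
    rw [h1, useWord, ih, show E.size * ((a + 1) * (K + 1) + terminators u) + E.code E.innerX
      = E.size * (K + 1) + (E.size * (a * (K + 1) + terminators u) + E.code E.innerX) by ring]
    simp only [unary, digits, List.append_assoc, List.replicate_add]

theorem useWord_scope_append (h : Γ ⊆ Δ) {r : ℕ} (f : Fin r → ℕ) (u : List (CSPSym Γ)) :
    E.useWord h K ((List.ofFn fun i => unary Γ (f i)).flatten ++ u)
      = (List.ofFn fun i => unary Δ
          (E.size * (f i * (K + 1) + (i.rev + terminators u)) + E.code E.innerX)).flatten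
        ++ E.useWord h K u := by
  induction r with
  | zero => simp
  | succ r ih =>
    rw [List.ofFn_succ, List.flatten_cons, List.append_assoc, useWord_unary_append, ih,
      terminators_scope_append, List.ofFn_succ, List.flatten_cons, List.append_assoc]
    simp [Fin.rev_zero, Fin.val_rev]

theorem useWord_consWord (h : Γ ⊆ Δ) {cs : List (Cons Γ (Fin n))} (hK : totalArity cs ≤ K) :
    E.useWord h K (consWord cs)
      = consWord ((E.useCons h K cs).map (mapScope (E.number n K))) := by
  induction cs with
  | nil => rfl
  | cons c cs ih =>
    have hc : totalArity (c :: cs) = c.1.1.1 + totalArity cs := by simp [totalArity]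
    rw [hc] at hK
    rw [consWord_cons, useWord, useWord_scope_append, ih (by omega), useCons, List.map_cons,
      consWord_cons, terminators_consWord]
    congr 4
    funext i
    simp only [mapScope, number_val, Fin.val_ofNat]
    rw [Nat.mod_eq_of_lt]
    have := (Fin.rev (n := c.1.1.1) i).2
    omega

/-- The tokens of the word for a ring element: a symbol, or a block of digits that depends on the
position of the element (`true`) or of its ring (`false`). -/
abbrev Token (Δ : ConstraintLanguage) : Type := CSPSym Δ ⊕ Bool

/-- The word for a token, for the `q`-th element in the ring that starts with the `v`-th one. -/
def interp (q v : ℕ) : Token Δ → List (CSPSym Δ)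
  | Sum.inl a => [a]
  | Sum.inr true => digits Δ (E.size * q)
  | Sum.inr false => digits Δ (E.size * v)

/-- A block of digits as a list of tokens. -/
abbrev digitTokens (Δ : ConstraintLanguage) (k : ℕ) : List (Token Δ) :=
  List.replicate k (Sum.inl (Sum.inl true))

theorem flatMap_interp_digitTokens (q v k : ℕ) :
    (digitTokens Δ k).flatMap (E.interp q v) = digits Δ k := by
  induction k with
  | zero => rfl
  | succ k ih => simp_all [digits, List.replicate_succ, interp]

open scoped Classical in
/-- The tokens for a variable of a ring element, which is the last one of its ring if `last` is
set. -/
def varTokens (last : Bool) (t : E.T) : List (Token Δ) :=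
  if h : t = E.r then
    (if last then [Sum.inr false] else Sum.inr true :: digitTokens Δ E.size)
      ++ (digitTokens Δ (E.code E.innerL) ++ [Sum.inl (Sum.inl false)])
  else Sum.inr true :: (digitTokens Δ (E.code ⟨t, h⟩) ++ [Sum.inl (Sum.inl false)])

/-- The tokens for a ring element. -/
def tokens (last : Bool) : List (Token Δ) :=
  (E.cons.map fun c =>
    Sum.inl (Sum.inr c.1) :: (List.ofFn fun i => E.varTokens last (c.2 i)).flatten).flatten

/-- The word for a ring element. -/
def elemWord (q v : ℕ) (last : Bool) : List (CSPSym Δ) := (E.tokens last).flatMap (E.interp q v)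

/-- The `r` of the last element is the `l` of the first one in the same ring, so its number starts
from the beginning of the ring; otherwise it lies `E.size` further than the current element. -/
theorem flatMap_varTokens (p : Fin n × Fin (K + 1)) (t : E.T) :
    (E.varTokens (decide (p.2 = Fin.last K)) t).flatMap
        (E.interp (p.1 * (K + 1) + p.2) (p.1 * (K + 1)))
      = unary Δ (E.number n K (E.place p t)) := by
  obtain ⟨v, j⟩ := p
  by_cases ht : t = E.r
  · subst ht
    rw [place_r, number_val, varTokens]
    by_cases hj : j = Fin.last K
    · subst hj
      simp [interp, flatMap_interp_digitTokens, unary, List.replicate_add, -List.replicate_append_replicate]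
    · have hj' : ((j + 1 : Fin (K + 1)) : ℕ) = j + 1 :=
        Fin.val_add_one_of_lt (lt_of_le_of_ne (Fin.le_last j) hj)
      simp only [hj, dite_true, decide_false, Bool.false_eq_true, if_false, List.cons_append,
        List.flatMap_cons, List.flatMap_append, flatMap_interp_digitTokens, List.flatMap_nil,
        List.append_nil, interp, unary, hj']
      rw [show E.size * (v * (K + 1) + (j + 1)) + E.code E.innerL
        = E.size * (v * (K + 1) + j) + (E.size + E.code E.innerL) by ring]
      simp [List.replicate_add, -List.replicate_append_replicate]
  · rw [place_of_ne _ _ ht, number_val, varTokens, dif_neg ht]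
    simp [interp, flatMap_interp_digitTokens, unary, List.replicate_add, -List.replicate_append_replicate]

theorem elemWord_eq (p : Fin n × Fin (K + 1)) :
    E.elemWord (p.1 * (K + 1) + p.2) (p.1 * (K + 1)) (decide (p.2 = Fin.last K))
      = consWord ((E.elemCons p).map (mapScope (E.number n K))) := by
  rw [elemWord, tokens, consWord, elemCons]
  induction E.cons with
  | nil => rfl
  | cons c cs ih =>
    simp only [List.map_cons, List.flatten_cons, List.flatMap_append, ih]
    congr 1
    rw [List.flatMap_cons, encodeCons, interp, List.singleton_append]
    congr 1
    simp only [List.flatMap_def, List.map_flatten, List.map_ofFn, List.flatten_flatten]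
    congr 2
    funext i
    have := E.flatMap_varTokens p (c.2 i)
    rw [List.flatMap_def] at this
    exact this

/-- The word for the first `j` elements of a ring. -/
def chainWord (v : ℕ) : ℕ → List (CSPSym Δ)
  | 0 => []
  | j + 1 => E.elemWord (v + j) v false ++ chainWord v j

/-- The word for `n` rings. -/
def ringWord (K : ℕ) : ℕ → List (CSPSym Δ)
  | 0 => []
  | n + 1 => (E.elemWord (n * (K + 1) + K) (n * (K + 1)) true
      ++ E.chainWord (n * (K + 1)) K) ++ ringWord K n

theorem chainWord_eq (v m : ℕ) :
    E.chainWord v m = (List.range m).reverse.flatMap fun j => E.elemWord (v + j) v false := by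
  induction m with
  | zero => rfl
  | succ m ih => simp [chainWord, List.range_succ, ih]

theorem ringWord_eq (n K : ℕ) :
    E.ringWord K n = ((List.range n).product (List.range (K + 1))).reverse.flatMap fun p =>
      E.elemWord (p.1 * (K + 1) + p.2) (p.1 * (K + 1)) (decide (p.2 = K)) := by
  induction n with
  | zero => rfl
  | succ n ih =>
    rw [ringWord, ih, chainWord_eq]
    simp only [List.product, List.range_succ, List.flatMap_append, List.reverse_append,
      List.flatMap_cons, List.flatMap_nil, List.append_nil, List.map_append, List.map_cons,
      List.map_nil, List.reverse_cons, List.reverse_nil, List.nil_append, List.append_assoc,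
      decide_true, ← List.map_reverse, List.flatMap_map]
    congr 2
    refine List.flatMap_congr fun j hj => ?_
    have : j ≠ K := by
      have := List.mem_range.1 (List.mem_reverse.1 hj)
      omega
    simp [this]

/-- The recursion puts later elements in front, as happens when a word is pushed onto a stack. This
is why `ringCons` lists the positions in reverse. -/
theorem ringWord_eq_consWord (n K : ℕ) :
    E.ringWord K n = consWord ((E.ringCons n K).map (mapScope (E.number n K))) := by
  have h : (List.range n).product (List.range (K + 1))
      = (positions n K).map fun p => ((p.1 : ℕ), (p.2 : ℕ)) := by
    simp only [positions, List.product, ← List.map_coe_finRange_eq_range, List.flatMap_map,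
      List.map_flatMap, List.map_map, Function.comp_def]
  rw [ringWord_eq, h, ← List.map_reverse, List.flatMap_map, ringCons]
  induction (positions n K).reverse with
  | nil => rfl
  | cons p l ih =>
    rw [List.flatMap_cons, ih, List.flatMap_cons, List.map_append, consWord_append, ← elemWord_eq]
    simp [Fin.ext_iff]

/-- The recursive words on the right are those that the machine builds up on its query stack, from
the end to the beginning. -/
theorem encode_ringInstance (h : Γ ⊆ Δ) (I : CSPInstance Γ) (hn : I.n ≤ K)
    (hK : totalArity I.constraints ≤ K) :
    (E.ringInstance h I hn hK).encode = digits Δ (E.size * (I.n * (K + 1))) ++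
      Sum.inl false :: (E.useWord h K (consWord I.constraints) ++ E.ringWord K I.n) := by
  rw [useWord_consWord E h hK, ringWord_eq_consWord, ← consWord_append, ← List.map_append,
    ← allCons, CSPInstance.encode, unary, List.append_assoc, List.singleton_append]
  congr 2
  simp only [ringInstance]
  ring

end RingElem

end

section

/-! ### The machine -/

/-- The counters of the machine. -/
inductive Ctr
  | nc | lc | lt | q | v | tmp | j
  deriving DecidableEq

instance : Fintype Ctr :=
  ⟨{Ctr.nc, Ctr.lc, Ctr.lt, Ctr.q, Ctr.v, Ctr.tmp, Ctr.j}, fun k => by cases k <;> decide⟩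

/-- The work stacks: the reversed input, the reversed answer, and the counters. -/
abbrev Work : Type := Bool ⊕ Ctr

/-- The alphabets of the work stacks. -/
def workSym (A : Type) : Work → Type
  | Sum.inl true => A
  | Sum.inl false => Bool
  | Sum.inr _ => Bool

instance (A : Type) [Finite A] : ∀ w, Finite (workSym A w)
  | Sum.inl true => inferInstanceAs (Finite A)
  | Sum.inl false => inferInstanceAs (Finite Bool)
  | Sum.inr _ => inferInstanceAs (Finite Bool)

/-- The contents of all stacks, the counters being given as numbers. -/
structure Mem (A B : Type) where
  input : List A
  eps : List Bool
  query : List B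
  delta : List Bool
  answer : List Bool
  output : List Bool
  rev : List A
  bits : List Bool
  cnt : Ctr → ℕ

namespace Mem

variable {A B : Type}

/-- The stacks with the given contents. -/
def stk (s : Mem A B) : ∀ k : Port ⊕ Work, List (StackSym A B (workSym A) k)
  | Sum.inl Port.input => s.input
  | Sum.inl Port.eps => s.eps
  | Sum.inl Port.query => s.query
  | Sum.inl Port.delta => s.delta
  | Sum.inl Port.answer => s.answer
  | Sum.inl Port.output => s.output
  | Sum.inr (Sum.inl true) => s.rev
  | Sum.inr (Sum.inl false) => s.bits
  | Sum.inr (Sum.inr k) => (List.replicate (s.cnt k) true : List Bool)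

variable (s : Mem A B)

theorem update_input (l : List A) :
    Function.update s.stk (Sum.inl Port.input) l = { s with input := l }.stk := by
  funext k
  rcases k with (_ | _) | (_ | _) | k <;> rfl

theorem update_eps (l : List Bool) :
    Function.update s.stk (Sum.inl Port.eps) l = { s with eps := l }.stk := by
  funext k
  rcases k with (_ | _) | (_ | _) | k <;> rfl

theorem update_query (l : List B) :
    Function.update s.stk (Sum.inl Port.query) l = { s with query := l }.stk := by
  funext k
  rcases k with (_ | _) | (_ | _) | k <;> rfl

theorem update_delta (l : List Bool) :
    Function.update s.stk (Sum.inl Port.delta) l = { s with delta := l }.stk := by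
  funext k
  rcases k with (_ | _) | (_ | _) | k <;> rfl

theorem update_answer (l : List Bool) :
    Function.update s.stk (Sum.inl Port.answer) l = { s with answer := l }.stk := by
  funext k
  rcases k with (_ | _) | (_ | _) | k <;> rfl

theorem update_output (l : List Bool) :
    Function.update s.stk (Sum.inl Port.output) l = { s with output := l }.stk := by
  funext k
  rcases k with (_ | _) | (_ | _) | k <;> rfl

theorem update_rev (l : List A) :
    Function.update s.stk (Sum.inr (Sum.inl true)) l = { s with rev := l }.stk := by
  funext k
  rcases k with (_ | _) | (_ | _) | k <;> rfl

theorem update_bits (l : List Bool) :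
    Function.update s.stk (Sum.inr (Sum.inl false)) l = { s with bits := l }.stk := by
  funext k
  rcases k with (_ | _) | (_ | _) | k <;> rfl

theorem update_cnt (k : Ctr) (m : ℕ) :
    Function.update s.stk (Sum.inr (Sum.inr k)) (List.replicate m true : List Bool)
      = { s with cnt := Function.update s.cnt k m }.stk := by
  funext k'
  rcases k' with (_ | _) | (_ | _) | k' <;> try rfl
  by_cases h : k' = k
  · subst h
    refine (Function.update_self ..).trans ?_
    simp only [stk, Function.update_self]
    rfl
  · refine (Function.update_of_ne (by simpa using h) ..).trans ?_
    simp only [stk, Function.update_of_ne h]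
    rfl

theorem update_cnt_push (k : Ctr) :
    Function.update s.stk (Sum.inr (Sum.inr k)) ((true : Bool) :: (s.stk (Sum.inr (Sum.inr k)) :))
      = { s with cnt := Function.update s.cnt k (s.cnt k + 1) }.stk :=
  s.update_cnt k (s.cnt k + 1)

theorem update_cnt_tail (k : Ctr) :
    Function.update s.stk (Sum.inr (Sum.inr k)) (s.stk (Sum.inr (Sum.inr k))).tail
      = { s with cnt := Function.update s.cnt k (s.cnt k - 1) }.stk := by
  rw [← s.update_cnt k]
  congr 1
  exact List.tail_replicate ..

end Mem

/-- The main labels of the machine, other than those for writing a ring element. -/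
inductive Base
  | readNum | readBody | tol | outer | inner | restore | stream | incJ | ask | cap | ans | fin
  deriving DecidableEq

instance : Fintype Base :=
  ⟨{Base.readNum, Base.readBody, Base.tol, Base.outer, Base.inner, Base.restore, Base.stream,
    Base.incJ, Base.ask, Base.cap, Base.ans, Base.fin}, fun b => by cases b <;> decide⟩

namespace RingElem

open Turing.TM2 (Stmt)

variable {Γ Δ : ConstraintLanguage} {d : ℕ} (E : RingElem Δ d)

/-- The main labels of the machine. -/
abbrev MainLab : Type :=
  Base ⊕ (Σ last : Bool, {l : List (Token Δ) // l <:+ (E.tokens last).reverse})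

/-- The labels of the machine: the main labels, and those of the routine that writes the value of a
counter and returns to a main label. -/
abbrev Lab : Type := E.MainLab ⊕ (Bool × Ctr × E.MainLab)

/-- The gadget is fixed, so only the suffixes of two fixed token lists occur. -/
instance : Finite E.MainLab := by
  have : ∀ last, Finite {l : List (Token Δ) // l <:+ (E.tokens last).reverse} :=
    fun last => Set.Finite.subset (List.finite_toSet (E.tokens last).reverse.tails)
      fun l hl => (List.mem_tails l _).2 hl
  infer_instance

/-- The statements of the machine. Its internal state holds the symbol that was read last. -/
abbrev St (Γ : ConstraintLanguage) (E : RingElem Δ d) : Type :=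
  Stmt (StackSym (CSPSym Γ) (CSPSym Δ) (workSym (CSPSym Γ))) E.Lab (Option (CSPSym Γ ⊕ Bool))

variable {E}

/-- Forget the last symbol and go to a label. -/
def jump (l : E.Lab) : St Γ E := Stmt.load (fun _ => none) (Stmt.goto fun _ => l)

/-- Go to a basic label. -/
abbrev base (b : Base) : E.Lab := Sum.inl (Sum.inl b)

def popInput (q : St Γ E) : St Γ E :=
  Stmt.pop (Sum.inl Port.input) (fun _ (a : Option (CSPSym Γ)) => a.map Sum.inl) q

def popEps (q : St Γ E) : St Γ E :=
  Stmt.pop (Sum.inl Port.eps) (fun _ (a : Option Bool) => a.map Sum.inr) q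

def popAnswer (q : St Γ E) : St Γ E :=
  Stmt.pop (Sum.inl Port.answer) (fun _ (a : Option Bool) => a.map Sum.inr) q

def popRev (q : St Γ E) : St Γ E :=
  Stmt.pop (Sum.inr (Sum.inl true)) (fun _ (a : Option (CSPSym Γ)) => a.map Sum.inl) q

def popBits (q : St Γ E) : St Γ E :=
  Stmt.pop (Sum.inr (Sum.inl false)) (fun _ (a : Option Bool) => a.map Sum.inr) q

def popCtr (k : Ctr) (q : St Γ E) : St Γ E :=
  Stmt.pop (Sum.inr (Sum.inr k)) (fun _ (a : Option Bool) => a.map Sum.inr) q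

def pushCtr (k : Ctr) (q : St Γ E) : St Γ E := Stmt.push (Sum.inr (Sum.inr k)) (fun _ => true) q

def pushQuery (a : CSPSym Δ) (q : St Γ E) : St Γ E := Stmt.push (Sum.inl Port.query) (fun _ => a) q

def pushDelta (b : Bool) (q : St Γ E) : St Γ E := Stmt.push (Sum.inl Port.delta) (fun _ => b) q

def pushDigits : ℕ → St Γ E → St Γ E
  | 0, q => q
  | k + 1, q => pushQuery (Sum.inl true) (pushDigits k q)

/-- The symbol in the internal state, if it is a symbol of the input. -/
def symOf : Option (CSPSym Γ ⊕ Bool) → CSPSym Γ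
  | some (Sum.inl a) => a
  | _ => Sum.inl true

/-- The bit in the internal state, if it is a bit. -/
def bitOf : Option (CSPSym Γ ⊕ Bool) → Bool
  | some (Sum.inr b) => b
  | _ => true

def isDigit : Option (CSPSym Γ ⊕ Bool) → Bool
  | some (Sum.inl (Sum.inl true)) => true
  | _ => false

def isTerminator : Option (CSPSym Γ ⊕ Bool) → Bool
  | some (Sum.inl (Sum.inl false)) => true
  | _ => false

def liftSym (h : Γ ⊆ Δ) : CSPSym Γ → CSPSym Δ := Sum.map id fun R => ⟨R.1, h R.2⟩

variable (h : Γ ⊆ Δ)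

/-- The counter `nc` holds the rings still to be written, and `lc` the length `K`, which is moved to
`lt` while a ring is written and then restored. The global index of the current element is `q`, that
of the first element of its ring is `v`, and `j` counts the terminators already read backwards.
Since the query is a stack, it is produced from its end: rings, original constraints, number of
variables. After the call, `lc` is increased to `K + 2` and limits the number of answer bits that
are copied. -/
def baseProg : Base → Instr (StackSym (CSPSym Γ) (CSPSym Δ) (workSym (CSPSym Γ))) E.Lab
    (Option (CSPSym Γ ⊕ Bool))
  | Base.readNum => Instr.det <| popInput <| Stmt.branch isDigit
      (pushCtr Ctr.nc <| pushCtr Ctr.lc <| jump (base Base.readNum))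
      (pushDelta true <| jump (base Base.readBody))
  | Base.readBody => Instr.det <| popInput <| Stmt.branch Option.isSome
      (Stmt.push (Sum.inr (Sum.inl true)) (fun v => symOf v) <|
        pushCtr Ctr.lc <| jump (base Base.readBody))
      (jump (base Base.tol))
  | Base.tol => Instr.det <| popEps <| Stmt.branch bitOf (jump (base Base.outer))
      (pushDelta false <| jump (base Base.tol))
  | Base.outer => Instr.det <| popCtr Ctr.nc <| Stmt.branch Option.isSome
      (jump (base Base.inner)) (jump (base Base.stream))
  | Base.inner => Instr.det <| popCtr Ctr.lc <| Stmt.branch Option.isSome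
      (pushCtr Ctr.lt <| jump (Sum.inl (Sum.inr ⟨false, _, List.suffix_rfl⟩)))
      (jump (Sum.inl (Sum.inr ⟨true, _, List.suffix_rfl⟩)))
  | Base.restore => Instr.det <| popCtr Ctr.lt <| Stmt.branch Option.isSome
      (pushCtr Ctr.lc <| pushCtr Ctr.v <| jump (base Base.restore))
      (jump (base Base.outer))
  | Base.stream => Instr.det <| popRev <| Stmt.branch Option.isSome
      (Stmt.branch isDigit
        (pushDigits E.size <| jump (Sum.inr (true, Ctr.lc, Sum.inl Base.stream)))
        (Stmt.branch isTerminator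
          (pushQuery (Sum.inl false) <| pushDigits (E.code E.innerX) <|
            jump (Sum.inr (true, Ctr.j, Sum.inl Base.incJ)))
          (Stmt.push (Sum.inl Port.query) (fun v => liftSym h (symOf v)) <|
            jump (base Base.stream))))
      (pushQuery (Sum.inl false) <| jump (Sum.inr (true, Ctr.q, Sum.inl Base.ask)))
  | Base.incJ => Instr.det <| pushCtr Ctr.j <| jump (base Base.stream)
  | Base.ask => Instr.call (base Base.cap)
  | Base.cap => Instr.det <| pushCtr Ctr.lc <| pushCtr Ctr.lc <| jump (base Base.ans)
  | Base.ans => Instr.det <| popCtr Ctr.lc <| Stmt.branch Option.isSome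
      (popAnswer <| Stmt.branch Option.isSome
        (Stmt.push (Sum.inr (Sum.inl false)) (fun v => bitOf v) <| jump (base Base.ans))
        (jump (base Base.fin)))
      (jump (base Base.fin))
  | Base.fin => Instr.det <| popBits <| Stmt.branch Option.isSome
      (Stmt.push (Sum.inl Port.output) (fun v => bitOf v) <| jump (base Base.fin))
      Stmt.halt

/-- Write a ring element, token by token. -/
def tokenProg (last : Bool) : (l : List (Token Δ)) → l <:+ (E.tokens last).reverse → St Γ E
  | [], _ => pushCtr Ctr.q <| bif last then pushCtr Ctr.v <| jump (base Base.restore)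
      else jump (base Base.inner)
  | Sum.inl a :: l, hl => pushQuery a <|
      jump (Sum.inl (Sum.inr ⟨last, l, (List.suffix_cons _ l).trans hl⟩))
  | Sum.inr b :: l, hl => jump (Sum.inr (true, bif b then Ctr.q else Ctr.v,
      Sum.inr ⟨last, l, (List.suffix_cons _ l).trans hl⟩))

/-- In the copying routine, the flag `true` marks the phase that moves the counter to `tmp` and
writes `E.size` digits per unit, and `false` the phase that moves it back. -/
def prog : E.Lab → Instr (StackSym (CSPSym Γ) (CSPSym Δ) (workSym (CSPSym Γ))) E.Lab
    (Option (CSPSym Γ ⊕ Bool))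
  | Sum.inl (Sum.inl b) => baseProg h b
  | Sum.inl (Sum.inr ⟨last, l, hl⟩) => Instr.det (tokenProg last l hl)
  | Sum.inr (true, k, ret) => Instr.det <| popCtr k <| Stmt.branch Option.isSome
      (pushCtr Ctr.tmp <| pushDigits E.size <| jump (Sum.inr (true, k, ret)))
      (jump (Sum.inr (false, k, ret)))
  | Sum.inr (false, k, ret) => Instr.det <| popCtr Ctr.tmp <| Stmt.branch Option.isSome
      (pushCtr k <| jump (Sum.inr (false, k, ret)))
      (jump (Sum.inl ret))

variable (E)

/-- The machine that replaces each variable by a ring, calls the oracle, and returns its answer. -/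
def machine : OracleTM (CSPSym Γ) (CSPSym Δ) where
  W := Work
  C := workSym (CSPSym Γ)
  L := E.Lab
  S := Option (CSPSym Γ ⊕ Bool)
  main := base Base.readNum
  initial := none
  prog := prog h

/-- The configuration with a given label and memory. -/
def cfg (l : E.Lab) (s : Mem (CSPSym Γ) (CSPSym Δ)) : (E.machine h).Cfg := ⟨some l, none, s.stk⟩

variable {E h}

theorem run_of_stepAux {l l' : E.Lab} {s s' : Mem (CSPSym Γ) (CSPSym Δ)} {q : St Γ E}
    (hq : prog h l = Instr.det q)
    (hs : Turing.TM2.stepAux q none s.stk = ⟨some l', none, s'.stk⟩) :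
    (E.machine h).RunLe 1 (E.cfg h l s) (E.cfg h l' s') :=
  OracleTM.RunLe.of_step (M := E.machine h) hq hs

theorem stepAux_jump (l : E.Lab) (v) (s : Mem (CSPSym Γ) (CSPSym Δ)) :
    Turing.TM2.stepAux (jump l : St Γ E) v s.stk = ⟨some l, none, s.stk⟩ := rfl

theorem stepAux_pushCtr (k : Ctr) (q : St Γ E) (v) (s : Mem (CSPSym Γ) (CSPSym Δ)) :
    Turing.TM2.stepAux (pushCtr k q) v s.stk
      = Turing.TM2.stepAux q v { s with cnt := Function.update s.cnt k (s.cnt k + 1) }.stk :=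
  congrArg (Turing.TM2.stepAux q v) (s.update_cnt_push k)

theorem stepAux_pushQuery (a : CSPSym Δ) (q : St Γ E) (v) (s : Mem (CSPSym Γ) (CSPSym Δ)) :
    Turing.TM2.stepAux (pushQuery a q) v s.stk
      = Turing.TM2.stepAux q v { s with query := a :: s.query }.stk :=
  congrArg (Turing.TM2.stepAux q v) (s.update_query _)

theorem stepAux_pushDelta (b : Bool) (q : St Γ E) (v) (s : Mem (CSPSym Γ) (CSPSym Δ)) :
    Turing.TM2.stepAux (pushDelta b q) v s.stk
      = Turing.TM2.stepAux q v { s with delta := b :: s.delta }.stk :=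
  congrArg (Turing.TM2.stepAux q v) (s.update_delta _)

theorem stepAux_pushDigits (k : ℕ) (q : St Γ E) (v) (s : Mem (CSPSym Γ) (CSPSym Δ)) :
    Turing.TM2.stepAux (pushDigits k q) v s.stk
      = Turing.TM2.stepAux q v { s with query := digits Δ k ++ s.query }.stk := by
  induction k generalizing s with
  | zero => rfl
  | succ k ih =>
    rw [pushDigits, stepAux_pushQuery, ih]
    congr 3
    simp [digits, List.replicate_succ']

theorem stepAux_popCtr_zero {k : Ctr} (q : St Γ E) (v) {s : Mem (CSPSym Γ) (CSPSym Δ)}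
    (hk : s.cnt k = 0) :
    Turing.TM2.stepAux (popCtr k q) v s.stk = Turing.TM2.stepAux q none s.stk := by
  have h1 : Function.update s.cnt k (s.cnt k - 1) = s.cnt := by
    rw [hk, Nat.zero_sub, ← hk, Function.update_eq_self]
  have h2 := s.update_cnt_tail k
  rw [h1] at h2
  have h3 : ((List.replicate (s.cnt k) true).head?.map Sum.inr : Option (CSPSym Γ ⊕ Bool))
      = none := by rw [hk]; rfl
  exact congrArg₂ (Turing.TM2.stepAux q) h3 h2

theorem stepAux_popCtr_succ {k : Ctr} (q : St Γ E) (v) {s : Mem (CSPSym Γ) (CSPSym Δ)} {m : ℕ}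
    (hk : s.cnt k = m + 1) :
    Turing.TM2.stepAux (popCtr k q) v s.stk = Turing.TM2.stepAux q (some (Sum.inr true))
      { s with cnt := Function.update s.cnt k m }.stk := by
  have h2 := s.update_cnt_tail k
  rw [hk, Nat.add_sub_cancel] at h2
  have h3 : ((List.replicate (s.cnt k) true).head?.map Sum.inr : Option (CSPSym Γ ⊕ Bool))
      = some (Sum.inr true) := by rw [hk]; rfl
  exact congrArg₂ (Turing.TM2.stepAux q) h3 h2

end RingElem

end

/-! ### Single steps of the machine and the copying routine -/

section

/-- The values of the counters. -/
def counters (nc lc lt q v tmp j : ℕ) : Ctr → ℕ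
  | Ctr.nc => nc
  | Ctr.lc => lc
  | Ctr.lt => lt
  | Ctr.q => q
  | Ctr.v => v
  | Ctr.tmp => tmp
  | Ctr.j => j

section Counters

variable (nc lc lt q v tmp j m : ℕ)

theorem update_counters_nc : Function.update (counters nc lc lt q v tmp j) Ctr.nc m
    = counters m lc lt q v tmp j := by funext k; cases k <;> rfl

theorem update_counters_lc : Function.update (counters nc lc lt q v tmp j) Ctr.lc m
    = counters nc m lt q v tmp j := by funext k; cases k <;> rfl

theorem update_counters_lt : Function.update (counters nc lc lt q v tmp j) Ctr.lt m
    = counters nc lc m q v tmp j := by funext k; cases k <;> rfl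

theorem update_counters_q : Function.update (counters nc lc lt q v tmp j) Ctr.q m
    = counters nc lc lt m v tmp j := by funext k; cases k <;> rfl

theorem update_counters_v : Function.update (counters nc lc lt q v tmp j) Ctr.v m
    = counters nc lc lt q m tmp j := by funext k; cases k <;> rfl

theorem update_counters_j : Function.update (counters nc lc lt q v tmp j) Ctr.j m
    = counters nc lc lt q v tmp m := by funext k; cases k <;> rfl

end Counters

namespace RingElem

open Turing.TM2 (Stmt stepAux)

variable {Γ Δ : ConstraintLanguage} {d : ℕ} {E : RingElem Δ d} {h : Γ ⊆ Δ}

theorem stepAux_popInput (q : St Γ E) (v) (s : Mem (CSPSym Γ) (CSPSym Δ)) :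
    stepAux (popInput q) v s.stk
      = stepAux q (s.input.head?.map Sum.inl) { s with input := s.input.tail }.stk :=
  congrArg (stepAux q _) (s.update_input _)

theorem stepAux_popEps (q : St Γ E) (v) (s : Mem (CSPSym Γ) (CSPSym Δ)) :
    stepAux (popEps q) v s.stk
      = stepAux q (s.eps.head?.map Sum.inr) { s with eps := s.eps.tail }.stk :=
  congrArg (stepAux q _) (s.update_eps _)

theorem stepAux_popAnswer (q : St Γ E) (v) (s : Mem (CSPSym Γ) (CSPSym Δ)) :
    stepAux (popAnswer q) v s.stk
      = stepAux q (s.answer.head?.map Sum.inr) { s with answer := s.answer.tail }.stk :=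
  congrArg (stepAux q _) (s.update_answer _)

theorem stepAux_popRev (q : St Γ E) (v) (s : Mem (CSPSym Γ) (CSPSym Δ)) :
    stepAux (popRev q) v s.stk
      = stepAux q (s.rev.head?.map Sum.inl) { s with rev := s.rev.tail }.stk :=
  congrArg (stepAux q _) (s.update_rev _)

theorem stepAux_popBits (q : St Γ E) (v) (s : Mem (CSPSym Γ) (CSPSym Δ)) :
    stepAux (popBits q) v s.stk
      = stepAux q (s.bits.head?.map Sum.inr) { s with bits := s.bits.tail }.stk :=
  congrArg (stepAux q _) (s.update_bits _)

theorem stepAux_pushRev (f : Option (CSPSym Γ ⊕ Bool) → CSPSym Γ) (q : St Γ E) (v)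
    (s : Mem (CSPSym Γ) (CSPSym Δ)) :
    stepAux (Stmt.push (Sum.inr (Sum.inl true)) f q) v s.stk
      = stepAux q v { s with rev := f v :: s.rev }.stk :=
  congrArg (stepAux q _) (s.update_rev _)

theorem stepAux_pushBits (f : Option (CSPSym Γ ⊕ Bool) → Bool) (q : St Γ E) (v)
    (s : Mem (CSPSym Γ) (CSPSym Δ)) :
    stepAux (Stmt.push (Sum.inr (Sum.inl false)) f q) v s.stk
      = stepAux q v { s with bits := f v :: s.bits }.stk :=
  congrArg (stepAux q _) (s.update_bits _)

theorem stepAux_pushOutput (f : Option (CSPSym Γ ⊕ Bool) → Bool) (q : St Γ E) (v)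
    (s : Mem (CSPSym Γ) (CSPSym Δ)) :
    stepAux (Stmt.push (Sum.inl Port.output) f q) v s.stk
      = stepAux q v { s with output := f v :: s.output }.stk :=
  congrArg (stepAux q _) (s.update_output _)

theorem stepAux_pushSym (f : Option (CSPSym Γ ⊕ Bool) → CSPSym Δ) (q : St Γ E) (v)
    (s : Mem (CSPSym Γ) (CSPSym Δ)) :
    stepAux (Stmt.push (Sum.inl Port.query) f q) v s.stk
      = stepAux q v { s with query := f v :: s.query }.stk :=
  congrArg (stepAux q _) (s.update_query _)

theorem stepAux_branch_true {f : Option (CSPSym Γ ⊕ Bool) → Bool} (q₁ q₂ : St Γ E) {v}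
    (hv : f v = true) (s : Mem (CSPSym Γ) (CSPSym Δ)) :
    stepAux (Stmt.branch f q₁ q₂) v s.stk = stepAux q₁ v s.stk := by
  simp [stepAux, hv]

theorem stepAux_branch_false {f : Option (CSPSym Γ ⊕ Bool) → Bool} (q₁ q₂ : St Γ E) {v}
    (hv : f v = false) (s : Mem (CSPSym Γ) (CSPSym Δ)) :
    stepAux (Stmt.branch f q₁ q₂) v s.stk = stepAux q₂ v s.stk := by
  simp [stepAux, hv]

/-! #### Writing the value of a counter -/

theorem run_copyOut {k : Ctr} (hk : k ≠ Ctr.tmp) (ret : E.MainLab)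
    (s : Mem (CSPSym Γ) (CSPSym Δ)) (m b : ℕ) (w : List (CSPSym Δ)) :
    (E.machine h).RunLe (m + 1)
      (E.cfg h (Sum.inr (true, k, ret))
        { s with query := w, cnt := Function.update (Function.update s.cnt k m) Ctr.tmp b })
      (E.cfg h (Sum.inr (false, k, ret))
        { s with
          query := digits Δ (E.size * m) ++ w
          cnt := Function.update (Function.update s.cnt k 0) Ctr.tmp (b + m) }) := by
  induction m generalizing b w with
  | zero =>
    refine run_of_stepAux rfl ?_
    rw [stepAux_popCtr_zero _ _ (by simp [hk]), stepAux_branch_false _ _ rfl, stepAux_jump]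
    simp
  | succ m ih =>
    have h1 := ih (b + 1) (digits Δ E.size ++ w)
    rw [← List.append_assoc, ← digits_add, ← Nat.mul_succ, Nat.add_right_comm b 1 m] at h1
    rw [Nat.add_comm (m + 1) 1]
    refine OracleTM.RunLe.trans (run_of_stepAux rfl ?_) h1
    rw [stepAux_popCtr_succ _ _ (m := m) (by simp [hk]), stepAux_branch_true _ _ rfl,
      stepAux_pushCtr, stepAux_pushDigits, stepAux_jump]
    congr 3
    funext c
    by_cases h1 : c = Ctr.tmp
    · subst h1; simp [hk.symm]
    · by_cases h2 : c = k <;> simp [h1, h2]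
      simp [hk]

theorem run_copyBack {k : Ctr} (hk : k ≠ Ctr.tmp) (ret : E.MainLab)
    (s : Mem (CSPSym Γ) (CSPSym Δ)) (m b : ℕ) :
    (E.machine h).RunLe (b + 1)
      (E.cfg h (Sum.inr (false, k, ret))
        { s with cnt := Function.update (Function.update s.cnt k m) Ctr.tmp b })
      (E.cfg h (Sum.inl ret)
        { s with cnt := Function.update (Function.update s.cnt k (m + b)) Ctr.tmp 0 }) := by
  induction b generalizing m with
  | zero =>
    refine run_of_stepAux rfl ?_
    rw [stepAux_popCtr_zero _ _ (by simp), stepAux_branch_false _ _ rfl, stepAux_jump]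
    simp
  | succ b ih =>
    have h1 := ih (m + 1)
    rw [Nat.add_right_comm m 1 b] at h1
    rw [Nat.add_comm (b + 1) 1]
    refine OracleTM.RunLe.trans (run_of_stepAux rfl ?_) h1
    rw [stepAux_popCtr_succ _ _ (m := b) (by simp), stepAux_branch_true _ _ rfl,
      stepAux_pushCtr, stepAux_jump]
    congr 3
    funext c
    by_cases h1 : c = Ctr.tmp
    · subst h1; simp [hk.symm]
    · by_cases h2 : c = k <;> simp [h1, h2]
      simp [hk]

/-- The two phases together leave all counters unchanged. The uniform bound `X` makes the costs of
all calls of the routine comparable. -/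
theorem run_copy {k : Ctr} (hk : k ≠ Ctr.tmp) (ret : E.MainLab)
    {s : Mem (CSPSym Γ) (CSPSym Δ)} (hs : s.cnt Ctr.tmp = 0) {X : ℕ} (hX : s.cnt k ≤ X) :
    (E.machine h).RunLe (2 * X + 2) (E.cfg h (Sum.inr (true, k, ret)) s)
      (E.cfg h (Sum.inl ret) { s with query := digits Δ (E.size * s.cnt k) ++ s.query }) := by
  have h1 := run_copyOut (h := h) hk ret s (s.cnt k) 0 s.query
  have h2 := run_copyBack (h := h) hk ret
    { s with query := digits Δ (E.size * s.cnt k) ++ s.query } 0 (0 + s.cnt k)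
  have h3 : Function.update (Function.update s.cnt k (s.cnt k)) Ctr.tmp 0 = s.cnt := by
    rw [Function.update_eq_self, ← hs, Function.update_eq_self]
  have h4 := h1.trans h2
  simp only [Nat.zero_add, h3] at h4
  exact h4.mono (by omega)

/-! #### Writing the rings -/

theorem run_tokens {last : Bool} {X : ℕ} (l : List (Token Δ)) (hl : l <:+ (E.tokens last).reverse)
    (s : Mem (CSPSym Γ) (CSPSym Δ)) (hs : s.cnt Ctr.tmp = 0) (hq : s.cnt Ctr.q ≤ X)
    (hv : s.cnt Ctr.v ≤ X) :
    (E.machine h).RunLe (l.length * (2 * X + 3))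
      (E.cfg h (Sum.inl (Sum.inr ⟨last, l, hl⟩)) s)
      (E.cfg h (Sum.inl (Sum.inr ⟨last, [], List.nil_suffix⟩))
        { s with query := l.reverse.flatMap (E.interp (s.cnt Ctr.q) (s.cnt Ctr.v)) ++ s.query }) := by
  induction l generalizing s with
  | nil => exact OracleTM.RunLe.refl _ _
  | cons a l ih =>
    rw [List.length_cons, Nat.succ_mul, Nat.add_comm _ (2 * X + 3)]
    have hl' : l <:+ (E.tokens last).reverse := (List.suffix_cons _ l).trans hl
    have key : (E.machine h).RunLe (2 * X + 3) (E.cfg h (Sum.inl (Sum.inr ⟨last, a :: l, hl⟩)) s)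
        (E.cfg h (Sum.inl (Sum.inr ⟨last, l, hl'⟩))
          { s with query := E.interp (s.cnt Ctr.q) (s.cnt Ctr.v) a ++ s.query }) := by
      rcases a with a | _ | _
      · refine OracleTM.RunLe.mono (m := 1) (run_of_stepAux rfl ?_) (by omega)
        rw [tokenProg, stepAux_pushQuery, stepAux_jump]
        rfl
      · exact (run_of_stepAux rfl rfl).trans
          (run_copy (k := Ctr.v) (by simp) _ hs hv) |>.mono (by omega)
      · exact (run_of_stepAux rfl rfl).trans
          (run_copy (k := Ctr.q) (by simp) _ hs hq) |>.mono (by omega)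
    refine key.trans ?_
    have := ih hl' { s with query := E.interp (s.cnt Ctr.q) (s.cnt Ctr.v) a ++ s.query } hs hq hv
    simpa [List.flatMap_append] using this

end RingElem

end

/-! ### Runs of the phases of the machine -/

section

namespace RingElem

open Turing.TM2 (Stmt stepAux)

variable {Γ Δ : ConstraintLanguage} {d : ℕ} {E : RingElem Δ d} {h : Γ ⊆ Δ}

/-- The label at which a ring element is written. -/
abbrev elemLab (E : RingElem Δ d) (last : Bool) : E.Lab :=
  Sum.inl (Sum.inr ⟨last, _, List.suffix_rfl⟩)

variable (E) in
/-- A bound for the number of tokens. -/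
def tokenBound : ℕ := (E.tokens false).length + (E.tokens true).length

theorem run_elem (last : Bool) {X : ℕ} (s : Mem (CSPSym Γ) (CSPSym Δ))
    (hs : s.cnt Ctr.tmp = 0) (hq : s.cnt Ctr.q ≤ X) (hv : s.cnt Ctr.v ≤ X) :
    (E.machine h).RunLe (E.tokenBound * (2 * X + 3)) (E.cfg h (E.elemLab last) s)
      (E.cfg h (Sum.inl (Sum.inr ⟨last, [], List.nil_suffix⟩))
        { s with query := E.elemWord (s.cnt Ctr.q) (s.cnt Ctr.v) last ++ s.query }) := by
  have := run_tokens (h := h) _ (List.suffix_rfl (l := (E.tokens last).reverse)) s hs hq hv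
  rw [List.reverse_reverse] at this
  refine this.mono (Nat.mul_le_mul_right _ ?_)
  cases last <;> simp [tokenBound]

/-- Throughout the loop `q = v + lt`. It writes one element per unit of `lc`, none of them the last;
the last one is written when `lc` is exhausted, which gives `K + 1` elements in total. -/
theorem run_inner {X : ℕ} (s : Mem (CSPSym Γ) (CSPSym Δ)) (w : List (CSPSym Δ))
    (nc lt v j m : ℕ) (hX : v + (lt + m) ≤ X) :
    (E.machine h).RunLe (m * (E.tokenBound * (2 * X + 3) + 2) + 1)
      (E.cfg h (base Base.inner)
        { s with query := E.chainWord v lt ++ w, cnt := counters nc m lt (v + lt) v 0 j })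
      (E.cfg h (E.elemLab true)
        { s with
          query := E.chainWord v (lt + m) ++ w
          cnt := counters nc 0 (lt + m) (v + (lt + m)) v 0 j }) := by
  induction m generalizing lt with
  | zero =>
    rw [Nat.zero_mul, Nat.zero_add]
    refine run_of_stepAux rfl ?_
    rw [stepAux_popCtr_zero _ _ rfl, stepAux_branch_false _ _ rfl, stepAux_jump]
    rfl
  | succ m ih =>
    have h1 : (E.machine h).RunLe 1
        (E.cfg h (base Base.inner)
          { s with query := E.chainWord v lt ++ w, cnt := counters nc (m + 1) lt (v + lt) v 0 j })
        (E.cfg h (E.elemLab false)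
          { s with
            query := E.chainWord v lt ++ w
            cnt := counters nc m (lt + 1) (v + lt) v 0 j }) := by
      refine run_of_stepAux rfl ?_
      rw [stepAux_popCtr_succ _ _ (m := m) rfl, stepAux_branch_true _ _ rfl, stepAux_pushCtr,
        stepAux_jump]
      simp only [update_counters_lc, update_counters_lt]
      rfl
    have h2 := run_elem (h := h) (E := E) false (X := X)
      { s with
        query := E.chainWord v lt ++ w
        cnt := counters nc m (lt + 1) (v + lt) v 0 j } rfl (show v + lt ≤ X by omega)
        (show v ≤ X by omega)
    have h3 : (E.machine h).RunLe 1
        (E.cfg h (Sum.inl (Sum.inr ⟨false, [], List.nil_suffix⟩))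
          { s with
            query := E.elemWord (v + lt) v false ++ (E.chainWord v lt ++ w)
            cnt := counters nc m (lt + 1) (v + lt) v 0 j })
        (E.cfg h (base Base.inner)
          { s with
            query := E.chainWord v (lt + 1) ++ w
            cnt := counters nc m (lt + 1) (v + (lt + 1)) v 0 j }) := by
      refine run_of_stepAux rfl ?_
      rw [tokenProg, stepAux_pushCtr, cond_false, stepAux_jump]
      simp only [update_counters_q, chainWord, List.append_assoc]
      rfl
    have h4 := ih (lt + 1) (by omega)
    rw [Nat.add_assoc lt 1 m, Nat.add_comm 1 m] at h4
    refine (((h1.trans h2).trans h3).trans h4).mono ?_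
    rw [Nat.succ_mul m]
    omega

/-- Besides restoring the length, this advances `v` to the next ring; together with the unit added
after the last element, `v` grows by `K + 1`. -/
theorem run_restore (s : Mem (CSPSym Γ) (CSPSym Δ)) (nc lc m q v j : ℕ) :
    (E.machine h).RunLe (m + 1)
      (E.cfg h (base Base.restore) { s with cnt := counters nc lc m q v 0 j })
      (E.cfg h (base Base.outer) { s with cnt := counters nc (lc + m) 0 q (v + m) 0 j }) := by
  induction m generalizing lc v with
  | zero =>
    refine run_of_stepAux rfl ?_
    rw [stepAux_popCtr_zero _ _ rfl, stepAux_branch_false _ _ rfl, stepAux_jump]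
    rfl
  | succ m ih =>
    have h1 := ih (lc + 1) (v + 1)
    rw [Nat.add_right_comm lc, Nat.add_right_comm v] at h1
    rw [Nat.add_comm (m + 1) 1]
    refine OracleTM.RunLe.trans (run_of_stepAux rfl ?_) h1
    rw [stepAux_popCtr_succ _ _ (m := m) rfl, stepAux_branch_true _ _ rfl, stepAux_pushCtr,
      stepAux_pushCtr, stepAux_jump]
    simp only [update_counters_lc, update_counters_lt, update_counters_v]
    rfl

theorem run_outer {X K : ℕ} (s : Mem (CSPSym Γ) (CSPSym Δ)) (w : List (CSPSym Δ))
    (m i : ℕ) (hX : (i + m) * (K + 1) ≤ X) :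
    (E.machine h).RunLe (m * ((K + 1) * (E.tokenBound * (2 * X + 3) + 5)) + 1)
      (E.cfg h (base Base.outer)
        { s with
          query := E.ringWord K i ++ w
          cnt := counters m K 0 (i * (K + 1)) (i * (K + 1)) 0 0 })
      (E.cfg h (base Base.stream)
        { s with
          query := E.ringWord K (i + m) ++ w
          cnt := counters 0 K 0 ((i + m) * (K + 1)) ((i + m) * (K + 1)) 0 0 }) := by
  induction m generalizing i with
  | zero =>
    rw [Nat.zero_mul, Nat.zero_add]
    refine run_of_stepAux rfl ?_
    rw [stepAux_popCtr_zero _ _ rfl, stepAux_branch_false _ _ rfl, stepAux_jump]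
    rfl
  | succ m ih =>
    have hX' : i * (K + 1) + (K + 1) ≤ X := by
      refine le_trans ?_ hX
      rw [← Nat.succ_mul]
      exact Nat.mul_le_mul_right _ (by omega)
    have h1 : (E.machine h).RunLe 1
        (E.cfg h (base Base.outer)
          { s with
            query := E.ringWord K i ++ w
            cnt := counters (m + 1) K 0 (i * (K + 1)) (i * (K + 1)) 0 0 })
        (E.cfg h (base Base.inner)
          { s with
            query := E.ringWord K i ++ w
            cnt := counters m K 0 (i * (K + 1)) (i * (K + 1)) 0 0 }) := by
      refine run_of_stepAux rfl ?_
      rw [stepAux_popCtr_succ _ _ (m := m) rfl, stepAux_branch_true _ _ rfl, stepAux_jump]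
      simp only [update_counters_nc]
    have h2 := run_inner (h := h) (E := E) (X := X) s (E.ringWord K i ++ w) m 0 (i * (K + 1)) 0 K
      (by omega)
    simp only [Nat.zero_add, Nat.add_zero, chainWord, List.nil_append] at h2
    have h3 := run_elem (h := h) (E := E) true (X := X)
      { s with
        query := E.chainWord (i * (K + 1)) K ++ (E.ringWord K i ++ w)
        cnt := counters m 0 K (i * (K + 1) + K) (i * (K + 1)) 0 0 } rfl
        (show i * (K + 1) + K ≤ X by omega) (show i * (K + 1) ≤ X by omega)
    have h4 : (E.machine h).RunLe 1
        (E.cfg h (Sum.inl (Sum.inr ⟨true, [], List.nil_suffix⟩))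
          { s with
            query := E.elemWord (i * (K + 1) + K) (i * (K + 1)) true ++
              (E.chainWord (i * (K + 1)) K ++ (E.ringWord K i ++ w))
            cnt := counters m 0 K (i * (K + 1) + K) (i * (K + 1)) 0 0 })
        (E.cfg h (base Base.restore)
          { s with
            query := E.ringWord K (i + 1) ++ w
            cnt := counters m 0 K (i * (K + 1) + K + 1) (i * (K + 1) + 1) 0 0 }) := by
      refine run_of_stepAux rfl ?_
      rw [tokenProg, stepAux_pushCtr, cond_true, stepAux_pushCtr, stepAux_jump]
      simp only [update_counters_q, update_counters_v, ringWord, List.append_assoc]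
      rfl
    have h5 := run_restore (h := h) (E := E) { s with query := E.ringWord K (i + 1) ++ w }
      m 0 K (i * (K + 1) + K + 1) (i * (K + 1) + 1) 0
    have e1 : i * (K + 1) + K + 1 = (i + 1) * (K + 1) := by ring
    have e2 : i * (K + 1) + 1 + K = (i + 1) * (K + 1) := by ring
    rw [e2, Nat.zero_add] at h5
    rw [e1] at h4 h5
    have h6 := ih (i + 1) (by rwa [Nat.add_right_comm, Nat.add_assoc])
    rw [Nat.add_right_comm i 1 m, Nat.add_assoc i m 1] at h6
    refine (((((h1.trans h2).trans h3).trans h4).trans h5).trans h6).mono ?_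
    rw [Nat.succ_mul m]
    generalize E.tokenBound * (2 * X + 3) = t
    have : (K + 1) * (t + 5) = K * (t + 2) + 3 * K + t + 5 := by ring
    rw [this]
    omega

/-! #### Writing the original constraints -/

/-- The invariant is that the suffix `u` already read has been translated and `j` counts its
terminators. A digit becomes `E.size * (K + 1)` digits, `E.size` of them written directly and the
others by copying `lc = K`. -/
theorem run_stream {X K : ℕ} (s : Mem (CSPSym Γ) (CSPSym Δ)) (w : List (CSPSym Δ)) (q v : ℕ)
    (r u : List (CSPSym Γ)) (hK : K ≤ X) (hu : r.length + u.length ≤ X) (hq : q ≤ X) :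
    (E.machine h).RunLe (r.length * (2 * X + 4) + (2 * X + 3))
      (E.cfg h (base Base.stream)
        { s with
          rev := r
          query := E.useWord h K u ++ w
          cnt := counters 0 K 0 q v 0 (terminators u) })
      (E.cfg h (base Base.ask)
        { s with
          rev := []
          query := digits Δ (E.size * q) ++
            Sum.inl false :: (E.useWord h K (r.reverse ++ u) ++ w)
          cnt := counters 0 K 0 q v 0 (terminators (r.reverse ++ u)) }) := by
  induction r generalizing u with
  | nil =>
    have h1 : (E.machine h).RunLe 1
        (E.cfg h (base Base.stream)
          { s with
            rev := []
            query := E.useWord h K u ++ w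
            cnt := counters 0 K 0 q v 0 (terminators u) })
        (E.cfg h (Sum.inr (true, Ctr.q, Sum.inl Base.ask))
          { s with
            rev := []
            query := Sum.inl false :: (E.useWord h K u ++ w)
            cnt := counters 0 K 0 q v 0 (terminators u) }) := by
      refine run_of_stepAux rfl ?_
      rw [stepAux_popRev, stepAux_branch_false _ _ rfl, stepAux_pushQuery, stepAux_jump]
      rfl
    have h2 := run_copy (E := E) (h := h) (k := Ctr.q) (by simp) (Sum.inl Base.ask)
      (s := { s with
            rev := []
            query := Sum.inl false :: (E.useWord h K u ++ w)
            cnt := counters 0 K 0 q v 0 (terminators u) }) rfl (X := X) hq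
    exact (h1.trans h2).mono (by simp; omega)
  | cons a r ih =>
    have hlen : r.length + (a :: u).length ≤ X := by
      simp only [List.length_cons] at hu ⊢
      omega
    have hterm : terminators u ≤ X := (terminators_le_length u).trans (by omega)
    have key : (E.machine h).RunLe (2 * X + 4)
        (E.cfg h (base Base.stream)
          { s with
            rev := a :: r
            query := E.useWord h K u ++ w
            cnt := counters 0 K 0 q v 0 (terminators u) })
        (E.cfg h (base Base.stream)
          { s with
            rev := r
            query := E.useWord h K (a :: u) ++ w
            cnt := counters 0 K 0 q v 0 (terminators (a :: u)) }) := by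
      rcases a with (_ | _) | R
      · have h1 : (E.machine h).RunLe 1
            (E.cfg h (base Base.stream)
              { s with
                rev := Sum.inl false :: r
                query := E.useWord h K u ++ w
                cnt := counters 0 K 0 q v 0 (terminators u) })
            (E.cfg h (Sum.inr (true, Ctr.j, Sum.inl Base.incJ))
              { s with
                rev := r
                query := digits Δ (E.code E.innerX) ++ Sum.inl false :: (E.useWord h K u ++ w)
                cnt := counters 0 K 0 q v 0 (terminators u) }) := by
          refine run_of_stepAux rfl ?_
          rw [stepAux_popRev, stepAux_branch_true _ _ rfl, stepAux_branch_false _ _ rfl,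
            stepAux_branch_true _ _ rfl, stepAux_pushQuery, stepAux_pushDigits, stepAux_jump]
          rfl
        have h2 := run_copy (E := E) (h := h) (k := Ctr.j) (by simp) (Sum.inl Base.incJ)
          (s := { s with
                rev := r
                query := digits Δ (E.code E.innerX) ++ Sum.inl false :: (E.useWord h K u ++ w)
                cnt := counters 0 K 0 q v 0 (terminators u) }) rfl (X := X) hterm
        have h3 : (E.machine h).RunLe 1
            (E.cfg h (base Base.incJ)
              { s with
                rev := r
                query := digits Δ (E.size * terminators u) ++
                  (digits Δ (E.code E.innerX) ++ Sum.inl false :: (E.useWord h K u ++ w))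
                cnt := counters 0 K 0 q v 0 (terminators u) })
            (E.cfg h (base Base.stream)
              { s with
                rev := r
                query := E.useWord h K (Sum.inl false :: u) ++ w
                cnt := counters 0 K 0 q v 0 (terminators (Sum.inl false :: u)) }) := by
          refine run_of_stepAux rfl ?_
          rw [stepAux_pushCtr, stepAux_jump]
          simp only [update_counters_j, useWord, terminators, List.append_assoc, List.cons_append]
          rfl
        exact ((h1.trans h2).trans h3).mono (by omega)
      · have h1 : (E.machine h).RunLe 1
            (E.cfg h (base Base.stream)
              { s with
                rev := Sum.inl true :: r
                query := E.useWord h K u ++ w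
                cnt := counters 0 K 0 q v 0 (terminators u) })
            (E.cfg h (Sum.inr (true, Ctr.lc, Sum.inl Base.stream))
              { s with
                rev := r
                query := digits Δ E.size ++ (E.useWord h K u ++ w)
                cnt := counters 0 K 0 q v 0 (terminators u) }) := by
          refine run_of_stepAux rfl ?_
          rw [stepAux_popRev, stepAux_branch_true _ _ rfl, stepAux_branch_true _ _ rfl,
            stepAux_pushDigits, stepAux_jump]
          rfl
        have h2 := run_copy (E := E) (h := h) (k := Ctr.lc) (by simp) (Sum.inl Base.stream)
          (s := { s with
                rev := r
                query := digits Δ E.size ++ (E.useWord h K u ++ w)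
                cnt := counters 0 K 0 q v 0 (terminators u) }) rfl (X := X) hK
        have e : digits Δ (E.size * K) ++ (digits Δ E.size ++ (E.useWord h K u ++ w))
            = E.useWord h K (Sum.inl true :: u) ++ w := by
          rw [useWord, Nat.mul_succ, digits_add, List.append_assoc, List.append_assoc]
        have h3 := h1.trans h2
        simp only [counters, e] at h3
        exact h3.mono (by omega)
      · refine OracleTM.RunLe.mono (m := 1) (run_of_stepAux rfl ?_) (by omega)
        rw [stepAux_popRev, stepAux_branch_true _ _ rfl, stepAux_branch_false _ _ rfl,
          stepAux_branch_false _ _ rfl, stepAux_pushSym, stepAux_jump]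
        rfl
    have h2 := ih (a :: u) hlen
    rw [List.reverse_cons, List.append_assoc, List.singleton_append]
    refine (key.trans h2).mono ?_
    rw [List.length_cons, Nat.succ_mul r.length]
    omega

/-! #### Reading the input -/

theorem run_readNum (s : Mem (CSPSym Γ) (CSPSym Δ)) (n a : ℕ) (u : List (CSPSym Γ)) :
    (E.machine h).RunLe (n + 1)
      (E.cfg h (base Base.readNum)
        { s with input := unary Γ n ++ u, delta := [], cnt := counters a a 0 0 0 0 0 })
      (E.cfg h (base Base.readBody)
        { s with input := u, delta := [true], cnt := counters (a + n) (a + n) 0 0 0 0 0 }) := by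
  induction n generalizing a with
  | zero =>
    refine run_of_stepAux rfl ?_
    rw [stepAux_popInput, stepAux_branch_false _ _ rfl, stepAux_pushDelta, stepAux_jump]
    rfl
  | succ n ih =>
    have h1 := ih (a + 1)
    rw [Nat.add_right_comm a] at h1
    rw [Nat.add_comm (n + 1) 1]
    refine OracleTM.RunLe.trans (run_of_stepAux rfl ?_) h1
    rw [stepAux_popInput, stepAux_branch_true _ _ rfl, stepAux_pushCtr, stepAux_pushCtr,
      stepAux_jump]
    simp only [update_counters_lc, update_counters_nc]
    rfl

theorem run_readBody (s : Mem (CSPSym Γ) (CSPSym Δ)) (n a : ℕ) (u r : List (CSPSym Γ)) :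
    (E.machine h).RunLe (u.length + 1)
      (E.cfg h (base Base.readBody)
        { s with input := u, rev := r, cnt := counters n a 0 0 0 0 0 })
      (E.cfg h (base Base.tol)
        { s with
          input := []
          rev := u.reverse ++ r
          cnt := counters n (a + u.length) 0 0 0 0 0 }) := by
  induction u generalizing a r with
  | nil =>
    refine run_of_stepAux rfl ?_
    rw [stepAux_popInput, stepAux_branch_false _ _ rfl, stepAux_jump]
    rfl
  | cons b u ih =>
    have h1 := ih (a + 1) (b :: r)
    rw [Nat.add_right_comm a, ← List.singleton_append, ← List.append_assoc,
      ← List.reverse_cons] at h1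
    rw [List.length_cons, Nat.add_comm (u.length + 1) 1]
    refine OracleTM.RunLe.trans (run_of_stepAux rfl ?_) h1
    rw [stepAux_popInput, stepAux_branch_true _ _ rfl, stepAux_pushRev, stepAux_pushCtr,
      stepAux_jump]
    simp only [update_counters_lc]
    rfl

/-- Only the zeros before the first 1 are used. In front of the 1 already on the stack they give the
leading power of two of the tolerance, and the rest `e` is ignored. -/
theorem run_tol (s : Mem (CSPSym Γ) (CSPSym Δ)) (p : ℕ) (e D : List Bool) :
    (E.machine h).RunLe (p + 1)
      (E.cfg h (base Base.tol)
        { s with eps := List.replicate p false ++ true :: e, delta := D })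
      (E.cfg h (base Base.outer)
        { s with eps := e, delta := List.replicate p false ++ D }) := by
  induction p generalizing D with
  | zero =>
    refine run_of_stepAux rfl ?_
    rw [stepAux_popEps, stepAux_branch_true _ _ rfl, stepAux_jump]
    rfl
  | succ p ih =>
    have h1 := ih (false :: D)
    have e : List.replicate p false ++ false :: D = List.replicate (p + 1) false ++ D := by
      rw [List.replicate_succ', List.append_assoc, List.singleton_append]
    rw [e] at h1
    rw [Nat.add_comm (p + 1) 1]
    refine OracleTM.RunLe.trans (run_of_stepAux rfl ?_) h1
    rw [stepAux_popEps, stepAux_branch_false _ _ rfl, stepAux_pushDelta, stepAux_jump]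
    rfl

/-! #### Returning the answer -/

/-- The loop is limited by a counter, so it ends within a time that does not depend on the length of
the answer. -/
theorem run_ans (s : Mem (CSPSym Γ) (CSPSym Δ)) (m q v j : ℕ) (a b : List Bool) :
    ∃ s' : Mem (CSPSym Γ) (CSPSym Δ), s'.output = s.output ∧ s'.bits = (a.take m).reverse ++ b ∧
      (E.machine h).RunLe (m + 1)
        (E.cfg h (base Base.ans)
          { s with answer := a, bits := b, cnt := counters 0 m 0 q v 0 j })
        (E.cfg h (base Base.fin) s') := by
  induction m generalizing a b with
  | zero =>
    refine ⟨{ s with answer := a, bits := b, cnt := counters 0 0 0 q v 0 j }, rfl, by simp,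
      run_of_stepAux rfl ?_⟩
    rw [stepAux_popCtr_zero _ _ rfl, stepAux_branch_false _ _ rfl, stepAux_jump]
  | succ m ih =>
    rcases a with _ | ⟨c, a⟩
    · refine ⟨{ s with answer := [], bits := b, cnt := counters 0 m 0 q v 0 j }, rfl, by simp,
        OracleTM.RunLe.mono (m := 1) (run_of_stepAux rfl ?_) (by omega)⟩
      rw [stepAux_popCtr_succ _ _ (m := m) rfl, stepAux_branch_true _ _ rfl, stepAux_popAnswer,
        stepAux_branch_false _ _ rfl, stepAux_jump]
      simp only [update_counters_lc]
      rfl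
    · obtain ⟨s', h1, h2, h3⟩ := ih a (c :: b)
      refine ⟨s', h1, by simpa using h2, ?_⟩
      rw [Nat.add_comm (m + 1) 1]
      refine OracleTM.RunLe.trans (run_of_stepAux rfl ?_) h3
      rw [stepAux_popCtr_succ _ _ (m := m) rfl, stepAux_branch_true _ _ rfl, stepAux_popAnswer,
        stepAux_branch_true _ _ rfl, stepAux_pushBits, stepAux_jump]
      simp only [update_counters_lc]
      rfl

theorem run_fin (s : Mem (CSPSym Γ) (CSPSym Δ)) (b o : List Bool) :
    (E.machine h).RunLe (b.length + 1)
      (E.cfg h (base Base.fin) { s with bits := b, output := o })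
      (⟨none, none, { s with bits := [], output := b.reverse ++ o }.stk⟩) := by
  induction b generalizing o with
  | nil =>
    refine OracleTM.RunLe.of_step (M := E.machine h)
      (q := popBits <| Stmt.branch Option.isSome
        (Stmt.push (Sum.inl Port.output) (fun v => bitOf v) <| jump (base Base.fin))
        Stmt.halt) rfl ?_
    refine (stepAux_popBits _ _ _).trans ?_
    exact stepAux_branch_false _ _ rfl _
  | cons c b ih =>
    have h1 := ih (c :: o)
    rw [← List.singleton_append, ← List.append_assoc, ← List.reverse_cons] at h1
    rw [List.length_cons, Nat.add_comm (b.length + 1) 1]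
    refine OracleTM.RunLe.trans (run_of_stepAux rfl ?_) h1
    rw [stepAux_popBits, stepAux_branch_true _ _ rfl, stepAux_pushOutput, stepAux_jump]
    rfl

end RingElem

end

section

/-! ### Binary expansions -/

theorem binFrac_nonneg (s : List Bool) : 0 ≤ binFrac s := by
  induction s with
  | nil => simp [binFrac]
  | cons b s ih => rw [binFrac]; split_ifs <;> positivity

theorem binFrac_le_one (s : List Bool) : binFrac s ≤ 1 := by
  induction s with
  | nil => simp [binFrac]
  | cons b s ih => rw [binFrac]; split_ifs <;> linarith

/-- The number of leading zeros of a binary expansion. -/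
def leadingZeros : List Bool → ℕ
  | false :: s => leadingZeros s + 1
  | _ => 0

theorem exists_eq_of_binFrac_pos {s : List Bool} (h : 0 < binFrac s) :
    ∃ e, s = List.replicate (leadingZeros s) false ++ true :: e := by
  induction s with
  | nil => simp [binFrac] at h
  | cons b s ih =>
    cases b
    · have : 0 < binFrac s := by
        rw [binFrac] at h
        simp only [Bool.false_eq_true, if_false, zero_add] at h
        linarith
      obtain ⟨e, he⟩ := ih this
      refine ⟨e, ?_⟩
      rw [leadingZeros, List.replicate_succ, List.cons_append, ← he]
    · exact ⟨s, rfl⟩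

theorem binFrac_zeros_append (p : ℕ) (s : List Bool) :
    binFrac (List.replicate p false ++ s) = binFrac s / 2 ^ p := by
  induction p with
  | zero => simp
  | succ p ih =>
    rw [List.replicate_succ, List.cons_append, binFrac, ih, pow_succ]
    simp only [Bool.false_eq_true, if_false, zero_add]
    rw [div_div]

/-- The binary expansion of the greatest power of two that is at most the given number. -/
def roundTol (s : List Bool) : List Bool := List.replicate (leadingZeros s) false ++ [true]

theorem binFrac_roundTol (s : List Bool) : binFrac (roundTol s) = (2 ^ (leadingZeros s + 1))⁻¹ := by
  rw [roundTol, binFrac_zeros_append, pow_succ]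
  simp only [binFrac, if_true, add_zero]
  rw [div_div, one_div, mul_comm]

theorem isTolerance_roundTol (s : List Bool) : IsTolerance (roundTol s) := by
  rw [IsTolerance, binFrac_roundTol]
  exact ⟨by positivity, inv_lt_one_of_one_lt₀ (one_lt_pow₀ one_lt_two (Nat.succ_ne_zero _))⟩

/-- The first inequality says that the oracle's guarantee is at least as strong as required, and the
second bounds the inverse of the rounded tolerance by `2 / ε`. -/
theorem binFrac_bounds {s : List Bool} (h : 0 < binFrac s) :
    binFrac (roundTol s) ≤ binFrac s ∧ (2 : ℝ) ^ leadingZeros s ≤ (binFrac s)⁻¹ := by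
  obtain ⟨e, he⟩ := exists_eq_of_binFrac_pos h
  have h0 := binFrac_nonneg e
  have h1 := binFrac_le_one e
  have hp : (0 : ℝ) < 2 ^ leadingZeros s := by positivity
  have hs : binFrac s = (1 + binFrac e) / 2 / 2 ^ leadingZeros s := by
    conv_lhs => rw [he]
    rw [binFrac_zeros_append, binFrac, if_pos rfl]
  constructor
  · rw [binFrac_roundTol, hs, pow_succ, mul_inv, mul_comm, ← div_eq_mul_inv]
    gcongr
    linarith
  · rw [le_inv_comm₀ hp h, hs, div_eq_mul_inv]
    exact mul_le_of_le_one_left (by positivity) (by linarith)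

theorem foldr_bit_bits (y : ℕ) : List.foldr Nat.bit 0 (Nat.bits y) = y := by
  induction y using Nat.binaryRec' with
  | zero => simp
  | bit b y hb ih => rw [Nat.bits_append_bit y b hb, List.foldr_cons, ih]

/-! ### Correctness and running time of the reduction -/

namespace RingElem

variable {Γ Δ : ConstraintLanguage} {d : ℕ} (E : RingElem Δ d) (h : Γ ⊆ Δ)

/-- A bound for the running time. -/
def time (x : List (CSPSym Γ)) (s : List Bool) : ℕ :=
  (5 * E.tokenBound + 50) * (x.length + (leadingZeros s + 1)) ^ 4

/-- The summands are the costs of the phases, with `L` the input length, `B` the bound on tokens,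
and `L * L` a bound for the counters. The largest term comes from writing up to `L` rings of `L`
elements, each token costing of order `L * L`. -/
theorem time_bound {B L n u p : ℕ} (hn : n ≤ L) (hu : u ≤ L) :
    (n + 1) + (u + 1) + (p + 1) + (n * (L * (B * (2 * (L * L) + 3) + 5)) + 1)
      + (u * (2 * (L * L) + 4) + (2 * (L * L) + 3)) + 1 + (1 + (L + 2) + (L + 2))
      ≤ (5 * B + 50) * (L + (p + 1)) ^ 4 := by
  have h1 : n * (L * (B * (2 * (L * L) + 3) + 5)) ≤ L * (L * (B * (2 * (L * L) + 3) + 5)) :=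
    Nat.mul_le_mul_right _ hn
  have h2 : u * (2 * (L * L) + 4) ≤ L * (2 * (L * L) + 4) := Nat.mul_le_mul_right _ hu
  set M := L + (p + 1) with hM
  have hLM : L ≤ M := by omega
  have hM1 : 1 ≤ M := by omega
  have hM2 : M ≤ M ^ 4 := Nat.le_self_pow (by norm_num) M
  have e1 : L ≤ M ^ 4 := hLM.trans hM2
  have e2 : L * L ≤ M ^ 4 := by
    calc L * L ≤ M * M := Nat.mul_le_mul hLM hLM
      _ = M ^ 2 := by ring
      _ ≤ M ^ 4 := Nat.pow_le_pow_right hM1 (by norm_num)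
  have e3 : L * (L * L) ≤ M ^ 4 := by
    calc L * (L * L) ≤ M * (M * M) := Nat.mul_le_mul hLM (Nat.mul_le_mul hLM hLM)
      _ = M ^ 3 := by ring
      _ ≤ M ^ 4 := Nat.pow_le_pow_right hM1 (by norm_num)
  have e4 : L * (L * (L * L)) ≤ M ^ 4 := by
    calc L * (L * (L * L)) ≤ M * (M * (M * M)) := by gcongr
      _ = M ^ 4 := by ring
  have hp : p + 1 ≤ M ^ 4 := le_trans (by omega) hM2
  have h3 : L * (L * (B * (2 * (L * L) + 3) + 5))
      = 2 * (B * (L * (L * (L * L)))) + 3 * (B * (L * L)) + 5 * (L * L) := by ring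
  have h4 : L * (2 * (L * L) + 4) = 2 * (L * (L * L)) + 4 * L := by ring
  have e5 : B * (L * (L * (L * L))) ≤ B * M ^ 4 := Nat.mul_le_mul_left _ e4
  have e6 : B * (L * L) ≤ B * M ^ 4 := Nat.mul_le_mul_left _ e2
  have h5 : (5 * B + 50) * M ^ 4 = 5 * (B * M ^ 4) + 50 * M ^ 4 := by ring
  rw [h5]
  rw [h3] at h1
  rw [h4] at h2
  -- With the monomials as atoms, the remaining inequality is linear.
  generalize n * (L * (B * (2 * (L * L) + 3) + 5)) = t1 at *
  generalize u * (2 * (L * L) + 4) = t2 at *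
  generalize B * (L * (L * (L * L))) = t3 at *
  generalize B * (L * L) = t4 at *
  generalize L * (L * L) = t5 at *
  generalize L * L = t6 at *
  generalize B * M ^ 4 = t7 at *
  generalize M ^ 4 = t8 at *
  omega

/-- The computation of the machine on an instance. -/
theorem exists_singleCall (I : CSPInstance Γ) {s : List Bool} (hs : 0 < binFrac s) {K : ℕ}
    (hK : I.encode.length = K + 1) (hn : I.n ≤ K) (ha : totalArity I.constraints ≤ K) :
    ∃ c : OracleTM.SingleCall (E.machine h) ((E.machine h).init I.encode s)
        (E.time I.encode s),
      (E.machine h).queryWord c.S = (E.ringInstance h I hn ha).encode ∧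
      (E.machine h).queryTol c.S = roundTol s ∧
      ∀ y, (E.machine h).output (c.final y) = List.foldr Nat.bit 0 ((Nat.bits y).take (K + 2)) := by
  obtain ⟨e, he⟩ := exists_eq_of_binFrac_pos hs
  set p := leadingZeros s with hp
  set u := consWord I.constraints with hu
  have hK' : I.n + u.length = K := by
    have : I.encode.length = I.n + 1 + u.length := by
      rw [CSPInstance.encode, List.length_append, hu, consWord]
      simp [unary]
    omega
  let s₀ : Mem (CSPSym Γ) (CSPSym Δ) :=
    ⟨unary Γ I.n ++ u, List.replicate p false ++ true :: e, [], [], [], [], [], [],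
      counters 0 0 0 0 0 0 0⟩
  have hinit : (E.machine h).init I.encode s = E.cfg h (base Base.readNum) s₀ := by
    have : (E.machine h).init I.encode s = (E.machine h).init (unary Γ I.n ++ u)
      (List.replicate p false ++ true :: e) := by rw [← he]; rfl
    rw [this]
    refine congrArg (Turing.TM2.Cfg.mk _ _) (funext fun k => ?_)
    rcases k with (_ | _) | (_ | _) | (_ | _) <;> rfl
  have r1 := run_readNum (E := E) (h := h) s₀ I.n 0 u
  have r2 := run_readBody (E := E) (h := h) { s₀ with delta := [true] } (0 + I.n) (0 + I.n) u []
  have r3 := run_tol (E := E) (h := h)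
    { s₀ with
      input := []
      rev := u.reverse ++ []
      cnt := counters (0 + I.n) (0 + I.n + u.length) 0 0 0 0 0 } p e [true]
  simp only [Nat.zero_add, hK', List.append_nil] at r1 r2 r3
  -- The indices `q` and `v` end at `n * (K + 1)`, so the square of the input length bounds every
  -- counter copied.
  have hX : I.n * (K + 1) ≤ (K + 1) * (K + 1) := Nat.mul_le_mul_right _ (by omega)
  have hX' : K + 1 ≤ (K + 1) * (K + 1) := Nat.le_mul_of_pos_left _ (Nat.succ_pos K)
  have r4 := run_outer (E := E) (h := h) (X := (K + 1) * (K + 1)) (K := K)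
    { s₀ with
      input := []
      eps := e
      delta := List.replicate p false ++ [true]
      rev := u.reverse } [] I.n 0 (by rwa [Nat.zero_add])
  have r5 := run_stream (E := E) (h := h) (X := (K + 1) * (K + 1)) (K := K)
    { s₀ with
      input := []
      eps := e
      delta := List.replicate p false ++ [true] } (E.ringWord K I.n)
      (I.n * (K + 1)) (I.n * (K + 1)) u.reverse [] (by omega)
      (by simp only [List.length_reverse, List.length_nil]; omega) hX
  simp only [Nat.zero_add, Nat.zero_mul, List.append_nil, List.reverse_reverse, useWord,
    terminators, List.nil_append, ringWord, List.length_reverse] at r4 r5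
  have run := (((r1.trans r2).trans r3).trans r4).trans r5
  rw [← encode_ringInstance E h I hn ha] at run
  set s₁ : Mem (CSPSym Γ) (CSPSym Δ) :=
    { s₀ with
      input := []
      eps := e
      delta := List.replicate p false ++ [true]
      rev := []
      query := (E.ringInstance h I hn ha).encode
      cnt := counters 0 K 0 (I.n * (K + 1)) (I.n * (K + 1)) 0 (terminators u) } with hs₁
  have hafter : ∀ y, ∃ c' : (E.machine h).Cfg,
      (E.machine h).RunLe (1 + ((K + 1) + 2) + ((K + 1) + 2))
        ⟨some (base Base.cap), none, (E.machine h).receive s₁.stk y⟩ c' ∧ c'.l = none ∧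
      (E.machine h).output c' = List.foldr Nat.bit 0 ((Nat.bits y).take (K + 2)) := by
    intro y
    let s₂ : Mem (CSPSym Γ) (CSPSym Δ) :=
      { s₁ with query := [], delta := [], answer := Nat.bits y }
    have hrec : (E.machine h).receive s₁.stk y = s₂.stk := by
      refine (congrArg (fun S => Function.update (Function.update S (Sum.inl Port.delta) [])
        (Sum.inl Port.answer) (Nat.bits y)) (s₁.update_query [])).trans ?_
      refine (congrArg (fun S => Function.update S (Sum.inl Port.answer) (Nat.bits y))
        (Mem.update_delta _ [])).trans ?_
      exact Mem.update_answer _ _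
    have q1 : (E.machine h).RunLe 1 (E.cfg h (base Base.cap) s₂)
        (E.cfg h (base Base.ans)
          { s₂ with
            answer := Nat.bits y
            bits := []
            cnt := counters 0 (K + 2) 0 (I.n * (K + 1)) (I.n * (K + 1)) 0 (terminators u) }) := by
      refine run_of_stepAux rfl ?_
      rw [stepAux_pushCtr, stepAux_pushCtr, stepAux_jump]
      simp only [s₂, hs₁, update_counters_lc]
      rfl
    obtain ⟨s₃, ho, hb, q2⟩ := run_ans (E := E) (h := h) s₂ (K + 2) (I.n * (K + 1))
      (I.n * (K + 1)) (terminators u) (Nat.bits y) []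
    have q3 := run_fin (E := E) (h := h) s₃ s₃.bits s₃.output
    refine ⟨⟨none, none,
      { s₃ with bits := [], output := s₃.bits.reverse ++ s₃.output }.stk⟩, ?_, rfl, ?_⟩
    · rw [hrec]
      exact (q1.trans q2).trans (q3.mono (by
        have : s₃.bits.length ≤ K + 2 := by
          rw [hb]
          simp
        omega))
    · have : s₃.bits.reverse ++ s₃.output = (Nat.bits y).take (K + 2) := by
        rw [hb, ho]
        simp [s₂, hs₁, s₀]
      exact congrArg (List.foldr Nat.bit 0) this
  choose fin hf1 hf2 hf3 using hafter
  refine ⟨⟨(I.n + 1) + (u.length + 1) + (p + 1)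
      + (I.n * ((K + 1) * (E.tokenBound * (2 * ((K + 1) * (K + 1)) + 3) + 5)) + 1)
      + (u.length * (2 * ((K + 1) * (K + 1)) + 4) + (2 * ((K + 1) * (K + 1)) + 3)),
    1 + ((K + 1) + 2) + ((K + 1) + 2), ?_, base Base.ask, base Base.cap, none, s₁.stk, fin, rfl,
    ?_, hf1, hf2⟩, rfl, ?_, hf3⟩
  · rw [time, hK]
    exact time_bound (by omega) (by omega)
  · rw [hinit]
    exact run
  · rfl

/-- With a single call and an unchanged count, the event that the oracle's answer is good is
contained in the event that the output is good. -/
theorem isAPReduction_machine :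
    IsAPReduction (sharpCSP Γ) (sharpCSPd d Δ) (E.machine h) := by
  have hlen : ∀ I : CSPInstance Γ, ∃ K, I.encode.length = K + 1 ∧ I.n ≤ K ∧
      totalArity I.constraints ≤ K := by
    intro I
    -- The input has one symbol more than this: the terminator after the number of variables, which
    -- the machine does not count.
    refine ⟨I.n + (consWord I.constraints).length, ?_, by omega, ?_⟩
    · rw [CSPInstance.encode, List.length_append, consWord]
      simp [unary]
      omega
    · rw [← terminators_consWord]
      exact (terminators_le_length _).trans (by omega)
  refine ⟨E.time, 5 * E.tokenBound + 50, 4, ?_, ?_, ?_⟩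
  · intro I s hs c hc hcall
    obtain ⟨K, hK, hn, ha⟩ := hlen I
    obtain ⟨sc, hq, ht, -⟩ := E.exists_singleCall h I hs.1 hK hn ha
    have hstk := sc.stk_eq_of_isCall hc hcall
    have hq' := (congrArg (E.machine h).queryWord hstk).trans hq
    have ht' := (congrArg (E.machine h).queryTol hstk).trans ht
    refine ⟨⟨⟨_, E.degree_ringInstance h I hn ha⟩, hq'⟩, ht' ▸ isTolerance_roundTol s, ?_⟩
    refine (congrArg (fun t => (binFrac t)⁻¹) ht').trans_le ?_
    have h1 := (binFrac_bounds hs.1).2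
    rw [binFrac_roundTol, inv_inv, pow_succ]
    have h2 : (1 : ℝ) ≤ (binFrac s)⁻¹ := (one_le_inv₀ hs.1).2 hs.2.le
    have h3 : (binFrac s)⁻¹ ≤ (((sharpCSP Γ).encode I).length + (binFrac s)⁻¹) ^ 4 := by
      refine le_trans ?_ (le_self_pow₀ ?_ (by norm_num))
      · exact le_add_of_nonneg_left (Nat.cast_nonneg _)
      · exact h2.trans (le_add_of_nonneg_left (Nat.cast_nonneg _))
    have h4 : (2 : ℝ) ≤ ((5 * E.tokenBound + 50 : ℕ) : ℝ) := by
      exact_mod_cast (show 2 ≤ 5 * E.tokenBound + 50 by omega)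
    calc (2 : ℝ) ^ leadingZeros s * 2 = 2 * 2 ^ leadingZeros s := mul_comm _ _
      _ ≤ _ := mul_le_mul h4 (h1.trans h3) (by positivity) (by positivity)
  · intro O hO I s hs
    obtain ⟨K, hK, hn, ha⟩ := hlen I
    obtain ⟨sc, hq, ht, hout⟩ := E.exists_singleCall h I hs.1 hK hn ha
    have hZ : (E.ringInstance h I hn ha).Z = I.Z := E.Z_ringInstance h I hn ha
    have hras := hO ⟨_, E.degree_ringInstance h I hn ha⟩ (roundTol s) (isTolerance_roundTol s)
    have hle := (binFrac_bounds hs.1).1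
    have hdist := sc.runDist_map_output O
    rw [hq, ht] at hdist
    refine le_of_le_of_eq ?_ (congrArg (fun P : PMF ℕ => P.toOuterMeasure
      {Y : ℕ | Real.exp (-binFrac s) * (I.Z : ℝ) ≤ Y ∧
        (Y : ℝ) ≤ Real.exp (binFrac s) * (I.Z : ℝ)}) hdist.symm)
    rw [PMF.toOuterMeasure_map_apply]
    refine hras.trans (MeasureTheory.measure_mono ?_)
    rintro y ⟨hy1, hy2⟩
    change Real.exp (-binFrac (roundTol s)) * ((E.ringInstance h I hn ha).Z : ℝ) ≤ y at hy1
    change (y : ℝ) ≤ Real.exp (binFrac (roundTol s)) * ((E.ringInstance h I hn ha).Z : ℝ) at hy2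
    rw [hZ] at hy1 hy2
    have hZ0 : (0 : ℝ) ≤ I.Z := Nat.cast_nonneg _
    have hZle : I.Z ≤ 2 ^ I.n := by
      refine (Nat.card_le_card_of_injective _ Subtype.val_injective).trans ?_
      simp
    -- A good answer is at most `e ^ δ * 2 ^ n < 4 * 2 ^ K`, so the `K + 2` copied bits contain all
    -- of it. Answers that are cut off are not good, and nothing is required of them.
    have hylt : y < 2 ^ (K + 2) := by
      have h1 : Real.exp (binFrac (roundTol s)) < 4 := by
        have h1 := Real.exp_le_exp.2 (binFrac_le_one (roundTol s))
        have := Real.exp_one_lt_d9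
        linarith
      have h2 : (I.Z : ℝ) ≤ 2 ^ I.n := by exact_mod_cast hZle
      have h3 : (2 : ℝ) ^ I.n ≤ 2 ^ K := pow_le_pow_right₀ one_le_two hn
      have h4 : (y : ℝ) < 2 ^ (K + 2) := by
        calc (y : ℝ) ≤ Real.exp (binFrac (roundTol s)) * I.Z := hy2
          _ ≤ Real.exp (binFrac (roundTol s)) * 2 ^ K :=
            mul_le_mul_of_nonneg_left (h2.trans h3) (Real.exp_pos _).le
          _ < 4 * 2 ^ K := mul_lt_mul_of_pos_right h1 (by positivity)
          _ = 2 ^ (K + 2) := by ring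
      exact_mod_cast h4
    have htake : (Nat.bits y).take (K + 2) = Nat.bits y := by
      refine List.take_of_length_le ?_
      rw [Nat.size_eq_bits_len]
      exact Nat.size_le.2 hylt
    have hy : (E.machine h).output (sc.final y) = y := by
      rw [hout, htake, foldr_bit_bits]
    simp only [Set.mem_preimage, Set.mem_ofPred_eq, hy]
    constructor
    · exact (mul_le_mul_of_nonneg_right (Real.exp_le_exp.2 (neg_le_neg hle)) hZ0).trans hy1
    · exact hy2.trans (mul_le_mul_of_nonneg_right (Real.exp_le_exp.2 hle) hZ0)
  · intro I s hs
    obtain ⟨K, hK, hn, ha⟩ := hlen I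
    obtain ⟨sc, -⟩ := E.exists_singleCall h I hs.1 hK hn ha
    refine ⟨sc.haltsWithin, ?_⟩
    have h1 := (binFrac_bounds hs.1).2
    -- The number of leading zeros is only logarithmic in the inverse tolerance, and later digits of
    -- `s` are never read; hence the length of `s` does not enter the running time.
    have h2 : ((leadingZeros s + 1 : ℕ) : ℝ) ≤ (binFrac s)⁻¹ := by
      refine le_trans ?_ h1
      exact_mod_cast Nat.lt_two_pow_self
    have h3 : (E.time I.encode s : ℝ) = ((5 * E.tokenBound + 50 : ℕ) : ℝ)
        * (I.encode.length + ((leadingZeros s + 1 : ℕ) : ℝ)) ^ 4 := by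
      rw [time]
      push_cast
      rfl
    refine h3.trans_le (mul_le_mul_of_nonneg_left (pow_le_pow_left₀ (by positivity) ?_ 4)
      (Nat.cast_nonneg _))
    exact add_le_add_right h2 _

end RingElem

end

end BoolCSP

end

theorem mainTheorem4 (Γ : BoolCSP.ConstraintLanguage) (d : ℕ)
    (h : BoolCSP.SimulatesEquality Γ d) :
    BoolCSP.APReducible (BoolCSP.sharpCSP Γ)
      (BoolCSP.sharpCSPd d (Γ ∪ BoolCSP.pinLanguage)) := by
  obtain ⟨E⟩ := BoolCSP.exists_ringElem h
  exact ⟨_, E.isAPReduction_machine Finset.subset_union_left⟩
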